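/- Let $Q$ be a finite quiver with vertex set $I$ and edge set $E$ (loops and multiple edges are allowed). A double quiver representation is a family $V_\bullet=(V_i)_{i\in I}$ of finite-dimensional complex vector spaces with linear maps $X_e:V_i\to V_j$, $Y_e:V_j\to V_i$ for every edge $e=\overrightarrow{ij}$; a framed one, with framing spaces $W_\bullet$, carries in addition linear maps $A_i:W_i\to V_i$ and $B_i:V_i\to W_i$. It is stable if no family of subspaces of $V_\bullet$, other than $V_\bullet$ itself, is preserved by all $X_e,Y_e$ and contains all $\operatorname{Im}A_i$. Let $\mathcal M_{\boldsymbol v,\boldsymbol w}$ be the Nakajima quiver variety: stable framed representations with $\dim V_i=v_i$, $\dim W_i=w_i$ and $\sum_e (X_eY_e-Y_eX_e)+\sum_i A_iB_i=0$, modulo $\prod_i GL(V_i)$. Let $\mathfrak Y_{\boldsymbol n}$ be the stack of double quiver representations of dimension $\boldsymbol n$ with $\sum_e (X_eY_e-Y_eX_e)=0$, and let $\mathcal N_{\boldsymbol v,\boldsymbol v+\boldsymbol n,\boldsymbol w}$ be the stack of short exact sequences $0\to K_\bullet\to V^+_\bullet\to V^-_\bullet\to 0$ with $K_\bullet\in\mathfrak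 Y_{\boldsymbol n}$ and with $V^+_\bullet\to V^-_\bullet$ a map of framed representations, $V^+_\bullet\in\mathcal M_{\boldsymbol v+\boldsymbol n,\boldsymbol w}$, $V^-_\bullet\in\mathcal M_{\boldsymbol v,\boldsymbol w}$. Fix $\boldsymbol v,\boldsymbol w',\boldsymbol w''\in\mathbb N^I$, put $\boldsymbol w=\boldsymbol w'+\boldsymbol w''$, $W_\bullet=W'_\bullet\oplus W''_\bullet$ with $\dim W'_i=w'_i$, $\dim W''_i=w''_i$, and $X=\mathcal M_{\boldsymbol v,\boldsymbol w}$ with its classical topology. The torus $A=\mathbb C^*$ acts on $X$ by $t\cdot(X_e,Y_e,A_i,B_i)=(X_e,Y_e,A_iU_i(t)^{-1},U_i(t)B_i)$, where $U_i(t)=t\,\mathrm{Id}_{W'_i}\oplus\mathrm{Id}_{W''_i}$. A closed flow line from $q\in X^A$ to $p\in X^A$ is a copy of $\mathbb P^1$ in $X$ which is the closure of the orbit of a point $x\in X$, with $\lim_{t\to0}t\cdot x=p$ and $\lim_{t\to\infty}t\cdot x=q$ (in particular the orbit is not a single point). The full attracting set $\mathrm{Attr}^f\subset X^A\times X$ is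 the smallest closed $A$-invariant subset which contains the diagonal $\{(p,p)\}_{p\in X^A}$ and is such that $(p,p')\in\mathrm{Attr}^f$ and $\lim_{t\to0}t\cdot x=p'$ imply $(p,x)\in\mathrm{Attr}^f$. Then the following hold. (1) The map $(V'_\bullet,V''_\bullet)\mapsto V'_\bullet\oplus V''_\bullet$ is a bijection $\bigsqcup_{\boldsymbol v'+\boldsymbol v''=\boldsymbol v}\mathcal M_{\boldsymbol v',\boldsymbol w'}\times\mathcal M_{\boldsymbol v'',\boldsymbol w''}\to X^A$. By means of it, points of $X^A$ are denoted as pairs $(V'_\bullet,V''_\bullet)$. (2) For $(\widetilde V'_\bullet,\widetilde V''_\bullet)$ and $(V'_\bullet,V''_\bullet)$ in $X^A$, the following three conditions are equivalent: (a) there is a closed flow line from $(\widetilde V'_\bullet,\widetilde V''_\bullet)$ to $(V'_\bullet,V''_\bullet)$; (b) there are surjective maps of framed double quiver representations $\pi':V'_\bullet\twoheadrightarrow\widetilde V'_\bullet$ and $\pi'':\widetilde V''_\bullet\twoheadrightarrow V''_\bullet$ (the identity on the framing spaces $W'_\bullet$ and $W''_\bullet$, respectively) whose kernels are non-zero and isomorphic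 as double quiver representations; (c) for some $\boldsymbol n\in\mathbb N^I\setminus\{\boldsymbol 0\}$ there are points of $\mathcal N_{\boldsymbol v'-\boldsymbol n,\boldsymbol v',\boldsymbol w'}$ and $\mathcal N_{\boldsymbol v'',\boldsymbol v''+\boldsymbol n,\boldsymbol w''}$ lying over $(\widetilde V'_\bullet,V'_\bullet)$ and $(V''_\bullet,\widetilde V''_\bullet)$, respectively, with the same image in $\mathfrak Y_{\boldsymbol n}$; here $\boldsymbol v'=\dim V'_\bullet$, $\boldsymbol v''=\dim V''_\bullet$, $\dim\widetilde V'_\bullet=\boldsymbol v'-\boldsymbol n$ and $\dim\widetilde V''_\bullet=\boldsymbol v''+\boldsymbol n$. (3) For $(V'_\bullet,V''_\bullet)\in X^A$ and $V_\bullet\in X$, one has $\big((V'_\bullet,V''_\bullet),V_\bullet\big)\in\mathrm{Attr}^f$ if and only if there are linear maps $V'_\bullet\xrightarrow{f}V_\bullet\xrightarrow{g}V''_\bullet$ such that - $g\circ f=0$; - $f$ and $g$ commute with the maps $X,Y$, and commute with the maps $A,B$ via the inclusion $W'_\bullet\hookrightarrow W_\bullet$ and the projection $W_\bullet\twoheadrightarrow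 W''_\bullet$, respectively; - for some $k\ge0$ there are chains of surjective maps of double quiver representations $V'_\bullet=E^0_\bullet\twoheadrightarrow E^1_\bullet\twoheadrightarrow\cdots\twoheadrightarrow E^k_\bullet=\operatorname{Im}f$ and $V_\bullet/\operatorname{Im}f=F^k_\bullet\twoheadrightarrow\cdots\twoheadrightarrow F^1_\bullet\twoheadrightarrow F^0_\bullet=V''_\bullet$, whose compositions are the maps induced by $f$ and $g$, such that for every $0\le l<k$ the kernels of $E^l_\bullet\twoheadrightarrow E^{l+1}_\bullet$ and $F^{l+1}_\bullet\twoheadrightarrow F^l_\bullet$ are isomorphic double quiver representations. -/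

import Mathlib

open Filter Topology

namespace QuiverVariety

section Representations

variable {I : Type*} [Quiver I]

/-- A double quiver representation on the family of complex vector spaces `V`: maps `X e` and `Y e`
in both directions along every arrow `e` of the quiver (loops and multiple arrows are allowed). -/
@[ext]
structure DoubleRep (V : I → Type*) [∀ i, AddCommGroup (V i)] [∀ i, Module ℂ (V i)] where
  X : ∀ {i j : I}, (i ⟶ j) → (V i →ₗ[ℂ] V j)
  Y : ∀ {i j : I}, (i ⟶ j) → (V j →ₗ[ℂ] V i)

/-- A framed double quiver representation on `V` with framing spaces `W`. -/
@[ext]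
structure FramedRep (V W : I → Type*) [∀ i, AddCommGroup (V i)] [∀ i, Module ℂ (V i)]
    [∀ i, AddCommGroup (W i)] [∀ i, Module ℂ (W i)] extends DoubleRep V where
  A : ∀ i, W i →ₗ[ℂ] V i
  B : ∀ i, V i →ₗ[ℂ] W i

variable {V V₁ V₂ V' V'' W W₁ W₂ W' W'' : I → Type*}
  [∀ i, AddCommGroup (V i)] [∀ i, Module ℂ (V i)]
  [∀ i, AddCommGroup (V₁ i)] [∀ i, Module ℂ (V₁ i)]
  [∀ i, AddCommGroup (V₂ i)] [∀ i, Module ℂ (V₂ i)]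
  [∀ i, AddCommGroup (V' i)] [∀ i, Module ℂ (V' i)]
  [∀ i, AddCommGroup (V'' i)] [∀ i, Module ℂ (V'' i)]
  [∀ i, AddCommGroup (W i)] [∀ i, Module ℂ (W i)]
  [∀ i, AddCommGroup (W₁ i)] [∀ i, Module ℂ (W₁ i)]
  [∀ i, AddCommGroup (W₂ i)] [∀ i, Module ℂ (W₂ i)]
  [∀ i, AddCommGroup (W' i)] [∀ i, Module ℂ (W' i)]
  [∀ i, AddCommGroup (W'' i)] [∀ i, Module ℂ (W'' i)]

/-- A subrepresentation: subspaces preserved by all the maps `X` and `Y`. -/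
@[ext]
structure SubRep (R : DoubleRep V) where
  carrier : ∀ i, Submodule ℂ (V i)
  X_mem : ∀ {i j : I} (e : i ⟶ j), ∀ x ∈ carrier i, R.X e x ∈ carrier j
  Y_mem : ∀ {i j : I} (e : i ⟶ j), ∀ x ∈ carrier j, R.Y e x ∈ carrier i

instance (R : DoubleRep V) : LE (SubRep R) := ⟨fun K L => ∀ i, K.carrier i ≤ L.carrier i⟩

instance (R : DoubleRep V) : Bot (SubRep R) where
  bot :=
    { carrier := fun _ => ⊥
      X_mem := by intro i j e x hx; simp_all
      Y_mem := by intro i j e x hx; simp_all }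

/-- A subrepresentation as a representation in its own right. -/
def SubRep.toRep {R : DoubleRep V} (K : SubRep R) : DoubleRep (fun i => K.carrier i) where
  X e := (R.X e).restrict (K.X_mem e)
  Y e := (R.Y e).restrict (K.Y_mem e)

/-- The quotient of a representation by a subrepresentation. -/
def SubRep.quotient {R : DoubleRep V} (K : SubRep R) :
    DoubleRep (fun i => V i ⧸ K.carrier i) where
  X {i j} e := (K.carrier i).mapQ (K.carrier j) (R.X e) (K.X_mem e)
  Y {i j} e := (K.carrier j).mapQ (K.carrier i) (R.Y e) (K.Y_mem e)

/-- Morphisms of double quiver representations. -/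
structure Hom (R : DoubleRep V₁) (S : DoubleRep V₂) where
  toFun : ∀ i, V₁ i →ₗ[ℂ] V₂ i
  comm_X : ∀ {i j : I} (e : i ⟶ j) (x : V₁ i), toFun j (R.X e x) = S.X e (toFun i x)
  comm_Y : ∀ {i j : I} (e : i ⟶ j) (x : V₁ j), toFun i (R.Y e x) = S.Y e (toFun j x)

/-- A morphism is surjective if it is so at every vertex. -/
def Hom.Surjective {R : DoubleRep V₁} {S : DoubleRep V₂} (φ : Hom R S) : Prop :=
  ∀ i, Function.Surjective (φ.toFun i)

/-- Isomorphism of double quiver representations. -/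
def DoubleRep.Isomorphic (R : DoubleRep V₁) (S : DoubleRep V₂) : Prop :=
  ∃ φ : Hom R S, ∀ i, Function.Bijective (φ.toFun i)

/-- The kernel of a morphism. -/
def Hom.ker {R : DoubleRep V₁} {S : DoubleRep V₂} (φ : Hom R S) : SubRep R where
  carrier i := LinearMap.ker (φ.toFun i)
  X_mem := by
    intro i j e x hx
    rw [LinearMap.mem_ker] at hx ⊢
    rw [φ.comm_X, hx, map_zero]
  Y_mem := by
    intro i j e x hx
    rw [LinearMap.mem_ker] at hx ⊢
    rw [φ.comm_Y, hx, map_zero]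

/-- The image of a morphism. -/
def Hom.range {R : DoubleRep V₁} {S : DoubleRep V₂} (φ : Hom R S) : SubRep S where
  carrier i := LinearMap.range (φ.toFun i)
  X_mem := by
    rintro i j e _ ⟨x, rfl⟩
    exact ⟨R.X e x, φ.comm_X e x⟩
  Y_mem := by
    rintro i j e _ ⟨x, rfl⟩
    exact ⟨R.Y e x, φ.comm_Y e x⟩

/-- The canonical map `V / K → V / L` for subrepresentations `K ≤ L` of `V`. -/
def SubRep.factor {R : DoubleRep V} {K L : SubRep R} (h : K ≤ L) :
    Hom K.quotient L.quotient where
  toFun i := (K.carrier i).mapQ (L.carrier i) LinearMap.id (h i)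
  comm_X := by
    intro i j e x
    induction x using Submodule.Quotient.induction_on with
    | _ x => simp [SubRep.quotient]
  comm_Y := by
    intro i j e x
    induction x using Submodule.Quotient.induction_on with
    | _ x => simp [SubRep.quotient]

/-- The map `V / Im f → V''` induced by a morphism `g : V → V''` with `g ∘ f = 0`. -/
def Hom.descend {R₁ : DoubleRep V₁} {R : DoubleRep V} {S : DoubleRep V₂}
    (f : Hom R₁ R) (g : Hom R S) (h : ∀ i x, g.toFun i (f.toFun i x) = 0) :
    Hom f.range.quotient S where
  toFun i := (f.range.carrier i).liftQ (g.toFun i) (by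
    rintro _ ⟨x, rfl⟩
    exact h i x)
  comm_X := by
    intro i j e x
    induction x using Submodule.Quotient.induction_on with
    | _ x => simpa [SubRep.quotient] using g.comm_X e x
  comm_Y := by
    intro i j e x
    induction x using Submodule.Quotient.induction_on with
    | _ x => simpa [SubRep.quotient] using g.comm_Y e x

/-- Morphisms of framed double quiver representations lying over given linear maps `α` between the
framing spaces: they commute with `X`, `Y`, and with `A`, `B` via `α`. -/
structure FramedHom (R : FramedRep V₁ W₁) (S : FramedRep V₂ W₂) (α : ∀ i, W₁ i →ₗ[ℂ] W₂ i)
    extends Hom R.toDoubleRep S.toDoubleRep where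
  comm_A : ∀ i (w : W₁ i), toFun i (R.A i w) = S.A i (α i w)
  comm_B : ∀ i (x : V₁ i), S.B i (toFun i x) = α i (R.B i x)

/-- Stability: no family of subspaces, other than all of `V`, is preserved by the maps `X`, `Y`
and contains the images of the maps `A`. -/
def FramedRep.IsStable (R : FramedRep V W) : Prop :=
  ∀ K : SubRep R.toDoubleRep, (∀ i w, R.A i w ∈ K.carrier i) → ∀ i, K.carrier i = ⊤

/-- The component at the vertex `i` of `∑ₑ (Xₑ Yₑ - Yₑ Xₑ)`. -/
noncomputable def DoubleRep.moment [Fintype I] [∀ i j : I, Fintype (i ⟶ j)] (R : DoubleRep V)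
    (i : I) : V i →ₗ[ℂ] V i :=
  (∑ j, ∑ e : (j ⟶ i), R.X e ∘ₗ R.Y e) - ∑ j, ∑ e : (i ⟶ j), R.Y e ∘ₗ R.X e

/-- The component at the vertex `i` of the moment map `∑ₑ (Xₑ Yₑ - Yₑ Xₑ) + ∑ᵢ Aᵢ Bᵢ`. -/
noncomputable def FramedRep.moment [Fintype I] [∀ i j : I, Fintype (i ⟶ j)] (R : FramedRep V W)
    (i : I) : V i →ₗ[ℂ] V i :=
  R.toDoubleRep.moment i + R.A i ∘ₗ R.B i

/-- Transport of structure along linear isomorphisms; for `V₁ = V₂` this is the action of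
`∏ᵢ GL(Vᵢ)`. -/
def DoubleRep.transport (R : DoubleRep V₁) (g : ∀ i, V₁ i ≃ₗ[ℂ] V₂ i) : DoubleRep V₂ where
  X {i j} e := (g j).toLinearMap ∘ₗ R.X e ∘ₗ (g i).symm.toLinearMap
  Y {i j} e := (g i).toLinearMap ∘ₗ R.Y e ∘ₗ (g j).symm.toLinearMap

/-- Transport of structure along linear isomorphisms; for `V₁ = V₂` this is the action of
`∏ᵢ GL(Vᵢ)`: conjugation of `X`, `Y`, left multiplication of `A`, right multiplication of `B`. -/
def FramedRep.transport (R : FramedRep V₁ W) (g : ∀ i, V₁ i ≃ₗ[ℂ] V₂ i) : FramedRep V₂ W where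
  toDoubleRep := R.toDoubleRep.transport g
  A i := (g i).toLinearMap ∘ₗ R.A i
  B i := R.B i ∘ₗ (g i).symm.toLinearMap

/-- The action of `∏ᵢ GL(Wᵢ)`: `(X, Y, A, B) ↦ (X, Y, A U⁻¹, U B)`. -/
def FramedRep.reframe (R : FramedRep V W) (U : ∀ i, W i ≃ₗ[ℂ] W i) : FramedRep V W where
  toDoubleRep := R.toDoubleRep
  A i := R.A i ∘ₗ (U i).symm.toLinearMap
  B i := (U i).toLinearMap ∘ₗ R.B i

/-- The family of direct sums `W'ᵢ ⊕ W''ᵢ`. -/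
abbrev FSum (W' W'' : I → Type*) : I → Type _ := fun i => W' i × W'' i

/-- The direct sum of framed representations, with framing `W' ⊕ W''`. -/
def FramedRep.directSum (R' : FramedRep V' W') (R'' : FramedRep V'' W'') :
    FramedRep (FSum V' V'') (FSum W' W'') where
  X e := (R'.X e).prodMap (R''.X e)
  Y e := (R'.Y e).prodMap (R''.Y e)
  A i := (R'.A i).prodMap (R''.A i)
  B i := (R'.B i).prodMap (R''.B i)

/-- The topology of pointwise convergence, i.e. (when `V`, `W` are finite-dimensional) the classical
topology of the complex affine space of framed double quiver representations. -/
instance [∀ i, TopologicalSpace (V i)] [∀ i, TopologicalSpace (W i)] :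
    TopologicalSpace (FramedRep V W) :=
  TopologicalSpace.induced
    (fun R : FramedRep V W =>
      ((fun (i j : I) (e : i ⟶ j) (x : V i) => R.X e x,
        fun (i j : I) (e : i ⟶ j) (x : V j) => R.Y e x,
        fun (i : I) (w : W i) => R.A i w,
        fun (i : I) (x : V i) => R.B i x) :
        (∀ i j : I, (i ⟶ j) → V i → V j) × (∀ i j : I, (i ⟶ j) → V j → V i) ×
          (∀ i, W i → V i) × (∀ i, V i → W i)))
    inferInstance

theorem FramedRep.IsStable.transport {R : FramedRep V₁ W} (h : R.IsStable)
    (g : ∀ i, V₁ i ≃ₗ[ℂ] V₂ i) : (R.transport g).IsStable := by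
  intro K hK i
  have key := h
    { carrier := fun i => (K.carrier i).comap (g i).toLinearMap
      X_mem := by
        intro i j e x hx
        have := K.X_mem e _ hx
        simpa [FramedRep.transport, DoubleRep.transport] using this
      Y_mem := by
        intro i j e x hx
        have := K.Y_mem e _ hx
        simpa [FramedRep.transport, DoubleRep.transport] using this }
    (fun i w => hK i w) i
  rw [eq_top_iff]
  intro y _
  have : (g i).symm y ∈ (K.carrier i).comap (g i).toLinearMap := by
    rw [show (K.carrier i).comap (g i).toLinearMap = ⊤ from key]; trivial
  simpa using this

theorem FramedRep.IsStable.reframe {R : FramedRep V W} (h : R.IsStable)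
    (U : ∀ i, W i ≃ₗ[ℂ] W i) : (R.reframe U).IsStable := by
  intro K hK
  refine h ⟨K.carrier, K.X_mem, K.Y_mem⟩ (fun i w => ?_)
  simpa [FramedRep.reframe] using hK i (U i w)

theorem FramedRep.IsStable.directSum {R' : FramedRep V' W'} {R'' : FramedRep V'' W''}
    (h' : R'.IsStable) (h'' : R''.IsStable) : (R'.directSum R'').IsStable := by
  intro K hK i
  have k' := h'
    { carrier := fun i => (K.carrier i).comap (LinearMap.inl ℂ (V' i) (V'' i))
      X_mem := by
        intro i j e x hx
        have := K.X_mem e _ hx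
        simpa [FramedRep.directSum] using this
      Y_mem := by
        intro i j e x hx
        have := K.Y_mem e _ hx
        simpa [FramedRep.directSum] using this }
    (fun i w => by simpa [FramedRep.directSum] using hK i (w, 0)) i
  have k'' := h''
    { carrier := fun i => (K.carrier i).comap (LinearMap.inr ℂ (V' i) (V'' i))
      X_mem := by
        intro i j e x hx
        have := K.X_mem e _ hx
        simpa [FramedRep.directSum] using this
      Y_mem := by
        intro i j e x hx
        have := K.Y_mem e _ hx
        simpa [FramedRep.directSum] using this }
    (fun i w => by simpa [FramedRep.directSum] using hK i (0, w)) i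
  rw [eq_top_iff]
  rintro ⟨x, y⟩ _
  have hx : x ∈ (K.carrier i).comap (LinearMap.inl ℂ (V' i) (V'' i)) := by
    rw [show (K.carrier i).comap (LinearMap.inl ℂ (V' i) (V'' i)) = ⊤ from k']; trivial
  have hy : y ∈ (K.carrier i).comap (LinearMap.inr ℂ (V' i) (V'' i)) := by
    rw [show (K.carrier i).comap (LinearMap.inr ℂ (V' i) (V'' i)) = ⊤ from k'']; trivial
  have := (K.carrier i).add_mem hx hy
  simpa using this

/-- The one-parameter subgroup `t ↦ diag(t, 1)` of `∏ᵢ GL(W'ᵢ ⊕ W''ᵢ)`. -/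
def torus (W' W'' : I → Type*) [∀ i, AddCommGroup (W' i)] [∀ i, Module ℂ (W' i)]
    [∀ i, AddCommGroup (W'' i)] [∀ i, Module ℂ (W'' i)] (t : ℂˣ) (i : I) :
    FSum W' W'' i ≃ₗ[ℂ] FSum W' W'' i :=
  LinearEquiv.prodCongr (LinearEquiv.smulOfUnit t) (LinearEquiv.refl ℂ (W'' i))

theorem reframe_torus_one (R : FramedRep V (FSum W' W'')) :
    R.reframe (torus W' W'' 1) = R := by
  have h : ∀ i, torus W' W'' 1 i = LinearEquiv.refl ℂ _ := by
    intro i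
    ext x <;> simp [torus, LinearEquiv.smulOfUnit]
  obtain ⟨D, A, B⟩ := R
  simp only [FramedRep.reframe, h]
  rfl

theorem reframe_torus_mul (R : FramedRep V (FSum W' W'')) (s t : ℂˣ) :
    R.reframe (torus W' W'' (s * t)) =
      (R.reframe (torus W' W'' t)).reframe (torus W' W'' s) := by
  have h : ∀ i, torus W' W'' (s * t) i = (torus W' W'' t i).trans (torus W' W'' s i) := by
    intro i
    ext x <;> simp [torus, LinearEquiv.smulOfUnit, mul_smul]
  obtain ⟨D, A, B⟩ := R
  simp only [FramedRep.reframe, h]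
  rfl

variable [Fintype I] [∀ i j : I, Fintype (i ⟶ j)]

theorem FramedRep.moment_transport {R : FramedRep V₁ W} (h : ∀ i, R.moment i = 0)
    (g : ∀ i, V₁ i ≃ₗ[ℂ] V₂ i) (i : I) : (R.transport g).moment i = 0 := by
  ext x
  have := congrArg (g i) (LinearMap.congr_fun (h i) ((g i).symm x))
  simpa [FramedRep.moment, DoubleRep.moment, FramedRep.transport, DoubleRep.transport,
    LinearMap.sum_apply] using this

theorem FramedRep.moment_reframe {R : FramedRep V W} (h : ∀ i, R.moment i = 0)
    (U : ∀ i, W i ≃ₗ[ℂ] W i) (i : I) : (R.reframe U).moment i = 0 := by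
  ext x
  have := LinearMap.congr_fun (h i) x
  simpa [FramedRep.moment, DoubleRep.moment, FramedRep.reframe, LinearMap.sum_apply] using this

theorem FramedRep.moment_directSum {R' : FramedRep V' W'} {R'' : FramedRep V'' W''}
    (h' : ∀ i, R'.moment i = 0) (h'' : ∀ i, R''.moment i = 0) (i : I) :
    (R'.directSum R'').moment i = 0 := by
  refine LinearMap.ext fun x => ?_
  have e' := LinearMap.congr_fun (h' i) x.1
  have e'' := LinearMap.congr_fun (h'' i) x.2
  refine Prod.ext ?_ ?_
  · simpa [FramedRep.moment, DoubleRep.moment, FramedRep.directSum, LinearMap.sum_apply,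
      Prod.fst_sum] using e'
  · simpa [FramedRep.moment, DoubleRep.moment, FramedRep.directSum, LinearMap.sum_apply,
      Prod.snd_sum] using e''

end Representations

section Varieties

variable {I : Type*} [Quiver I] [Fintype I] [∀ i j : I, Fintype (i ⟶ j)]

/-- The standard family of complex vector spaces of dimension vector `v`. -/
abbrev Cn (v : I → ℕ) : I → Type := fun i => Fin (v i) → ℂ

/-- `μ⁻¹(0)ˢ`: stable framed representations of dimension `v` on which the moment map vanishes. -/
abbrev StableRep (v : I → ℕ) (W : I → Type*) [∀ i, AddCommGroup (W i)] [∀ i, Module ℂ (W i)] :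
    Type _ :=
  {R : FramedRep (Cn v) W // (∀ i, R.moment i = 0) ∧ R.IsStable}

/-- The orbit equivalence relation of `∏ᵢ GL(Vᵢ)` on `μ⁻¹(0)ˢ`. -/
instance gaugeSetoid (v : I → ℕ) (W : I → Type*) [∀ i, AddCommGroup (W i)]
    [∀ i, Module ℂ (W i)] : Setoid (StableRep v W) where
  r R S := ∃ g : ∀ i, Cn v i ≃ₗ[ℂ] Cn v i, R.1.transport g = S.1
  iseqv :=
    { refl := fun R => ⟨fun i => LinearEquiv.refl ℂ _, rfl⟩
      symm := by
        rintro R S ⟨g, hg⟩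
        refine ⟨fun i => (g i).symm, ?_⟩
        rw [← hg]
        ext <;> simp [FramedRep.transport, DoubleRep.transport]
      trans := by
        rintro R S T ⟨g, hg⟩ ⟨h, hh⟩
        refine ⟨fun i => (g i).trans (h i), ?_⟩
        rw [← hh, ← hg]
        rfl }

/-- The Nakajima quiver variety `μ⁻¹(0)ˢ / ∏ᵢ GL(Vᵢ)` (its complex points). -/
def Nak (v : I → ℕ) (W : I → Type*) [∀ i, AddCommGroup (W i)] [∀ i, Module ℂ (W i)] : Type _ :=
  Quotient (gaugeSetoid v W)

/-- The classical topology of the quiver variety, i.e. the quotient topology. -/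
instance (v : I → ℕ) (W : I → Type*) [∀ i, AddCommGroup (W i)] [∀ i, Module ℂ (W i)]
    [∀ i, TopologicalSpace (W i)] : TopologicalSpace (Nak v W) :=
  inferInstanceAs (TopologicalSpace (Quotient (gaugeSetoid v W)))

/-- The point of the quiver variety defined by a representation. -/
def Nak.mk {v : I → ℕ} {W : I → Type*} [∀ i, AddCommGroup (W i)] [∀ i, Module ℂ (W i)]
    (R : StableRep v W) : Nak v W :=
  Quotient.mk (gaugeSetoid v W) R

/-- Complex points of the stack `𝔜ₙ`: double quiver representations of dimension `n` with
`∑ₑ (Xₑ Yₑ - Yₑ Xₑ) = 0`, up to the action of `∏ᵢ GL(nᵢ)`. -/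
def yoSetoid (n : I → ℕ) : Setoid {K : DoubleRep (Cn n) // ∀ i, K.moment i = 0} where
  r K L := ∃ g : ∀ i, Cn n i ≃ₗ[ℂ] Cn n i, K.1.transport g = L.1
  iseqv :=
    { refl := fun K => ⟨fun i => LinearEquiv.refl ℂ _, rfl⟩
      symm := by
        rintro K L ⟨g, hg⟩
        refine ⟨fun i => (g i).symm, ?_⟩
        rw [← hg]
        ext <;> simp [DoubleRep.transport]
      trans := by
        rintro K L M ⟨g, hg⟩ ⟨h, hh⟩
        refine ⟨fun i => (g i).trans (h i), ?_⟩
        rw [← hh, ← hg]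
        rfl }

/-- Complex points of the stack `𝔜ₙ`. -/
def Yo (n : I → ℕ) : Type _ := Quotient (yoSetoid n)

/-- Points of the stack of short exact sequences `0 → K → V⁺ → V⁻ → 0`, where `V⁺`, `V⁻` are stable
framed representations of dimensions `vp`, `vm` with framing `W`, and `K` is an unframed one, of
dimension `n` (exactness forces `vp = vm + n`, and `B` to vanish on `K`). -/
structure NPoint (vm vp n : I → ℕ) (W : I → Type*) [∀ i, AddCommGroup (W i)]
    [∀ i, Module ℂ (W i)] where
  K : {K : DoubleRep (Cn n) // ∀ i, K.moment i = 0}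
  Vp : StableRep vp W
  Vm : StableRep vm W
  incl : Hom K.1 Vp.1.toDoubleRep
  proj : FramedHom Vp.1 Vm.1 (fun _ => LinearMap.id)
  incl_injective : ∀ i, Function.Injective (incl.toFun i)
  exact : ∀ i, LinearMap.range (incl.toFun i) = LinearMap.ker (proj.toFun i)
  proj_surjective : proj.toHom.Surjective

section

variable {vm vp n : I → ℕ} {W : I → Type*} [∀ i, AddCommGroup (W i)] [∀ i, Module ℂ (W i)]

/-- The projection `(0 → K → V⁺ → V⁻ → 0) ↦ K`. -/
def NPoint.p (ν : NPoint vm vp n W) : Yo n := Quotient.mk (yoSetoid n) ν.K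

/-- The projection `(0 → K → V⁺ → V⁻ → 0) ↦ V⁺`. -/
def NPoint.piPlus (ν : NPoint vm vp n W) : Nak vp W := Nak.mk ν.Vp

/-- The projection `(0 → K → V⁺ → V⁻ → 0) ↦ V⁻`. -/
def NPoint.piMinus (ν : NPoint vm vp n W) : Nak vm W := Nak.mk ν.Vm

end

variable {W' W'' : I → Type*} [∀ i, AddCommGroup (W' i)] [∀ i, Module ℂ (W' i)]
  [∀ i, AddCommGroup (W'' i)] [∀ i, Module ℂ (W'' i)]

/-- The action of the torus `diag(t, 1)` on `μ⁻¹(0)ˢ`. -/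
def StableRep.twist {v : I → ℕ} (t : ℂˣ) (R : StableRep v (FSum W' W'')) :
    StableRep v (FSum W' W'') :=
  ⟨R.1.reframe (torus W' W'' t), FramedRep.moment_reframe R.2.1 _, R.2.2.reframe _⟩

/-- The action of the rank one torus `ℂˣ` on the quiver variety with framing `W' ⊕ W''`. -/
instance (v : I → ℕ) : MulAction ℂˣ (Nak v (FSum W' W'')) where
  smul t := Quotient.map (sa := gaugeSetoid v (FSum W' W'')) (sb := gaugeSetoid v (FSum W' W''))
    (StableRep.twist t) (by
      rintro R S ⟨g, hg⟩
      refine ⟨g, ?_⟩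
      change (R.1.reframe _).transport g = S.1.reframe _
      rw [← hg]
      rfl)
  one_smul := by
    intro x
    induction x using Quotient.inductionOn with
    | _ R => exact congrArg (Quotient.mk _) (Subtype.ext (reframe_torus_one R.1))
  mul_smul := by
    intro s t x
    induction x using Quotient.inductionOn with
    | _ R => exact congrArg (Quotient.mk _) (Subtype.ext (reframe_torus_mul R.1 s t))

/-- The identification `ℂ^a ⊕ ℂ^b ≅ ℂ^(a + b)` at every vertex. -/
def sumEquiv {v' v'' v : I → ℕ} (h : v' + v'' = v) (i : I) : FSum (Cn v') (Cn v'') i ≃ₗ[ℂ] Cn v i :=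
  (LinearEquiv.sumArrowLequivProdArrow (Fin (v' i)) (Fin (v'' i)) ℂ ℂ).symm.trans
    (LinearEquiv.funCongrLeft ℂ ℂ
      (finSumFinEquiv.trans (finCongr (congrFun h i))).symm)

/-- The direct sum of two points of `μ⁻¹(0)ˢ`. -/
def StableRep.sum {v' v'' v : I → ℕ} (h : v' + v'' = v) (R' : StableRep v' W')
    (R'' : StableRep v'' W'') : StableRep v (FSum W' W'') :=
  ⟨(R'.1.directSum R''.1).transport (sumEquiv h),
    FramedRep.moment_transport (FramedRep.moment_directSum R'.2.1 R''.2.1) _,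
    (R'.2.2.directSum R''.2.2).transport _⟩

/-- The map `([V'], [V'']) ↦ [V' ⊕ V'']` of quiver varieties. -/
def Nak.sum {v' v'' v : I → ℕ} (h : v' + v'' = v) :
    Nak v' W' → Nak v'' W'' → Nak v (FSum W' W'') :=
  Quotient.map₂ (sa := gaugeSetoid v' W') (sb := gaugeSetoid v'' W'')
    (sc := gaugeSetoid v (FSum W' W'')) (StableRep.sum h) (by
      rintro R' S' ⟨g', hg'⟩ R'' S'' ⟨g'', hg''⟩
      refine ⟨fun i => (sumEquiv h i).symm.trans
        (((g' i).prodCongr (g'' i)).trans (sumEquiv h i)), ?_⟩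
      change ((R'.1.directSum R''.1).transport _).transport _ =
        (S'.1.directSum S''.1).transport _
      rw [← hg', ← hg'']
      ext : 1
      · ext <;> simp [FramedRep.transport, DoubleRep.transport, FramedRep.directSum]
      · ext <;> simp [FramedRep.transport, DoubleRep.transport, FramedRep.directSum]
      · ext <;> simp [FramedRep.transport, DoubleRep.transport, FramedRep.directSum]
      · ext <;> simp [FramedRep.transport, DoubleRep.transport, FramedRep.directSum])

theorem Nak.smul_sum {v' v'' v : I → ℕ} (h : v' + v'' = v) (m' : Nak v' W') (m'' : Nak v'' W'')
    (t : ℂˣ) : t • Nak.sum h m' m'' = Nak.sum h m' m'' := by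
  induction m' using Quotient.inductionOn with
  | _ R' =>
    induction m'' using Quotient.inductionOn with
    | _ R'' =>
      refine Quotient.sound (s := gaugeSetoid v (FSum W' W'')) ?_
      refine ⟨fun i => (sumEquiv h i).symm.trans
        (((LinearEquiv.smulOfUnit t).prodCongr (LinearEquiv.refl ℂ _)).trans (sumEquiv h i)), ?_⟩
      change (((R'.1.directSum R''.1).transport _).reframe _).transport _ =
        (R'.1.directSum R''.1).transport _
      ext : 1
      · ext <;> simp [FramedRep.transport, DoubleRep.transport, FramedRep.directSum,
          FramedRep.reframe, LinearEquiv.smulOfUnit]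
      · ext <;> simp [FramedRep.transport, DoubleRep.transport, FramedRep.directSum,
          FramedRep.reframe, LinearEquiv.smulOfUnit]
      · ext <;> simp [FramedRep.transport, DoubleRep.transport, FramedRep.directSum,
          FramedRep.reframe, torus, LinearEquiv.smulOfUnit]
      · ext <;> simp [FramedRep.transport, DoubleRep.transport, FramedRep.directSum,
          FramedRep.reframe, torus, LinearEquiv.smulOfUnit]

/-- The fixed point `[V' ⊕ V'']` indicated by the pair `([V'], [V''])`. -/
def fixedPair {v' v'' v : I → ℕ} (h : v' + v'' = v) (m' : Nak v' W') (m'' : Nak v'' W'') :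
    MulAction.fixedPoints ℂˣ (Nak v (FSum W' W'')) :=
  ⟨Nak.sum h m' m'', fun t => Nak.smul_sum h m' m'' t⟩

end Varieties

section Attracting

variable {M : Type*} [TopologicalSpace M] [MulAction ℂˣ M]

/-- `lim_{t → 0} t · x = p`. -/
def LimZero (x p : M) : Prop :=
  Tendsto (fun t : ℂˣ => t • x) (comap ((↑) : ℂˣ → ℂ) (𝓝 0)) (𝓝 p)

/-- There is a closed flow line from `q` to `p`: a copy of the Riemann sphere `ℂ ∪ {∞}` in `M`
which is the closure of the orbit of a point `x`, the points `t · x` corresponding to the points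
`t ∈ ℂˣ`, the limit `p` as `t → 0` to `0`, and the limit `q` as `t → ∞` to `∞`. -/
def ClosedFlowLine (q p : M) : Prop :=
  ∃ (x : M) (φ : OnePoint ℂ → M), IsClosedEmbedding φ ∧
    (∀ t : ℂˣ, φ ((t : ℂ) : OnePoint ℂ) = t • x) ∧
    φ ((0 : ℂ) : OnePoint ℂ) = p ∧ φ OnePoint.infty = q

/-- Subsets `S` of `M^A × M` (for `A = ℂˣ`) which contain the diagonal, are closed and
`A`-invariant, and such that `(p, p') ∈ S` and `lim_{t → 0} t · x = p'` imply `(p, x) ∈ S`. -/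
structure IsFullAttracting (S : Set (MulAction.fixedPoints ℂˣ M × M)) : Prop where
  diag_mem : ∀ p : MulAction.fixedPoints ℂˣ M, (p, (p : M)) ∈ S
  isClosed : IsClosed S
  smul_mem : ∀ (t : ℂˣ) (p : MulAction.fixedPoints ℂˣ M) (x : M), (p, x) ∈ S → (p, t • x) ∈ S
  attr_mem : ∀ (p p' : MulAction.fixedPoints ℂˣ M) (x : M),
    (p, (p' : M)) ∈ S → LimZero x (p' : M) → (p, x) ∈ S

variable (M) in
/-- The full attracting set: the smallest set as in `IsFullAttracting`. -/
def fullAttr : Set (MulAction.fixedPoints ℂˣ M × M) :=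
  ⋂₀ {S | IsFullAttracting S}

theorem isFullAttracting_fullAttr : IsFullAttracting (fullAttr M) where
  diag_mem p := Set.mem_sInter.2 fun _ hS => hS.diag_mem p
  isClosed := isClosed_sInter fun _ hS => hS.isClosed
  smul_mem t p x hx := Set.mem_sInter.2 fun S hS => hS.smul_mem t p x (Set.mem_sInter.1 hx S hS)
  attr_mem p p' x hp hx :=
    Set.mem_sInter.2 fun S hS => hS.attr_mem p p' x (Set.mem_sInter.1 hp S hS) hx

end Attracting

section Filtrations

variable {I : Type*} [Quiver I] {V V' V'' : I → Type*}
  [∀ i, AddCommGroup (V i)] [∀ i, Module ℂ (V i)]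
  [∀ i, AddCommGroup (V' i)] [∀ i, Module ℂ (V' i)]
  [∀ i, AddCommGroup (V'' i)] [∀ i, Module ℂ (V'' i)]

/-- For `f : V' → V` and `g : V → V''` with `g ∘ f = 0`: existence of chains of surjections
`V' = E⁰ ↠ E¹ ↠ ⋯ ↠ Eᵏ = Im f` and `V / Im f = Fᵏ ↠ ⋯ ↠ F¹ ↠ F⁰ = V''`, composing to the maps
induced by `f` and `g`, such that the kernels of `Eˡ ↠ Eˡ⁺¹` and `Fˡ⁺¹ ↠ Fˡ` are isomorphic for all
`l < k`. Here `Eˡ = V' / P l` and `Fˡ = (V / Im f) / Q l` for subrepresentations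
`0 = P 0 ≤ ⋯ ≤ P k = Ker f` and `0 = Q k ≤ ⋯ ≤ Q 0 = Ker (V / Im f → V'')`. -/
def MatchingFiltrations {R' : DoubleRep V'} {R : DoubleRep V} {R'' : DoubleRep V''}
    (f : Hom R' R) (g : Hom R R'') (h : ∀ i x, g.toFun i (f.toFun i x) = 0) : Prop :=
  ∃ (k : ℕ) (P : ℕ → SubRep R') (Q : ℕ → SubRep f.range.quotient)
    (hP : ∀ l, P l ≤ P (l + 1)) (hQ : ∀ l, Q (l + 1) ≤ Q l),
    P 0 = ⊥ ∧ P k = f.ker ∧ Q k = ⊥ ∧ Q 0 = (f.descend g h).ker ∧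
    (f.descend g h).Surjective ∧
    ∀ l < k, (SubRep.factor (hP l)).ker.toRep.Isomorphic (SubRep.factor (hQ l)).ker.toRep

end Filtrations

end QuiverVariety

open QuiverVariety

set_option linter.unusedSectionVars false

/-! Stability means that the images of the maps `A` generate. So a framed morphism out of a stable
representation is determined by its map of framings, one into a stable representation is surjective
when its map of framings is, and morphisms over the identity in both directions are isomorphisms.
Moreover, framed morphisms between converging families converge if the limit of the sources is
stable (`FramedHom.exists_tendsto`). Hence the quiver variety is Hausdorff and limits under the
torus are unique.

Limits and fixed points: if `t · R` converges for `t → 0`, then `B''` vanishes on the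
subrepresentation generated by the images of `A'` (`LimZero.B_snd_eq_zero`), so `R` is an extension
of a `W''`-framed representation by a `W'`-framed one. Conversely, the torus multiplies the
off-diagonal block of an extension by `t`, so the limit is the direct sum of the two pieces
(`limZero_sum_iff`). A fixed point is its own limit, hence a direct sum. Exchanging `W'` and `W''`
inverts the torus up to a gauge scalar, which settles `t → ∞` (`limInfty_sum_iff`).

Flow lines: a point with limits at both ends has two subrepresentations, one for each end. Their
intersection is the kernel of the map from each of them to the quotient by the other, which gives
the isomorphic kernels. Conversely, two surjections with isomorphic kernels are glued to an
amalgamated sum (`exists_amalgam`). An element `t` of its stabilizer would act by `t` on one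
subrepresentation and by 1 on the other; as they meet non-trivially, `t = 1`, and the orbit closes
to a sphere.

Attracting set: each step of a pair of matching filtrations yields an amalgam whose orbit joins two
fixed points, and `V` is attracted to the last of them; thus matching filtrations put a pair into
the full attracting set. For the converse, the pairs with matching filtrations must form a set as in
`IsFullAttracting`, and the difficulty is that it is closed. For this, the moment equation and
stability are forgotten. Every matching chain is a limit of short exact sequences: adding to `f` a
small multiple of the last isomorphism shortens the chain by one
(`MatchingChain.exists_deformation`). Conversely, every limit of short exact sequences, with
surjective limit of the maps `g`, carries a matching chain (`exists_matchingChain_of_ultrafilter`):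
in singular bases of `f`, the arrows satisfy `z c = c x` with `c` the diagonal of singular values.
Sorting these by their rate of decay makes the limits of `x` and `z` block triangular in opposite
directions, with conjugate diagonal blocks. -/

namespace QuiverVariety

/-! ### Representations and framed morphisms through the arrows of the doubled quiver -/

section Algebra

/-- The arrows of the doubled quiver: `X e` runs along `e`, `Y e` in the opposite direction. -/
inductive DArrow {I : Type*} [Quiver I] : I → I → Type _
  | X {i j : I} (e : i ⟶ j) : DArrow i j
  | Y {i j : I} (e : i ⟶ j) : DArrow j i

variable {I : Type*} [Quiver I]

variable {V V₁ V₂ V₃ V' V'' W W₁ W₂ W₃ W' W'' : I → Type*}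
  [∀ i, AddCommGroup (V i)] [∀ i, Module ℂ (V i)]
  [∀ i, AddCommGroup (V₁ i)] [∀ i, Module ℂ (V₁ i)]
  [∀ i, AddCommGroup (V₂ i)] [∀ i, Module ℂ (V₂ i)]
  [∀ i, AddCommGroup (V₃ i)] [∀ i, Module ℂ (V₃ i)]
  [∀ i, AddCommGroup (V' i)] [∀ i, Module ℂ (V' i)]
  [∀ i, AddCommGroup (V'' i)] [∀ i, Module ℂ (V'' i)]
  [∀ i, AddCommGroup (W i)] [∀ i, Module ℂ (W i)]
  [∀ i, AddCommGroup (W₁ i)] [∀ i, Module ℂ (W₁ i)]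
  [∀ i, AddCommGroup (W₂ i)] [∀ i, Module ℂ (W₂ i)]
  [∀ i, AddCommGroup (W₃ i)] [∀ i, Module ℂ (W₃ i)]
  [∀ i, AddCommGroup (W' i)] [∀ i, Module ℂ (W' i)]
  [∀ i, AddCommGroup (W'' i)] [∀ i, Module ℂ (W'' i)]

/-- The linear map by which an arrow of the doubled quiver acts. -/
def DoubleRep.act (R : DoubleRep V) : ∀ {i j : I}, DArrow i j → V i →ₗ[ℂ] V j
  | _, _, .X e => R.X e
  | _, _, .Y e => R.Y e

/-- The double quiver representation with a given action of the arrows. -/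
def DoubleRep.ofAct (a : ∀ i j : I, DArrow i j → V i →ₗ[ℂ] V j) : DoubleRep V where
  X e := a _ _ (.X e)
  Y e := a _ _ (.Y e)

@[simp]
theorem DoubleRep.act_ofAct (a : ∀ i j : I, DArrow i j → V i →ₗ[ℂ] V j) {i j : I}
    (d : DArrow i j) : (DoubleRep.ofAct a).act d = a i j d := by
  cases d <;> rfl

theorem FramedRep.ext_act {R S : FramedRep V W}
    (h : ∀ (i j : I) (d : DArrow i j) (x : V i), R.act d x = S.act d x)
    (hA : ∀ i w, R.A i w = S.A i w) (hB : ∀ i x, R.B i x = S.B i x) : R = S := by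
  ext i j e x
  · exact h _ _ (.X e) x
  · exact h _ _ (.Y e) x
  · exact hA _ _
  · exact hB _ _

theorem SubRep.act_mem {R : DoubleRep V} (K : SubRep R) {i j : I} (d : DArrow i j) {x : V i}
    (hx : x ∈ K.carrier i) : R.act d x ∈ K.carrier j := by
  cases d
  · exact K.X_mem _ x hx
  · exact K.Y_mem _ x hx

/-- A family of subspaces preserved by all arrows of the doubled quiver. -/
def SubRep.ofAct {R : DoubleRep V} (K : ∀ i, Submodule ℂ (V i))
    (h : ∀ (i j : I) (d : DArrow i j), ∀ x ∈ K i, R.act d x ∈ K j) : SubRep R where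
  carrier := K
  X_mem e x hx := h _ _ (.X e) x hx
  Y_mem e x hx := h _ _ (.Y e) x hx

theorem Hom.comm {R : DoubleRep V₁} {S : DoubleRep V₂} (φ : Hom R S) {i j : I} (d : DArrow i j)
    (x : V₁ i) : φ.toFun j (R.act d x) = S.act d (φ.toFun i x) := by
  cases d
  · exact φ.comm_X _ x
  · exact φ.comm_Y _ x

/-- A family of linear maps commuting with all arrows of the doubled quiver. -/
def Hom.ofAct {R : DoubleRep V₁} {S : DoubleRep V₂} (φ : ∀ i, V₁ i →ₗ[ℂ] V₂ i)
    (h : ∀ (i j : I) (d : DArrow i j) (x : V₁ i), φ j (R.act d x) = S.act d (φ i x)) :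
    Hom R S where
  toFun := φ
  comm_X e x := h _ _ (.X e) x
  comm_Y e x := h _ _ (.Y e) x

theorem SubRep.act_quotient {R : DoubleRep V} (K : SubRep R) {i j : I} (d : DArrow i j) (x : V i) :
    K.quotient.act d ((K.carrier i).mkQ x) = (K.carrier j).mkQ (R.act d x) := by
  cases d <;> rfl

theorem SubRep.coe_act_toRep {R : DoubleRep V} (K : SubRep R) {i j : I} (d : DArrow i j)
    (x : K.carrier i) : ((K.toRep.act d x : K.carrier j) : V j) = R.act d x := by
  cases d <;> rfl

theorem FramedRep.act_directSum (R' : FramedRep V' W') (R'' : FramedRep V'' W'') {i j : I}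
    (d : DArrow i j) :
    (R'.directSum R'').act d = (R'.act d).prodMap (R''.act d) := by
  cases d <;> rfl

theorem DoubleRep.act_transport (R : DoubleRep V₁) (g : ∀ i, V₁ i ≃ₗ[ℂ] V₂ i) {i j : I}
    (d : DArrow i j) (x : V₂ i) : (R.transport g).act d x = g j (R.act d ((g i).symm x)) := by
  cases d <;> rfl

namespace FramedHom

variable {R : FramedRep V₁ W₁} {S : FramedRep V₂ W₂} {T : FramedRep V₃ W₃}
  {α : ∀ i, W₁ i →ₗ[ℂ] W₂ i} {β : ∀ i, W₂ i →ₗ[ℂ] W₃ i}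

/-- Composition of framed morphisms, over a given expression for the composite on framings. -/
def comp (ψ : FramedHom S T β) (φ : FramedHom R S α) (γ : ∀ i, W₁ i →ₗ[ℂ] W₃ i)
    (h : ∀ i w, β i (α i w) = γ i w) : FramedHom R T γ where
  toHom := Hom.ofAct (fun i => ψ.toFun i ∘ₗ φ.toFun i) (fun i j d x => by
    simp [φ.toHom.comm, ψ.toHom.comm])
  comm_A i w := by
    change ψ.toFun i (φ.toFun i _) = _
    rw [φ.comm_A, ψ.comm_A, h]
  comm_B i x := by
    change T.B i (ψ.toFun i (φ.toFun i _)) = _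
    rw [ψ.comm_B, φ.comm_B, h]

@[simp]
theorem comp_toFun (ψ : FramedHom S T β) (φ : FramedHom R S α) (γ : ∀ i, W₁ i →ₗ[ℂ] W₃ i)
    (h : ∀ i w, β i (α i w) = γ i w) (i : I) (x : V₁ i) :
    (ψ.comp φ γ h).toFun i x = ψ.toFun i (φ.toFun i x) := rfl

/-- The image is a subrepresentation and contains the images of `S.A`, every framing vector of the
target being hit. -/
theorem surjective (hS : S.IsStable) (φ : FramedHom R S α)
    (hα : ∀ i, Function.Surjective (α i)) : φ.toHom.Surjective := by
  intro i
  have := hS φ.toHom.range (fun i w => by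
    obtain ⟨w', rfl⟩ := hα i w
    exact ⟨R.A i w', φ.comm_A i w'⟩) i
  exact LinearMap.range_eq_top.1 this

/-- The equalizer is a subrepresentation containing the images of `R.A`. This rigidity is the source
of all uniqueness statements below. -/
theorem toFun_eq_of_isStable (hR : R.IsStable) (φ ψ : FramedHom R S α) (i : I) (x : V₁ i) :
    φ.toFun i x = ψ.toFun i x := by
  have := hR (SubRep.ofAct (fun i => LinearMap.eqLocus (φ.toFun i) (ψ.toFun i))
    (fun i j d x hx => by
      rw [LinearMap.mem_eqLocus] at hx ⊢
      rw [φ.toHom.comm, ψ.toHom.comm, hx]))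
    (fun i w => by
      change φ.toFun i _ = ψ.toFun i _
      rw [φ.comm_A, ψ.comm_A]) i
  have hx : x ∈ LinearMap.eqLocus (φ.toFun i) (ψ.toFun i) := by
    rw [show LinearMap.eqLocus (φ.toFun i) (ψ.toFun i) = ⊤ from this]; trivial
  exact hx

end FramedHom

/-- The identity as a framed morphism. -/
def FramedRep.idHom (R : FramedRep V W) : FramedHom R R (fun _ => LinearMap.id) where
  toFun _ := LinearMap.id
  comm_X _ _ := rfl
  comm_Y _ _ := rfl
  comm_A _ _ := rfl
  comm_B _ _ := rfl

/-- The inverse of a bijective framed morphism. -/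
noncomputable def FramedHom.symm {R : FramedRep V₁ W} {S : FramedRep V₂ W}
    (φ : FramedHom R S (fun _ => LinearMap.id)) (h : ∀ i, Function.Bijective (φ.toFun i)) :
    FramedHom S R (fun _ => LinearMap.id) where
  toHom := Hom.ofAct (fun i => (LinearEquiv.ofBijective (φ.toFun i) (h i)).symm.toLinearMap)
    (fun i j d x => by
      obtain ⟨y, rfl⟩ := (h i).2 x
      apply (h j).1
      change φ.toFun j ((LinearEquiv.ofBijective (φ.toFun j) (h j)).symm _) = _
      refine ((LinearEquiv.ofBijective (φ.toFun j) (h j)).apply_symm_apply _).trans ?_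
      rw [φ.toHom.comm]
      congr 1
      exact ((LinearEquiv.ofBijective (φ.toFun i) (h i)).apply_symm_apply _).symm)
  comm_A i w := by
    apply (h i).1
    change φ.toFun i ((LinearEquiv.ofBijective (φ.toFun i) (h i)).symm _) = _
    refine ((LinearEquiv.ofBijective (φ.toFun i) (h i)).apply_symm_apply _).trans ?_
    rw [φ.comm_A]
    rfl
  comm_B i x := by
    obtain ⟨y, rfl⟩ := (h i).2 x
    rw [φ.comm_B]
    change R.B i ((LinearEquiv.ofBijective (φ.toFun i) (h i)).symm (φ.toFun i y)) = R.B i y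
    congr 1
    exact (LinearEquiv.ofBijective (φ.toFun i) (h i)).symm_apply_apply y

@[simp]
theorem FramedHom.apply_symm {R : FramedRep V₁ W} {S : FramedRep V₂ W}
    (φ : FramedHom R S (fun _ => LinearMap.id)) (h : ∀ i, Function.Bijective (φ.toFun i)) (i : I)
    (x : V₂ i) : φ.toFun i ((φ.symm h).toFun i x) = x :=
  (LinearEquiv.ofBijective (φ.toFun i) (h i)).apply_symm_apply x

@[simp]
theorem FramedHom.symm_apply {R : FramedRep V₁ W} {S : FramedRep V₂ W}
    (φ : FramedHom R S (fun _ => LinearMap.id)) (h : ∀ i, Function.Bijective (φ.toFun i)) (i : I)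
    (x : V₁ i) : (φ.symm h).toFun i (φ.toFun i x) = x :=
  (LinearEquiv.ofBijective (φ.toFun i) (h i)).symm_apply_apply x

theorem FramedHom.symm_bijective {R : FramedRep V₁ W} {S : FramedRep V₂ W}
    (φ : FramedHom R S (fun _ => LinearMap.id)) (h : ∀ i, Function.Bijective (φ.toFun i)) (i : I) :
    Function.Bijective ((φ.symm h).toFun i) :=
  (LinearEquiv.ofBijective (φ.toFun i) (h i)).symm.bijective

/-- Transport of structure as an isomorphism. -/
def FramedRep.transportHom (R : FramedRep V₁ W) (g : ∀ i, V₁ i ≃ₗ[ℂ] V₂ i) :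
    FramedHom R (R.transport g) (fun _ => LinearMap.id) where
  toHom := Hom.ofAct (fun i => (g i).toLinearMap) (fun i j d x => by
    change g j _ = (R.toDoubleRep.transport g).act d (g i x)
    rw [DoubleRep.act_transport, LinearEquiv.symm_apply_apply])
  comm_A i w := rfl
  comm_B i x := by simp [FramedRep.transport, Hom.ofAct]

@[simp]
theorem FramedRep.transportHom_toFun (R : FramedRep V₁ W) (g : ∀ i, V₁ i ≃ₗ[ℂ] V₂ i) (i : I)
    (x : V₁ i) : (R.transportHom g).toFun i x = g i x := rfl

theorem FramedRep.transportHom_bijective (R : FramedRep V₁ W) (g : ∀ i, V₁ i ≃ₗ[ℂ] V₂ i) (i : I) :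
    Function.Bijective ((R.transportHom g).toFun i) := (g i).bijective

theorem FramedHom.transport_eq {R : FramedRep V₁ W} {S : FramedRep V₂ W}
    (φ : FramedHom R S (fun _ => LinearMap.id)) (h : ∀ i, Function.Bijective (φ.toFun i)) :
    R.transport (fun i => LinearEquiv.ofBijective (φ.toFun i) (h i)) = S := by
  refine FramedRep.ext_act (fun i j d x => ?_) (fun i w => φ.comm_A i w) (fun i x => ?_)
  · change (R.toDoubleRep.transport _).act d x = _
    rw [DoubleRep.act_transport]
    obtain ⟨y, rfl⟩ := (h i).2 x
    have : (LinearEquiv.ofBijective (φ.toFun i) (h i)).symm (φ.toFun i y) = y :=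
      (LinearEquiv.ofBijective (φ.toFun i) (h i)).symm_apply_apply y
    rw [this]
    exact φ.toHom.comm d y
  · obtain ⟨y, rfl⟩ := (h i).2 x
    have : (LinearEquiv.ofBijective (φ.toFun i) (h i)).symm (φ.toFun i y) = y :=
      (LinearEquiv.ofBijective (φ.toFun i) (h i)).symm_apply_apply y
    change R.B i ((LinearEquiv.ofBijective (φ.toFun i) (h i)).symm (φ.toFun i y)) = _
    rw [this, φ.comm_B]
    rfl

/-- The inclusion of the first summand. -/
def FramedRep.inlHom (R' : FramedRep V' W') (R'' : FramedRep V'' W'') :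
    FramedHom R' (R'.directSum R'') (fun i => LinearMap.inl ℂ (W' i) (W'' i)) where
  toHom := Hom.ofAct (fun i => LinearMap.inl ℂ (V' i) (V'' i)) (fun i j d x => by
    rw [FramedRep.act_directSum]; simp)
  comm_A i w := by simp [FramedRep.directSum, Hom.ofAct]
  comm_B i w := by simp [FramedRep.directSum, Hom.ofAct]

/-- The inclusion of the second summand. -/
def FramedRep.inrHom (R' : FramedRep V' W') (R'' : FramedRep V'' W'') :
    FramedHom R'' (R'.directSum R'') (fun i => LinearMap.inr ℂ (W' i) (W'' i)) where
  toHom := Hom.ofAct (fun i => LinearMap.inr ℂ (V' i) (V'' i)) (fun i j d x => by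
    rw [FramedRep.act_directSum]; simp)
  comm_A i w := by simp [FramedRep.directSum, Hom.ofAct]
  comm_B i w := by simp [FramedRep.directSum, Hom.ofAct]

/-- The projection onto the first summand. -/
def FramedRep.fstHom (R' : FramedRep V' W') (R'' : FramedRep V'' W'') :
    FramedHom (R'.directSum R'') R' (fun i => LinearMap.fst ℂ (W' i) (W'' i)) where
  toHom := Hom.ofAct (fun i => LinearMap.fst ℂ (V' i) (V'' i)) (fun i j d x => by
    rw [FramedRep.act_directSum]; simp)
  comm_A i w := by simp [FramedRep.directSum, Hom.ofAct]
  comm_B i w := by simp [FramedRep.directSum, Hom.ofAct]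

/-- The projection onto the second summand. -/
def FramedRep.sndHom (R' : FramedRep V' W') (R'' : FramedRep V'' W'') :
    FramedHom (R'.directSum R'') R'' (fun i => LinearMap.snd ℂ (W' i) (W'' i)) where
  toHom := Hom.ofAct (fun i => LinearMap.snd ℂ (V' i) (V'' i)) (fun i j d x => by
    rw [FramedRep.act_directSum]; simp)
  comm_A i w := by simp [FramedRep.directSum, Hom.ofAct]
  comm_B i w := by simp [FramedRep.directSum, Hom.ofAct]

/-- A quotient of a stable representation by a framed surjection is stable. -/
theorem FramedRep.IsStable.of_surjective {R : FramedRep V₁ W₁} {S : FramedRep V₂ W₂}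
    {α : ∀ i, W₁ i →ₗ[ℂ] W₂ i} (hR : R.IsStable) (φ : FramedHom R S α)
    (h : φ.toHom.Surjective) : S.IsStable := by
  intro K hK i
  have := hR (SubRep.ofAct (fun i => (K.carrier i).comap (φ.toFun i)) (fun i j d x hx => by
    rw [Submodule.mem_comap] at hx ⊢
    rw [φ.toHom.comm]
    exact K.act_mem d hx)) (fun i w => by
      change φ.toFun i _ ∈ K.carrier i
      rw [φ.comm_A]
      exact hK i _) i
  rw [eq_top_iff]
  intro y _
  obtain ⟨x, rfl⟩ := h i y
  have hx : x ∈ (K.carrier i).comap (φ.toFun i) := by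
    rw [show (K.carrier i).comap (φ.toFun i) = ⊤ from this]; trivial
  exact hx

section Moment

variable [Fintype I] [∀ i j : I, Fintype (i ⟶ j)]

theorem Hom.comm_moment {R : DoubleRep V₁} {S : DoubleRep V₂} (φ : Hom R S) (i : I) (x : V₁ i) :
    φ.toFun i (R.moment i x) = S.moment i (φ.toFun i x) := by
  simp [DoubleRep.moment, LinearMap.sum_apply, φ.comm_X, φ.comm_Y]

theorem FramedHom.comm_moment {R : FramedRep V₁ W₁} {S : FramedRep V₂ W₂}
    {α : ∀ i, W₁ i →ₗ[ℂ] W₂ i} (φ : FramedHom R S α) (i : I) (x : V₁ i) :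
    φ.toFun i (R.moment i x) = S.moment i (φ.toFun i x) := by
  simp only [FramedRep.moment, LinearMap.add_apply, map_add, φ.toHom.comm_moment,
    LinearMap.comp_apply, φ.comm_A, φ.comm_B]

theorem FramedHom.moment_eq_zero_of_surjective {R : FramedRep V₁ W₁} {S : FramedRep V₂ W₂}
    {α : ∀ i, W₁ i →ₗ[ℂ] W₂ i} (φ : FramedHom R S α) (h : φ.toHom.Surjective)
    (hR : ∀ i, R.moment i = 0) (i : I) : S.moment i = 0 := by
  refine LinearMap.ext fun y => ?_
  obtain ⟨x, rfl⟩ := h i y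
  rw [← φ.comm_moment, hR]
  simp

theorem FramedHom.moment_eq_zero_of_injective {R : FramedRep V₁ W₁} {S : FramedRep V₂ W₂}
    {α : ∀ i, W₁ i →ₗ[ℂ] W₂ i} (φ : FramedHom R S α)
    (h : ∀ i, Function.Injective (φ.toFun i)) (hS : ∀ i, S.moment i = 0) (i : I) :
    R.moment i = 0 := by
  refine LinearMap.ext fun x => h i ?_
  rw [φ.comm_moment, hS]
  simp

end Moment

end Algebra

/-! ### Points of the quiver variety as isomorphism classes -/

section Points

variable {I : Type*} [Quiver I] [Fintype I] [∀ i j : I, Fintype (i ⟶ j)]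
  {W W' W'' : I → Type*} [∀ i, AddCommGroup (W i)] [∀ i, Module ℂ (W i)]
  [∀ i, AddCommGroup (W' i)] [∀ i, Module ℂ (W' i)]
  [∀ i, AddCommGroup (W'' i)] [∀ i, Module ℂ (W'' i)]

/-- Gauge orbits are isomorphism classes; points are compared below by framed isomorphisms instead
of group elements. -/
theorem Nak.mk_eq_mk_iff {v : I → ℕ} {R S : StableRep v W} :
    Nak.mk R = Nak.mk S ↔ ∃ φ : FramedHom R.1 S.1 (fun _ => LinearMap.id),
      ∀ i, Function.Bijective (φ.toFun i) := by
  constructor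
  · intro h
    obtain ⟨g, hg⟩ := Quotient.exact h
    obtain ⟨S, hS⟩ := S
    change _ = S at hg
    subst hg
    exact ⟨R.1.transportHom g, R.1.transportHom_bijective g⟩
  · rintro ⟨φ, h⟩
    exact Quotient.sound (s := gaugeSetoid v W) ⟨_, φ.transport_eq h⟩

theorem Nak.exists_rep {v : I → ℕ} (x : Nak v W) : ∃ R : StableRep v W, Nak.mk R = x :=
  Quotient.exists_rep x

theorem dim_eq_of_bijective {v u : I → ℕ} (φ : ∀ i, Cn v i →ₗ[ℂ] Cn u i)
    (h : ∀ i, Function.Bijective (φ i)) : v = u := by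
  funext i
  have := (LinearEquiv.ofBijective (φ i) (h i)).finrank_eq
  simpa using this

/-- Framed morphisms in both directions between stable representations are isomorphisms. -/
theorem FramedHom.bijective_of_isStable {v u : I → ℕ} {R : FramedRep (Cn v) W}
    {S : FramedRep (Cn u) W} (hR : R.IsStable) (hS : S.IsStable)
    (φ : FramedHom R S (fun _ => LinearMap.id)) (ψ : FramedHom S R (fun _ => LinearMap.id)) (i : I) :
    Function.Bijective (φ.toFun i) := by
  refine ⟨?_, φ.surjective hS (fun i => Function.surjective_id) i⟩
  -- The composite and the identity lie over the same map of framings, so rigidity identifies them.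
  have : ∀ x, ψ.toFun i (φ.toFun i x) = x := fun x =>
    FramedHom.toFun_eq_of_isStable hR (ψ.comp φ (fun _ => LinearMap.id) (fun _ _ => rfl)) R.idHom
      i x
  exact Function.LeftInverse.injective this

end Points

/-! ### Convergence of representations and of framed morphisms -/

section Topology

/-- In finite dimension, expansion in the standard basis reduces varying arguments to finitely many
fixed ones. -/
theorem tendsto_linearMap_apply {ι : Type*} {l : Filter ι} {m : ℕ} {E : Type*} [AddCommGroup E]
    [Module ℂ E] [TopologicalSpace E] [IsTopologicalAddGroup E] [ContinuousSMul ℂ E]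
    {L : ι → (Fin m → ℂ) →ₗ[ℂ] E} {L₀ : (Fin m → ℂ) →ₗ[ℂ] E}
    (hL : ∀ x, Tendsto (fun n => L n x) l (𝓝 (L₀ x))) {x : ι → Fin m → ℂ} {x₀ : Fin m → ℂ}
    (hx : Tendsto x l (𝓝 x₀)) : Tendsto (fun n => L n (x n)) l (𝓝 (L₀ x₀)) := by
  simp only [fun n => LinearMap.pi_apply_eq_sum_univ (L n) (x n),
    LinearMap.pi_apply_eq_sum_univ L₀ x₀]
  exact tendsto_finsetSum _ fun i _ => ((tendsto_pi_nhds.1 hx i).smul (hL _))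

theorem tendsto_matrix_inv {ι : Type*} {l : Filter ι} {m : ℕ} {M : ι → Matrix (Fin m) (Fin m) ℂ}
    {M₀ : Matrix (Fin m) (Fin m) ℂ} (hM : Tendsto M l (𝓝 M₀)) (h : M₀.det ≠ 0) :
    Tendsto (fun n => (M n)⁻¹) l (𝓝 M₀⁻¹) := by
  simp only [Matrix.inv_def, Ring.inverse_eq_inv']
  have h1 : Tendsto (fun n => (M n).det) l (𝓝 M₀.det) :=
    ((continuous_id.matrix_det (A := fun M : Matrix (Fin m) (Fin m) ℂ => M)).tendsto M₀).comp hM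
  have h2 : Tendsto (fun n => (M n).adjugate) l (𝓝 M₀.adjugate) :=
    ((continuous_id.matrix_adjugate (A := fun M : Matrix (Fin m) (Fin m) ℂ => M)).tendsto M₀).comp
      hM
  exact (h1.inv₀ h).smul h2

/-- Linear maps which converge along sequences of vectors converging to a basis converge
pointwise. -/
theorem exists_tendsto_of_basis {ι : Type*} {l : Filter ι} {m : ℕ} {E : Type*} [AddCommGroup E]
    [Module ℂ E] [TopologicalSpace E] [IsTopologicalAddGroup E] [ContinuousSMul ℂ E]
    {L : ι → (Fin m → ℂ) →ₗ[ℂ] E} {M : ι → Matrix (Fin m) (Fin m) ℂ} {y : Fin m → E}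
    (hM : Tendsto M l (𝓝 1)) (hy : ∀ j, Tendsto (fun n => L n ((M n).col j)) l (𝓝 (y j))) :
    ∃ L₀ : (Fin m → ℂ) →ₗ[ℂ] E, ∀ x, Tendsto (fun n => L n x) l (𝓝 (L₀ x)) := by
  refine ⟨Fintype.linearCombination ℂ y, fun x => ?_⟩
  -- The columns of `M n` tend to the standard basis, so they are eventually a basis, in which `x`
  -- is expanded.
  have hdet : ∀ᶠ n in l, (M n).det ≠ 0 := by
    have h1 : Tendsto (fun n => (M n).det) l (𝓝 (1 : Matrix (Fin m) (Fin m) ℂ).det) :=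
      ((continuous_id.matrix_det (A := fun M : Matrix (Fin m) (Fin m) ℂ => M)).tendsto 1).comp hM
    refine h1.eventually_ne ?_
    simp
  have hinv := tendsto_matrix_inv hM (by simp)
  have hc : Tendsto (fun n => (M n)⁻¹.mulVec x) l (𝓝 x) := by
    have := ((continuous_id.matrix_mulVec continuous_const
      (A := fun M : Matrix (Fin m) (Fin m) ℂ => M) (B := fun _ => x)).tendsto
      (1 : Matrix (Fin m) (Fin m) ℂ)⁻¹).comp hinv
    simpa [Function.comp_def] using this
  have key : Tendsto (fun n => ∑ j, ((M n)⁻¹.mulVec x) j • L n ((M n).col j)) l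
      (𝓝 (∑ j, x j • y j)) :=
    tendsto_finsetSum _ fun j _ => (tendsto_pi_nhds.1 hc j).smul (hy j)
  rw [Fintype.linearCombination_apply]
  refine key.congr' (hdet.mono fun n hn => ?_)
  have e : (M n).mulVec ((M n)⁻¹.mulVec x) = x := by
    rw [Matrix.mulVec_mulVec, Matrix.mul_nonsing_inv _ (isUnit_iff_ne_zero.2 hn),
      Matrix.one_mulVec]
  calc ∑ j, ((M n)⁻¹.mulVec x) j • L n ((M n).col j)
      = L n (∑ j, ((M n)⁻¹.mulVec x) j • (M n).col j) := by simp [map_sum]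
    _ = L n ((M n).mulVec ((M n)⁻¹.mulVec x)) := by
      generalize (M n)⁻¹.mulVec x = c
      congr 1
      ext r
      simp [Matrix.mulVec, dotProduct, Finset.sum_apply, mul_comm]
    _ = L n x := by rw [e]

variable {I : Type*} [Quiver I] {V W : I → Type*}
  [∀ i, AddCommGroup (V i)] [∀ i, Module ℂ (V i)] [∀ i, TopologicalSpace (V i)]
  [∀ i, AddCommGroup (W i)] [∀ i, Module ℂ (W i)] [∀ i, TopologicalSpace (W i)]

theorem FramedRep.tendsto_iff {ι : Type*} {l : Filter ι} {R : ι → FramedRep V W}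
    {R₀ : FramedRep V W} :
    Tendsto R l (𝓝 R₀) ↔
      (∀ (i j : I) (d : DArrow i j) (x : V i),
        Tendsto (fun n => (R n).act d x) l (𝓝 (R₀.act d x))) ∧
      (∀ i w, Tendsto (fun n => (R n).A i w) l (𝓝 (R₀.A i w))) ∧
      ∀ i x, Tendsto (fun n => (R n).B i x) l (𝓝 (R₀.B i x)) := by
  have hi : IsInducing (fun R : FramedRep V W =>
      ((fun (i j : I) (e : i ⟶ j) (x : V i) => R.X e x,
        fun (i j : I) (e : i ⟶ j) (x : V j) => R.Y e x,
        fun (i : I) (w : W i) => R.A i w,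
        fun (i : I) (x : V i) => R.B i x) :
        (∀ i j : I, (i ⟶ j) → V i → V j) × (∀ i j : I, (i ⟶ j) → V j → V i) ×
          (∀ i, W i → V i) × (∀ i, V i → W i))) := ⟨rfl⟩
  rw [hi.tendsto_nhds_iff]
  simp only [Prod.tendsto_iff, Function.comp_def, tendsto_pi_nhds]
  constructor
  · rintro ⟨h1, h2, h3, h4⟩
    refine ⟨fun i j d x => ?_, h3, h4⟩
    cases d
    · exact h1 _ _ _ x
    · exact h2 _ _ _ x
  · rintro ⟨h1, h2, h3⟩
    exact ⟨fun i j e => h1 _ _ (.X e), fun i j e => h1 _ _ (.Y e), h2, h3⟩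

theorem FramedRep.continuous_iff {Z : Type*} [TopologicalSpace Z] {R : Z → FramedRep V W} :
    Continuous R ↔
      (∀ (i j : I) (d : DArrow i j) (x : V i), Continuous (fun z => (R z).act d x)) ∧
      (∀ i w, Continuous (fun z => (R z).A i w)) ∧
      ∀ i x, Continuous (fun z => (R z).B i x) := by
  simp only [continuous_iff_continuousAt, ContinuousAt, FramedRep.tendsto_iff]
  constructor
  · intro h
    exact ⟨fun i j d x z => (h z).1 i j d x, fun i w z => (h z).2.1 i w,
      fun i x z => (h z).2.2 i x⟩
  · rintro ⟨h1, h2, h3⟩ z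
    exact ⟨fun i j d x => h1 i j d x z, fun i w => h2 i w z, fun i x => h3 i x z⟩

variable {W₁ W₂ : I → Type*}
  [∀ i, AddCommGroup (W₁ i)] [∀ i, Module ℂ (W₁ i)] [∀ i, TopologicalSpace (W₁ i)]
  [∀ i, AddCommGroup (W₂ i)] [∀ i, Module ℂ (W₂ i)] [∀ i, TopologicalSpace (W₂ i)]
  [∀ i, IsTopologicalAddGroup (W₂ i)] [∀ i, ContinuousSMul ℂ (W₂ i)] [∀ i, T2Space (W₂ i)]

/-- The vectors which are limits of vectors on which the linear maps `h n`, satisfying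
`h n ∘ P n = R n ∘ h n`, converge, form a subrepresentation of the limit of the `P n`. -/
def convergenceSubRep {ι : Type*} {l : Filter ι} {a b : I → ℕ}
    {P : ι → DoubleRep (Cn a)} {P₀ : DoubleRep (Cn a)} {R : ι → DoubleRep (Cn b)}
    {R₀ : DoubleRep (Cn b)}
    (hP : ∀ (i j : I) (d : DArrow i j) (x), Tendsto (fun n => (P n).act d x) l (𝓝 (P₀.act d x)))
    (hR : ∀ (i j : I) (d : DArrow i j) (x), Tendsto (fun n => (R n).act d x) l (𝓝 (R₀.act d x)))
    (h : ∀ (_ : ι) (i : I), Cn a i →ₗ[ℂ] Cn b i)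
    (hh : ∀ n (i j : I) (d : DArrow i j) x, h n j ((P n).act d x) = (R n).act d (h n i x)) :
    SubRep P₀ :=
  SubRep.ofAct
    (fun i =>
      { carrier := {x | ∃ (u : ι → Cn a i) (y : Cn b i), Tendsto u l (𝓝 x) ∧
          Tendsto (fun n => h n i (u n)) l (𝓝 y)}
        add_mem' := by
          rintro x x' ⟨u, y, hu, hy⟩ ⟨u', y', hu', hy'⟩
          exact ⟨fun n => u n + u' n, y + y', hu.add hu', by simpa using hy.add hy'⟩
        zero_mem' := ⟨fun _ => 0, 0, tendsto_const_nhds, by simpa using tendsto_const_nhds⟩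
        smul_mem' := by
          rintro c x ⟨u, y, hu, hy⟩
          exact ⟨fun n => c • u n, c • y, hu.const_smul c, by simpa using hy.const_smul c⟩ })
    (by
      rintro i j d x ⟨u, y, hu, hy⟩
      refine ⟨fun n => (P n).act d (u n), R₀.act d y,
        tendsto_linearMap_apply (hP i j d) hu, ?_⟩
      simp only [hh]
      exact tendsto_linearMap_apply (hR i j d) hy)

/-- Framed morphisms between converging representations, the limit of whose sources is stable,
converge. -/
theorem FramedHom.exists_tendsto {ι : Type*} {l : Filter ι} [l.NeBot] {a b : I → ℕ}
    {α : ∀ i, W₁ i →ₗ[ℂ] W₂ i} (hα : ∀ i, Continuous (α i))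
    {P : ι → FramedRep (Cn a) W₁} {P₀ : FramedRep (Cn a) W₁}
    {R : ι → FramedRep (Cn b) W₂} {R₀ : FramedRep (Cn b) W₂}
    (hP : Tendsto P l (𝓝 P₀)) (hR : Tendsto R l (𝓝 R₀)) (hst : P₀.IsStable)
    (h : ∀ n, FramedHom (P n) (R n) α) :
    ∃ h₀ : FramedHom P₀ R₀ α, ∀ i x, Tendsto (fun n => (h n).toFun i x) l (𝓝 (h₀.toFun i x)) := by
  rw [FramedRep.tendsto_iff] at hP hR
  have key : ∀ i, ∃ L : Cn a i →ₗ[ℂ] Cn b i,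
      ∀ x, Tendsto (fun n => (h n).toFun i x) l (𝓝 (L x)) := by
    intro i
    -- On `A w` the morphisms converge, since they turn it into the framing vectors of the targets.
    -- Stability of the limit then makes every basis vector a limit of vectors along which the
    -- morphisms converge.
    have htop := hst (convergenceSubRep hP.1 hR.1 (fun n i => (h n).toFun i)
      (fun n i j d x => (h n).toHom.comm d x)) (fun i w => by
        refine ⟨fun n => (P n).A i w, R₀.A i (α i w), hP.2.1 i w, ?_⟩
        simp only [(h _).comm_A]
        exact hR.2.1 i _) i
    have hmem : ∀ j : Fin (a i), ∃ (u : ι → Cn a i) (y : Cn b i),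
        Tendsto u l (𝓝 (Pi.single j 1)) ∧ Tendsto (fun n => (h n).toFun i (u n)) l (𝓝 y) := by
      intro j
      have : (Pi.single j 1 : Cn a i) ∈ (⊤ : Submodule ℂ (Cn a i)) := trivial
      rw [← htop] at this
      exact this
    choose u y hu hy using hmem
    refine exists_tendsto_of_basis (M := fun n => Matrix.of fun r c => u c n r) (y := y) ?_ hy
    refine tendsto_pi_nhds.2 fun r => tendsto_pi_nhds.2 fun c => ?_
    have := tendsto_pi_nhds.1 (hu c) r
    simpa [Matrix.one_apply, Pi.single_apply] using this
  choose L hL using key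
  refine ⟨{ toHom := Hom.ofAct L fun i j d x => ?_, comm_A := fun i w => ?_,
            comm_B := fun i x => ?_ }, hL⟩
  · refine tendsto_nhds_unique (tendsto_linearMap_apply (hL j) (hP.1 i j d x)) ?_
    simp only [(h _).toHom.comm]
    exact tendsto_linearMap_apply (hR.1 i j d) (hL i x)
  · refine tendsto_nhds_unique (tendsto_linearMap_apply (hL i) (hP.2.1 i w)) ?_
    simp only [(h _).comm_A]
    exact hR.2.1 i _
  · refine tendsto_nhds_unique (tendsto_linearMap_apply (hR.2.2 i) (hL i x)) ?_
    simp only [(h _).comm_B]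
    exact ((hα i).tendsto _).comp (hP.2.2 i x)

end Topology

/-! ### The quiver variety is Hausdorff -/

section NakTopology

variable {I : Type*} [Quiver I] [Fintype I] [∀ i j : I, Fintype (i ⟶ j)]
  {W : I → Type*} [∀ i, AddCommGroup (W i)] [∀ i, Module ℂ (W i)] [∀ i, TopologicalSpace (W i)]

/-- The action of `∏ᵢ GL(Vᵢ)` on `μ⁻¹(0)ˢ`. -/
def StableRep.gauge {v : I → ℕ} (g : ∀ i, Cn v i ≃ₗ[ℂ] Cn v i) (R : StableRep v W) :
    StableRep v W :=
  ⟨R.1.transport g, FramedRep.moment_transport R.2.1 g, R.2.2.transport g⟩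

theorem Nak.mk_gauge {v : I → ℕ} (g : ∀ i, Cn v i ≃ₗ[ℂ] Cn v i) (R : StableRep v W) :
    Nak.mk (R.gauge g) = Nak.mk R :=
  (Quotient.sound (s := gaugeSetoid v W) ⟨g, rfl⟩ : Nak.mk R = Nak.mk (R.gauge g)).symm

theorem StableRep.continuous_gauge {v : I → ℕ} (g : ∀ i, Cn v i ≃ₗ[ℂ] Cn v i) :
    Continuous (StableRep.gauge g : StableRep v W → StableRep v W) := by
  refine continuous_induced_rng.2 ?_
  have h0 := FramedRep.continuous_iff.1
    (continuous_subtype_val : Continuous (Subtype.val : StableRep v W → FramedRep (Cn v) W))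
  have hg : ∀ i, Continuous (g i) := fun i => (g i).toLinearMap.continuous_of_finiteDimensional
  refine FramedRep.continuous_iff.2 ⟨fun i j d x => ?_, fun i w => ?_, fun i x => ?_⟩
  · have : (fun R : StableRep v W => (R.gauge g).1.act d x) =
        fun R => g j (R.1.act d ((g i).symm x)) :=
      funext fun R => DoubleRep.act_transport _ g d x
    exact this ▸ (hg j).comp (h0.1 i j d _)
  · exact (hg i).comp (h0.2.1 i w)
  · exact h0.2.2 i _

theorem Nak.continuous_mk {v : I → ℕ} : Continuous (Nak.mk : StableRep v W → Nak v W) :=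
  continuous_quotient_mk'

/-- The saturation of an open set is the union of its preimages under the gauge group, which acts
continuously. Openness is what lifts limits in the quotient to limits of representatives. -/
theorem Nak.isOpenMap_mk {v : I → ℕ} : IsOpenMap (Nak.mk : StableRep v W → Nak v W) := by
  intro U hU
  have : IsOpen ((Nak.mk : StableRep v W → Nak v W) ⁻¹' (Nak.mk '' U)) := by
    have e : (Nak.mk : StableRep v W → Nak v W) ⁻¹' (Nak.mk '' U) =
        ⋃ g : ∀ i, Cn v i ≃ₗ[ℂ] Cn v i, StableRep.gauge g ⁻¹' U := by
      ext R
      simp only [Set.mem_preimage, Set.mem_image, Set.mem_iUnion]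
      constructor
      · rintro ⟨S, hS, h⟩
        obtain ⟨g, hg⟩ := Quotient.exact h.symm
        refine ⟨g, ?_⟩
        rwa [show R.gauge g = S from Subtype.ext hg]
      · rintro ⟨g, hg⟩
        exact ⟨_, hg, Nak.mk_gauge g R⟩
    rw [e]
    exact isOpen_iUnion fun g => hU.preimage (StableRep.continuous_gauge g)
  exact this

theorem Nak.isOpenQuotientMap_mk {v : I → ℕ} :
    IsOpenQuotientMap (Nak.mk : StableRep v W → Nak v W) :=
  ⟨Nak.exists_rep, Nak.continuous_mk, Nak.isOpenMap_mk⟩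

variable [∀ i, IsTopologicalAddGroup (W i)] [∀ i, ContinuousSMul ℂ (W i)] [∀ i, T2Space (W i)]

/-- For an open quotient map it suffices that the orbit relation is closed. Isomorphisms along a
converging family of isomorphic pairs converge, and so do their inverses, because both limits are
stable; two limits in opposite directions are isomorphisms. -/
instance {v : I → ℕ} : T2Space (Nak v W) := by
  rw [t2Space_iff_of_isOpenQuotientMap (Nak.isOpenQuotientMap_mk (v := v) (W := W)),
    ← closure_subset_iff_isClosed]
  rintro ⟨R₀, S₀⟩ hRS
  rw [mem_closure_iff_comap_neBot] at hRS
  set Z := {q : StableRep v W × StableRep v W | Nak.mk q.1 = Nak.mk q.2}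
  have hval : Tendsto (Subtype.val : Z → _) (comap Subtype.val (𝓝 (R₀, S₀))) (𝓝 (R₀, S₀)) :=
    tendsto_comap
  have hR : Tendsto (fun q : Z => q.1.1.1) (comap Subtype.val (𝓝 (R₀, S₀))) (𝓝 R₀.1) :=
    (continuous_subtype_val.tendsto _).comp ((continuous_fst.tendsto _).comp hval)
  have hS : Tendsto (fun q : Z => q.1.2.1) (comap Subtype.val (𝓝 (R₀, S₀))) (𝓝 S₀.1) :=
    (continuous_subtype_val.tendsto _).comp ((continuous_snd.tendsto _).comp hval)
  have hφ : ∀ q : Z, ∃ φ : FramedHom q.1.1.1 q.1.2.1 (fun _ => LinearMap.id),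
      ∀ i, Function.Bijective (φ.toFun i) := fun q => Nak.mk_eq_mk_iff.1 q.2
  choose φ hbij using hφ
  obtain ⟨φ₀, -⟩ := FramedHom.exists_tendsto (fun i => continuous_id) hR hS R₀.2.2 φ
  obtain ⟨ψ₀, -⟩ := FramedHom.exists_tendsto (fun i => continuous_id) hS hR S₀.2.2
    (fun q => (φ q).symm (hbij q))
  exact Nak.mk_eq_mk_iff.2 ⟨φ₀, φ₀.bijective_of_isStable R₀.2.2 S₀.2.2 ψ₀⟩

end NakTopology

/-! ### Subrepresentations and quotients as points of quiver varieties -/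

section Models

variable {I : Type*} [Quiver I]

variable {V V₁ V₂ W W₁ W₂ : I → Type*}
  [∀ i, AddCommGroup (V i)] [∀ i, Module ℂ (V i)]
  [∀ i, AddCommGroup (V₁ i)] [∀ i, Module ℂ (V₁ i)]
  [∀ i, AddCommGroup (V₂ i)] [∀ i, Module ℂ (V₂ i)]
  [∀ i, AddCommGroup (W i)] [∀ i, Module ℂ (W i)]
  [∀ i, AddCommGroup (W₁ i)] [∀ i, Module ℂ (W₁ i)]
  [∀ i, AddCommGroup (W₂ i)] [∀ i, Module ℂ (W₂ i)]

/-- The subrepresentation generated by the images of the maps `Aᵢ ∘ αᵢ`. -/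
def FramedRep.gen (R : FramedRep V W) (α : ∀ i, W₁ i →ₗ[ℂ] W i) : SubRep R.toDoubleRep :=
  SubRep.ofAct (fun i => ⨅ L : {L : SubRep R.toDoubleRep // ∀ i w, R.A i (α i w) ∈ L.carrier i},
    L.1.carrier i) (fun i j d x hx => by
      rw [Submodule.mem_iInf] at hx ⊢
      exact fun L => L.1.act_mem d (hx L))

theorem FramedRep.A_mem_gen (R : FramedRep V W) (α : ∀ i, W₁ i →ₗ[ℂ] W i) (i : I) (w : W₁ i) :
    R.A i (α i w) ∈ (R.gen α).carrier i :=
  (Submodule.mem_iInf _).2 fun L => L.2 i w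

theorem FramedRep.gen_le (R : FramedRep V W) (α : ∀ i, W₁ i →ₗ[ℂ] W i)
    (L : SubRep R.toDoubleRep) (h : ∀ i w, R.A i (α i w) ∈ L.carrier i) : R.gen α ≤ L :=
  fun _ _ hx => (Submodule.mem_iInf _).1 hx ⟨L, h⟩

/-- A subrepresentation with a framing obtained from that of the whole representation. -/
def SubRep.framedSub {R : FramedRep V W} (K : SubRep R.toDoubleRep) (α : ∀ i, W₁ i →ₗ[ℂ] W i)
    (ρ : ∀ i, W i →ₗ[ℂ] W₁ i) (hA : ∀ i w, R.A i (α i w) ∈ K.carrier i) :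
    FramedRep (fun i => K.carrier i) W₁ where
  toDoubleRep := K.toRep
  A i := (R.A i ∘ₗ α i).codRestrict _ (hA i)
  B i := ρ i ∘ₗ R.B i ∘ₗ (K.carrier i).subtype

/-- A quotient representation with a framing obtained from that of the whole representation. -/
def SubRep.framedQuotient {R : FramedRep V W} (K : SubRep R.toDoubleRep)
    (α : ∀ i, W i →ₗ[ℂ] W₁ i) (σ : ∀ i, W₁ i →ₗ[ℂ] W i)
    (hB : ∀ i, ∀ x ∈ K.carrier i, α i (R.B i x) = 0) :
    FramedRep (fun i => V i ⧸ K.carrier i) W₁ where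
  toDoubleRep := K.quotient
  A i := (K.carrier i).mkQ ∘ₗ R.A i ∘ₗ σ i
  B i := (K.carrier i).liftQ (α i ∘ₗ R.B i) (fun x hx => hB i x hx)

variable [Fintype I] [∀ i j : I, Fintype (i ⟶ j)]

/-- Every finite-dimensional stable representation with vanishing moment map is isomorphic to one
on the standard spaces. -/
theorem FramedRep.exists_stableRep [∀ i, FiniteDimensional ℂ (V i)] {R : FramedRep V W}
    (hm : ∀ i, R.moment i = 0) (hs : R.IsStable) :
    ∃ S : StableRep (fun i => Module.finrank ℂ (V i)) W,
      ∃ φ : FramedHom R S.1 (fun _ => LinearMap.id), ∀ i, Function.Bijective (φ.toFun i) :=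
  ⟨⟨R.transport fun i => (Module.finBasis ℂ (V i)).equivFun,
    FramedRep.moment_transport hm _, hs.transport _⟩, R.transportHom _, R.transportHom_bijective _⟩

/-- By `hA` the map `A` modulo `K` factors through `α`, with `σ` used to write the factor down, and
by `hB` the map `α ∘ B` descends. Stability and the moment equation pass along the framed
surjection. -/
theorem exists_quotient_model [∀ i, FiniteDimensional ℂ (V i)] {R : FramedRep V W}
    (hm : ∀ i, R.moment i = 0) (hs : R.IsStable) (K : SubRep R.toDoubleRep)
    (α : ∀ i, W i →ₗ[ℂ] W₁ i) (σ : ∀ i, W₁ i →ₗ[ℂ] W i)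
    (hA : ∀ i w, R.A i w - R.A i (σ i (α i w)) ∈ K.carrier i)
    (hB : ∀ i, ∀ x ∈ K.carrier i, α i (R.B i x) = 0) :
    ∃ (u : I → ℕ) (S : StableRep u W₁) (φ : FramedHom R S.1 α), φ.toHom.Surjective ∧
      ∀ i x, φ.toFun i x = 0 ↔ x ∈ K.carrier i := by
  let π : FramedHom R (K.framedQuotient α σ hB) α :=
    { toHom := Hom.ofAct (fun i => (K.carrier i).mkQ) (fun i j d x => (K.act_quotient d x).symm)
      comm_A := fun i w => (Submodule.Quotient.eq _).2 (hA i w)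
      comm_B := fun i x => rfl }
  have hπ : π.toHom.Surjective := fun i => Submodule.mkQ_surjective _
  obtain ⟨S, φ, hφ⟩ := FramedRep.exists_stableRep (π.moment_eq_zero_of_surjective hπ hm)
    (hs.of_surjective π hπ)
  refine ⟨_, S, φ.comp π α (fun _ _ => rfl), fun i => (hφ i).2.comp (hπ i), fun i x => ?_⟩
  rw [FramedHom.comp_toFun, map_eq_zero_iff _ (hφ i).1]
  exact Submodule.Quotient.mk_eq_zero _

/-- By `hB` the values of `B` on the generated subrepresentation come from `W₁`, with `ρ` providing
preimages, so the inclusion is framed and the moment equation restricts. -/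
theorem exists_sub_model [∀ i, FiniteDimensional ℂ (V i)] {R : FramedRep V W}
    (hm : ∀ i, R.moment i = 0) (α : ∀ i, W₁ i →ₗ[ℂ] W i) (ρ : ∀ i, W i →ₗ[ℂ] W₁ i)
    (hB : ∀ i, ∀ x ∈ (R.gen α).carrier i, α i (ρ i (R.B i x)) = R.B i x) :
    ∃ (u : I → ℕ) (S : StableRep u W₁) (φ : FramedHom S.1 R α),
      (∀ i, Function.Injective (φ.toFun i)) ∧
      ∀ i, LinearMap.range (φ.toFun i) = (R.gen α).carrier i := by
  let ι : FramedHom ((R.gen α).framedSub α ρ (R.A_mem_gen α)) R α :=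
    { toHom := Hom.ofAct (fun i => ((R.gen α).carrier i).subtype)
        (fun i j d x => (R.gen α).coe_act_toRep d x)
      comm_A := fun i w => rfl
      comm_B := fun i x => (hB i x x.2).symm }
  have hι : ∀ i, Function.Injective (ι.toFun i) := fun i => Submodule.injective_subtype _
  have hst : ((R.gen α).framedSub α ρ (R.A_mem_gen α)).IsStable := by
    intro L hL i
    -- A subrepresentation of the generated one containing the framing is one of `R`, so minimality
    -- applies.
    have := R.gen_le α (SubRep.ofAct (fun i => (L.carrier i).map ((R.gen α).carrier i).subtype)
      (by
        rintro i j d _ ⟨x, hx, rfl⟩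
        exact ⟨_, L.act_mem d hx, (R.gen α).coe_act_toRep d x⟩))
      (fun i w => ⟨_, hL i w, rfl⟩) i
    rw [eq_top_iff]
    rintro ⟨x, hx⟩ -
    obtain ⟨y, hy, hyx⟩ := this hx
    rwa [show (⟨x, hx⟩ : (R.gen α).carrier i) = y from Subtype.ext hyx.symm]
  obtain ⟨S, φ, hφ⟩ := FramedRep.exists_stableRep (ι.moment_eq_zero_of_injective hι hm) hst
  refine ⟨_, S, ι.comp (φ.symm hφ) α (fun _ _ => rfl),
    fun i => (hι i).comp (φ.symm_bijective hφ i).1, fun i => ?_⟩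
  ext x
  constructor
  · rintro ⟨y, rfl⟩
    exact ((φ.symm hφ).toFun i y).2
  · intro hx
    obtain ⟨y, hy⟩ := (φ.symm_bijective hφ i).2 ⟨x, hx⟩
    exact ⟨y, congrArg Subtype.val hy⟩

end Models

/-! ### Splittings and dimension counts for short exact sequences -/

section LinearAlgebra

/-- An arbitrary left inverse of `f` is corrected by `s ∘ g` so that it vanishes on the chosen
complement. -/
theorem exists_splitting {k E F G : Type*} [Field k] [AddCommGroup E] [Module k E]
    [AddCommGroup F] [Module k F] [AddCommGroup G] [Module k G] {f : E →ₗ[k] F} {g : F →ₗ[k] G}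
    (hf : Function.Injective f) (hg : Function.Surjective g) (hgf : ∀ x, g (f x) = 0)
    (hex : ∀ y, g y = 0 → ∃ x, f x = y) :
    ∃ (r : F →ₗ[k] E) (s : G →ₗ[k] F), (∀ x, r (f x) = x) ∧ (∀ z, g (s z) = z) ∧
      ∀ y, f (r y) + s (g y) = y := by
  obtain ⟨s, hs⟩ := g.exists_rightInverse_of_surjective (LinearMap.range_eq_top.2 hg)
  obtain ⟨r, hr⟩ := f.exists_leftInverse_of_injective (LinearMap.ker_eq_bot.2 hf)
  have hs' : ∀ z, g (s z) = z := fun z => LinearMap.congr_fun hs z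
  have hr' : ∀ x, r (f x) = x := fun z => LinearMap.congr_fun hr z
  refine ⟨r ∘ₗ (LinearMap.id - s ∘ₗ g), s, fun x => by simp [hgf, hr'], hs', fun y => ?_⟩
  obtain ⟨x, hx⟩ := hex (y - s (g y)) (by simp [hs'])
  have : (LinearMap.id - s ∘ₗ g : F →ₗ[k] F) y = f x := by simp [hx]
  rw [LinearMap.comp_apply, this, hr', hx]
  abel

variable {I : Type*} {v' v'' v : I → ℕ} {f : ∀ i, Cn v' i →ₗ[ℂ] Cn v i}
  {g : ∀ i, Cn v i →ₗ[ℂ] Cn v'' i}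

theorem range_eq_ker_of_dim (hv : v' + v'' = v) (hf : ∀ i, Function.Injective (f i))
    (hg : ∀ i, Function.Surjective (g i)) (hgf : ∀ i x, g i (f i x) = 0) (i : I) :
    LinearMap.range (f i) = LinearMap.ker (g i) := by
  apply Submodule.eq_of_le_of_finrank_eq
  · rintro _ ⟨x, rfl⟩
    exact hgf i x
  · have h1 := LinearMap.finrank_range_add_finrank_ker (g i)
    rw [LinearMap.range_eq_top.2 (hg i)] at h1
    have h2 := LinearMap.finrank_range_of_inj (hf i)
    have h3 := congrFun hv i
    simp only [Pi.add_apply] at h3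
    simp at h1 h2
    omega

theorem dim_add_of_exact (hf : ∀ i, Function.Injective (f i))
    (hg : ∀ i, Function.Surjective (g i))
    (hfg : ∀ i, LinearMap.range (f i) = LinearMap.ker (g i)) : v' + v'' = v := by
  funext i
  have h1 := LinearMap.finrank_range_add_finrank_ker (g i)
  rw [LinearMap.range_eq_top.2 (hg i), ← hfg i] at h1
  have h2 := LinearMap.finrank_range_of_inj (hf i)
  simp at h1 h2
  simp only [Pi.add_apply]
  omega

end LinearAlgebra

/-! ### Uniqueness of the summands of a direct sum -/

section Sums

variable {I : Type*} [Quiver I] [Fintype I] [∀ i j : I, Fintype (i ⟶ j)]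
  {W' W'' : I → Type*}
  [∀ i, AddCommGroup (W' i)] [∀ i, Module ℂ (W' i)]
  [∀ i, AddCommGroup (W'' i)] [∀ i, Module ℂ (W'' i)]

theorem Nak.sum_mk_mk {v' v'' v : I → ℕ} (h : v' + v'' = v) (R' : StableRep v' W')
    (R'' : StableRep v'' W'') :
    Nak.sum h (Nak.mk R') (Nak.mk R'') = Nak.mk (StableRep.sum h R' R'') := rfl

theorem Nak.mk_eq_sum_iff {v' v'' v : I → ℕ} (h : v' + v'' = v) {R' : StableRep v' W'}
    {R'' : StableRep v'' W''} {R : StableRep v (FSum W' W'')} :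
    Nak.mk R = Nak.sum h (Nak.mk R') (Nak.mk R'') ↔
      ∃ φ : FramedHom (R'.1.directSum R''.1) R.1 (fun _ => LinearMap.id),
        ∀ i, Function.Bijective (φ.toFun i) := by
  have ht := (R'.1.directSum R''.1).transportHom_bijective (sumEquiv h)
  rw [Nak.sum_mk_mk, eq_comm, Nak.mk_eq_mk_iff]
  constructor
  · rintro ⟨φ, hφ⟩
    exact ⟨φ.comp ((R'.1.directSum R''.1).transportHom (sumEquiv h)) _ (fun _ _ => rfl),
      fun i => (hφ i).comp (ht i)⟩
  · rintro ⟨φ, hφ⟩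
    exact ⟨φ.comp (((R'.1.directSum R''.1).transportHom (sumEquiv h)).symm ht) _ (fun _ _ => rfl),
      fun i => (hφ i).comp (FramedHom.symm_bijective _ ht i)⟩

/-- An isomorphism of direct sums and its inverse have diagonal blocks over the identity of the
framing. These are framed morphisms in both directions between stable representations, hence
isomorphisms, without any claim on the off-diagonal blocks. -/
theorem Nak.sum_eq_sum_iff {u' u'' v' v'' v : I → ℕ} (hu : u' + u'' = v) (hv : v' + v'' = v)
    {S' : StableRep u' W'} {S'' : StableRep u'' W''}
    {R' : StableRep v' W'} {R'' : StableRep v'' W''} :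
    Nak.sum hu (Nak.mk S') (Nak.mk S'') = Nak.sum hv (Nak.mk R') (Nak.mk R'') ↔
      (∃ φ' : FramedHom R'.1 S'.1 (fun _ => LinearMap.id), ∀ i, Function.Bijective (φ'.toFun i)) ∧
      ∃ φ'' : FramedHom R''.1 S''.1 (fun _ => LinearMap.id),
        ∀ i, Function.Bijective (φ''.toFun i) := by
  constructor
  · intro h
    obtain ⟨φ, hφ⟩ := (Nak.mk_eq_sum_iff hv).1 h
    have ht := (S'.1.directSum S''.1).transportHom_bijective (sumEquiv hu)
    let χ : FramedHom (R'.1.directSum R''.1) (S'.1.directSum S''.1) (fun _ => LinearMap.id) :=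
      (((S'.1.directSum S''.1).transportHom (sumEquiv hu)).symm ht).comp φ _ (fun _ _ => rfl)
    have hχ : ∀ i, Function.Bijective (χ.toFun i) := fun i =>
      (FramedHom.symm_bijective _ ht i).comp (hφ i)
    constructor
    · refine ⟨(S'.1.fstHom S''.1).comp (χ.comp (R'.1.inlHom R''.1) (fun i => LinearMap.inl ℂ _ _)
        (fun _ _ => rfl)) _ (fun _ _ => rfl), fun i => FramedHom.bijective_of_isStable R'.2.2 S'.2.2 _
        ((R'.1.fstHom R''.1).comp ((χ.symm hχ).comp (S'.1.inlHom S''.1) (fun i => LinearMap.inl ℂ _ _)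
          (fun _ _ => rfl)) _
          (fun _ _ => rfl)) i⟩
    · refine ⟨(S'.1.sndHom S''.1).comp (χ.comp (R'.1.inrHom R''.1) (fun i => LinearMap.inr ℂ _ _)
        (fun _ _ => rfl)) _ (fun _ _ => rfl), fun i => FramedHom.bijective_of_isStable R''.2.2 S''.2.2 _
        ((R'.1.sndHom R''.1).comp ((χ.symm hχ).comp (S'.1.inrHom S''.1) (fun i => LinearMap.inr ℂ _ _)
          (fun _ _ => rfl)) _
          (fun _ _ => rfl)) i⟩
  · rintro ⟨⟨φ', h'⟩, ⟨φ'', h''⟩⟩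
    obtain rfl := dim_eq_of_bijective _ h'
    obtain rfl := dim_eq_of_bijective _ h''
    rw [Nak.mk_eq_mk_iff.2 ⟨φ', h'⟩, Nak.mk_eq_mk_iff.2 ⟨φ'', h''⟩]

end Sums

/-! ### The vanishing forced by the existence of a limit -/

section TorusLimits

instance comap_coe_units_neBot : (comap ((↑) : ℂˣ → ℂ) (𝓝 0)).NeBot := by
  rw [comap_neBot_iff]
  intro t ht
  obtain ⟨z, hz, h0⟩ := (inter_mem (mem_nhdsWithin_of_mem_nhds ht) self_mem_nhdsWithin :
    t ∩ {0}ᶜ ∈ 𝓝[≠] (0 : ℂ)) |> nonempty_of_mem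
  exact ⟨Units.mk0 z h0, hz⟩

variable {I : Type*} [Quiver I] {V W' W'' : I → Type*}
  [∀ i, AddCommGroup (V i)] [∀ i, Module ℂ (V i)]
  [∀ i, AddCommGroup (W' i)] [∀ i, Module ℂ (W' i)]
  [∀ i, AddCommGroup (W'' i)] [∀ i, Module ℂ (W'' i)]

theorem FramedRep.reframe_torus_A (R : FramedRep V (FSum W' W'')) (t : ℂˣ) (i : I)
    (w : FSum W' W'' i) :
    (R.reframe (torus W' W'' t)).A i w = R.A i ((t⁻¹ : ℂˣ) • w.1, w.2) := rfl

theorem FramedRep.reframe_torus_B (R : FramedRep V (FSum W' W'')) (t : ℂˣ) (i : I) (x : V i) :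
    (R.reframe (torus W' W'' t)).B i x = (t • (R.B i x).1, (R.B i x).2) := rfl

theorem FramedRep.reframe_act (R : FramedRep V W') (U : ∀ i, W' i ≃ₗ[ℂ] W' i) {i j : I}
    (d : DArrow i j) : (R.reframe U).act d = R.act d := by
  cases d <;> rfl

variable [Fintype I] [∀ i j : I, Fintype (i ⟶ j)]

theorem Nak.smul_mk {v : I → ℕ} (t : ℂˣ) (R : StableRep v (FSum W' W'')) :
    t • Nak.mk R = Nak.mk (R.twist t) := rfl

variable
  [∀ i, TopologicalSpace (W' i)] [∀ i, IsTopologicalAddGroup (W' i)]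
  [∀ i, ContinuousSMul ℂ (W' i)] [∀ i, T2Space (W' i)]
  [∀ i, TopologicalSpace (W'' i)] [∀ i, IsTopologicalAddGroup (W'' i)]
  [∀ i, ContinuousSMul ℂ (W'' i)] [∀ i, T2Space (W'' i)]

/-- If the limit for `t → 0` exists, then the maps `B''` vanish on the subrepresentation generated
by the images of the maps `A'`. -/
theorem LimZero.B_snd_eq_zero {v : I → ℕ} {R : StableRep v (FSum W' W'')}
    {p : Nak v (FSum W' W'')} (h : LimZero (Nak.mk R) p) (i : I) (x : Cn v i)
    (hx : x ∈ (R.1.gen (fun i => LinearMap.inl ℂ (W' i) (W'' i))).carrier i) :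
    (R.1.B i x).2 = 0 := by
  obtain ⟨P, rfl⟩ := p.exists_rep
  -- The indices are representatives of torus translates, filtered by convergence to `P` and of `t`
  -- to 0. Openness of the quotient map makes the filter non-trivial.
  let Z := {q : StableRep v (FSum W' W'') × ℂˣ // Nak.mk q.1 = q.2 • Nak.mk R}
  let l : Filter Z := comap Subtype.val (𝓝 P ×ˢ comap ((↑) : ℂˣ → ℂ) (𝓝 0))
  have hl : l.NeBot := by
    rw [comap_neBot_iff]
    intro s hs
    obtain ⟨U, hU, T, hT, hUT⟩ := mem_prod_iff.1 hs
    have h1 : Nak.mk '' U ∈ 𝓝 (Nak.mk P) := Nak.isOpenMap_mk.image_mem_nhds hU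
    obtain ⟨t, ht, htT⟩ := nonempty_of_mem (inter_mem (mem_map.1 (h h1)) hT)
    obtain ⟨Q, hQ, hQt⟩ := ht
    exact ⟨⟨(Q, t), hQt⟩, hUT ⟨hQ, htT⟩⟩
  have hval : Tendsto (Subtype.val : Z → _) l (𝓝 P ×ˢ comap ((↑) : ℂˣ → ℂ) (𝓝 0)) := tendsto_comap
  have hP : Tendsto (fun q : Z => q.1.1.1) l (𝓝 P.1) :=
    (continuous_subtype_val.tendsto _).comp (tendsto_fst.comp hval)
  have ht : Tendsto (fun q : Z => (q.1.2 : ℂ)) l (𝓝 0) :=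
    tendsto_comap.comp (tendsto_snd.comp hval)
  rw [FramedRep.tendsto_iff] at hP
  have hφ : ∀ q : Z, ∃ φ : FramedHom (R.twist q.1.2).1 q.1.1.1 (fun _ => LinearMap.id),
      ∀ i, Function.Bijective (φ.toFun i) := fun q =>
    Nak.mk_eq_mk_iff.1 ((Nak.smul_mk q.1.2 R).symm.trans q.2.symm)
  choose φ hφ using hφ
  have hcomm : ∀ (q : Z) (i j : I) (d : DArrow i j) (x : Cn v i),
      (φ q).toFun j (R.1.act d x) = q.1.1.1.act d ((φ q).toFun i x) := by
    intro q i j d x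
    rw [← (φ q).toHom.comm]
    exact congrArg _ (LinearMap.congr_fun (R.1.reframe_act _ d) x).symm
  -- These are the vectors whose images still converge after division by `t`. They contain the
  -- images of `A'`, since the twist divides `A'` by `t`.
  let L : SubRep R.1.toDoubleRep := SubRep.ofAct
    (fun i =>
      { carrier := {x | ∃ y, Tendsto (fun q : Z => (q.1.2 : ℂ)⁻¹ • (φ q).toFun i x) l (𝓝 y)}
        add_mem' := by
          rintro x x' ⟨y, hy⟩ ⟨y', hy'⟩
          exact ⟨y + y', by simpa using hy.add hy'⟩
        zero_mem' := ⟨0, by simp⟩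
        smul_mem' := by
          rintro c x ⟨y, hy⟩
          refine ⟨c • y, ?_⟩
          simp only [map_smul, smul_comm _ c]
          exact hy.const_smul c })
    (by
      rintro i j d x ⟨y, hy⟩
      refine ⟨P.1.act d y, ?_⟩
      refine (tendsto_linearMap_apply (hP.1 i j d) hy).congr fun q => ?_
      rw [map_smul, hcomm])
  have hL : ∀ i w, R.1.A i (LinearMap.inl ℂ (W' i) (W'' i) w) ∈ L.carrier i := by
    intro i w
    refine ⟨P.1.A i (w, 0), (hP.2.1 i (w, 0)).congr fun q => ?_⟩
    have h1 := (φ q).comm_A i ((q.1.2 : ℂ) • w, 0)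
    have h2 : (R.twist q.1.2).1.A i ((q.1.2 : ℂ) • w, 0) = R.1.A i (w, 0) := by
      change R.1.A i ((q.1.2⁻¹ : ℂˣ) • ((q.1.2 : ℂˣ) • w), 0) = _
      rw [inv_smul_smul]
    rw [h2] at h1
    change _ = _ • (φ q).toFun i (R.1.A i (w, 0))
    rw [h1]
    change _ = _ • (q.1.1.1).A i ((q.1.2 : ℂ) • w, 0)
    rw [← map_smul]
    congr 1
    ext
    · simp
    · simp
  obtain ⟨y, hy⟩ := R.1.gen_le _ L hL i hx
  -- The twist leaves `B''` alone, so `B'' x` is `t` times a convergent quantity and must vanish.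
  have h1 : ∀ q : Z, (R.1.B i x).2 =
      (q.1.2 : ℂ) • (q.1.1.1.B i ((q.1.2 : ℂ)⁻¹ • (φ q).toFun i x)).2 := by
    intro q
    rw [map_smul, Prod.smul_snd, smul_inv_smul₀ q.1.2.ne_zero, (φ q).comm_B]
    rfl
  have h2 : Tendsto (fun q : Z =>
      (q.1.2 : ℂ) • (q.1.1.1.B i ((q.1.2 : ℂ)⁻¹ • (φ q).toFun i x)).2) l
      (𝓝 ((0 : ℂ) • (P.1.B i y).2)) :=
    ht.smul ((continuous_snd.tendsto _).comp (tendsto_linearMap_apply (hP.2.2 i) hy))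
  rw [zero_smul] at h2
  simp only [← h1] at h2
  exact tendsto_nhds_unique tendsto_const_nhds h2

end TorusLimits

/-! ### Extensions degenerate to direct sums; torus fixed points -/

section Degeneration

variable {I : Type*} [Quiver I] {W' W'' : I → Type*}
  [∀ i, AddCommGroup (W' i)] [∀ i, Module ℂ (W' i)]
  [∀ i, AddCommGroup (W'' i)] [∀ i, Module ℂ (W'' i)]

/-- The family of extensions which degenerates an extension of `R''` by `R'`, split by the linear
maps `r` and `s`, to the direct sum. -/
def extensionFamily {v' v'' v : I → ℕ} (R' : FramedRep (Cn v') W') (R'' : FramedRep (Cn v'') W'')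
    (R : FramedRep (Cn v) (FSum W' W'')) (r : ∀ i, Cn v i →ₗ[ℂ] Cn v' i)
    (s : ∀ i, Cn v'' i →ₗ[ℂ] Cn v i) (t : ℂ) : FramedRep (FSum (Cn v') (Cn v'')) (FSum W' W'') where
  toDoubleRep := DoubleRep.ofAct fun i j d =>
    (R'.directSum R'').act d +
      t • LinearMap.inl ℂ _ _ ∘ₗ r j ∘ₗ R.act d ∘ₗ s i ∘ₗ LinearMap.snd ℂ _ _
  A i := (R'.directSum R'').A i +
    t • LinearMap.inl ℂ _ _ ∘ₗ r i ∘ₗ R.A i ∘ₗ LinearMap.inr ℂ _ _ ∘ₗ LinearMap.snd ℂ _ _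
  B i := (R'.directSum R'').B i +
    t • LinearMap.inl ℂ _ _ ∘ₗ LinearMap.fst ℂ _ _ ∘ₗ R.B i ∘ₗ s i ∘ₗ LinearMap.snd ℂ _ _

theorem extensionFamily_zero {v' v'' v : I → ℕ} (R' : FramedRep (Cn v') W')
    (R'' : FramedRep (Cn v'') W'') (R : FramedRep (Cn v) (FSum W' W''))
    (r : ∀ i, Cn v i →ₗ[ℂ] Cn v' i) (s : ∀ i, Cn v'' i →ₗ[ℂ] Cn v i) :
    extensionFamily R' R'' R r s 0 = R'.directSum R'' := by
  refine FramedRep.ext_act (fun i j d x => ?_) (fun i w => ?_) (fun i x => ?_)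
  · simp [extensionFamily]
  · simp [extensionFamily]
  · simp [extensionFamily]

/-- For invertible `t`, the family of extensions is isomorphic to the torus orbit. -/
def extensionFamilyHom {v' v'' v : I → ℕ} {R' : FramedRep (Cn v') W'}
    {R'' : FramedRep (Cn v'') W''} {R : FramedRep (Cn v) (FSum W' W'')}
    (f : FramedHom R' R (fun i => LinearMap.inl ℂ (W' i) (W'' i)))
    (g : FramedHom R R'' (fun i => LinearMap.snd ℂ (W' i) (W'' i)))
    (r : ∀ i, Cn v i →ₗ[ℂ] Cn v' i) (s : ∀ i, Cn v'' i →ₗ[ℂ] Cn v i)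
    (hrf : ∀ i x, r i (f.toFun i x) = x)
    (hfs : ∀ i x, f.toFun i (r i x) + s i (g.toFun i x) = x) (t : ℂˣ) :
    FramedHom (R.reframe (torus W' W'' t)) (extensionFamily R' R'' R r s t)
      (fun _ => LinearMap.id) where
  -- Scaling the first coordinate by `t` multiplies the off-diagonal blocks by `t` and cancels the
  -- factors by which the torus acts on the `W'` parts of `A` and `B`.
  toHom := Hom.ofAct (fun i => ((t : ℂ) • r i).prod (g.toFun i)) (fun i j d x => by
    rw [FramedRep.reframe_act]
    have h1 : r j (R.act d x) = R'.act d (r i x) + r j (R.act d (s i (g.toFun i x))) := by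
      conv_lhs => rw [← hfs i x]
      rw [map_add, map_add, ← f.toHom.comm, hrf]
    have h2 := g.toHom.comm d x
    ext1
    · simp [extensionFamily, FramedRep.act_directSum, h1]
    · simp [extensionFamily, FramedRep.act_directSum, h2])
  comm_A i w := by
    have h1 : r i (R.A i (((t⁻¹ : ℂˣ) • w.1), w.2)) =
        (t : ℂ)⁻¹ • R'.A i w.1 + r i (R.A i (0, w.2)) := by
      rw [← hrf i ((t : ℂ)⁻¹ • R'.A i w.1), ← map_add, map_smul, f.comm_A, ← map_smul, ← map_add]
      congr 2
      ext
      · simp [Units.smul_def]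
      · simp
    have h2 := g.comm_A i (((t⁻¹ : ℂˣ) • w.1), w.2)
    rw [FramedRep.reframe_torus_A]
    ext1
    · simp [extensionFamily, Hom.ofAct, FramedRep.directSum, h1]
    · simpa [extensionFamily, Hom.ofAct, FramedRep.directSum] using h2
  comm_B i x := by
    have h1 := congrArg Prod.fst (f.comm_B i (r i x))
    have h2 := g.comm_B i x
    have h3 : R.B i x = R.B i (f.toFun i (r i x)) + R.B i (s i (g.toFun i x)) := by
      rw [← map_add, hfs]
    change _ = (R.reframe (torus W' W'' t)).B i x
    rw [FramedRep.reframe_torus_B]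
    ext1
    · rw [h3]
      simp at h1
      simp [extensionFamily, Hom.ofAct, FramedRep.directSum, h1, Units.smul_def]
    · simpa [extensionFamily, Hom.ofAct, FramedRep.directSum] using h2

variable [Fintype I] [∀ i j : I, Fintype (i ⟶ j)]
  [∀ i, TopologicalSpace (W' i)] [∀ i, IsTopologicalAddGroup (W' i)]
  [∀ i, ContinuousSMul ℂ (W' i)]
  [∀ i, TopologicalSpace (W'' i)] [∀ i, IsTopologicalAddGroup (W'' i)]
  [∀ i, ContinuousSMul ℂ (W'' i)]

theorem continuous_extensionFamily {v' v'' v : I → ℕ} (R' : FramedRep (Cn v') W')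
    (R'' : FramedRep (Cn v'') W'') (R : FramedRep (Cn v) (FSum W' W''))
    (r : ∀ i, Cn v i →ₗ[ℂ] Cn v' i) (s : ∀ i, Cn v'' i →ₗ[ℂ] Cn v i) :
    Continuous (extensionFamily R' R'' R r s) := by
  refine FramedRep.continuous_iff.2 ⟨fun i j d x => ?_, fun i w => ?_, fun i x => ?_⟩
  · simp only [extensionFamily, DoubleRep.act_ofAct, LinearMap.add_apply, LinearMap.smul_apply]
    fun_prop
  · simp only [extensionFamily, LinearMap.add_apply, LinearMap.smul_apply]
    fun_prop
  · simp only [extensionFamily, LinearMap.add_apply, LinearMap.smul_apply]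
    exact continuous_const.add (continuous_id.smul continuous_const)

/-- The torus orbit of an extension of `R''` by `R'` extends continuously to `t = 0`, by the
direct sum. -/
theorem exists_continuous_orbit {v' v'' v : I → ℕ} (hv : v' + v'' = v) {R' : StableRep v' W'}
    {R'' : StableRep v'' W''} {R : StableRep v (FSum W' W'')}
    (f : FramedHom R'.1 R.1 (fun i => LinearMap.inl ℂ (W' i) (W'' i)))
    (g : FramedHom R.1 R''.1 (fun i => LinearMap.snd ℂ (W' i) (W'' i)))
    (hf : ∀ i, Function.Injective (f.toFun i)) (hgf : ∀ i x, g.toFun i (f.toFun i x) = 0) :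
    ∃ γ : ℂ → Nak v (FSum W' W''), Continuous γ ∧ (∀ t : ℂˣ, γ t = t • Nak.mk R) ∧
      γ 0 = Nak.sum hv (Nak.mk R') (Nak.mk R'') := by
  have hg : g.toHom.Surjective := g.surjective R''.2.2 fun i => LinearMap.snd_surjective
  have hex := range_eq_ker_of_dim hv hf hg hgf
  have hsplit := fun i => exists_splitting (hf i) (hg i) (hgf i) (fun y hy => by
    have : y ∈ LinearMap.range (f.toFun i) := by rw [hex i]; exact hy
    exact this)
  choose r s hrf hgs hfs using hsplit
  have hbij : ∀ (t : ℂˣ) i,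
      Function.Bijective ((extensionFamilyHom f g r s hrf hfs t).toFun i) := by
    intro t i
    constructor
    · rw [injective_iff_map_eq_zero]
      intro x hx
      have h1 : (t : ℂ) • r i x = 0 := congrArg Prod.fst hx
      have h2 : g.toFun i x = 0 := congrArg Prod.snd hx
      rw [smul_eq_zero_iff_right t.ne_zero] at h1
      rw [← hfs i x, h1, h2]
      simp
    · rintro ⟨y, z⟩
      refine ⟨f.toFun i ((t : ℂ)⁻¹ • y) + s i z, Prod.ext ?_ ?_⟩
      -- At `s z` the splitting identity leaves `f (r (s z)) = 0`.
      · have h : r i (s i z) = 0 := by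
          have := hfs i (s i z)
          rw [hgs, add_eq_right] at this
          exact hf i (by rw [this, map_zero])
        change (t : ℂ) • r i _ = y
        rw [map_add, hrf, h, add_zero, smul_inv_smul₀ t.ne_zero]
      · change g.toFun i _ = z
        rw [map_add, hgf, hgs, zero_add]
  -- For `t ≠ 0` both properties are inherited from the isomorphic torus translate, at `t = 0` from
  -- the direct sum.
  have hprop : ∀ t : ℂ, (∀ i, (extensionFamily R'.1 R''.1 R.1 r s t).moment i = 0) ∧
      (extensionFamily R'.1 R''.1 R.1 r s t).IsStable := by
    intro t
    rcases eq_or_ne t 0 with rfl | ht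
    · rw [extensionFamily_zero]
      exact ⟨FramedRep.moment_directSum R'.2.1 R''.2.1, R'.2.2.directSum R''.2.2⟩
    · have hφ := hbij (Units.mk0 t ht)
      exact ⟨(extensionFamilyHom f g r s hrf hfs (Units.mk0 t ht)).moment_eq_zero_of_surjective
        (fun i => (hφ i).2) (R.twist (Units.mk0 t ht)).2.1,
        (R.twist (Units.mk0 t ht)).2.2.of_surjective _ (fun i => (hφ i).2)⟩
  let S : ℂ → StableRep v (FSum W' W'') := fun t =>
    ⟨(extensionFamily R'.1 R''.1 R.1 r s t).transport (sumEquiv hv),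
      FramedRep.moment_transport (hprop t).1 _, (hprop t).2.transport _⟩
  have hcont := FramedRep.continuous_iff.1 (continuous_extensionFamily R'.1 R''.1 R.1 r s)
  have he : ∀ i, Continuous (sumEquiv hv i) := fun i =>
    (sumEquiv hv i).toLinearMap.continuous_of_finiteDimensional
  refine ⟨fun t => Nak.mk (S t), Nak.continuous_mk.comp (continuous_induced_rng.2 ?_),
    fun t => ?_, ?_⟩
  · refine FramedRep.continuous_iff.2 ⟨fun i j d x => ?_, fun i w => ?_, fun i x => ?_⟩
    · have : (fun t => ((Subtype.val ∘ S) t).act d x) = fun t => sumEquiv hv j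
          ((extensionFamily R'.1 R''.1 R.1 r s t).act d ((sumEquiv hv i).symm x)) :=
        funext fun t => DoubleRep.act_transport _ (sumEquiv hv) d x
      exact this ▸ (he j).comp (hcont.1 i j d _)
    · exact (he i).comp (hcont.2.1 i w)
    · exact hcont.2.2 i _
  · rw [Nak.smul_mk]
    symm
    rw [Nak.mk_eq_mk_iff]
    exact ⟨((extensionFamily R'.1 R''.1 R.1 r s t).transportHom (sumEquiv hv)).comp
      (extensionFamilyHom f g r s hrf hfs t) _ (fun _ _ => rfl), fun i =>
      (FramedRep.transportHom_bijective (extensionFamily R'.1 R''.1 R.1 r s t) (sumEquiv hv) i).comp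
        (hbij t i)⟩
  · have h0 : S 0 = StableRep.sum hv R' R'' := Subtype.ext
      (congrArg (fun Q => FramedRep.transport Q (sumEquiv hv))
        (extensionFamily_zero R'.1 R''.1 R.1 r s))
    exact congrArg Nak.mk h0

variable [∀ i, T2Space (W' i)] [∀ i, T2Space (W'' i)]

/-- A representation `R`, on which the maps `B''` vanish on the subrepresentation generated by the
images of the maps `A'`, is an extension. -/
theorem exists_extension {v : I → ℕ} (R : StableRep v (FSum W' W''))
    (h : ∀ i, ∀ x ∈ (R.1.gen (fun i => LinearMap.inl ℂ (W' i) (W'' i))).carrier i,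
      (R.1.B i x).2 = 0) :
    ∃ (v' v'' : I → ℕ) (_ : v' + v'' = v) (R' : StableRep v' W') (R'' : StableRep v'' W'')
      (f : FramedHom R'.1 R.1 (fun i => LinearMap.inl ℂ (W' i) (W'' i)))
      (g : FramedHom R.1 R''.1 (fun i => LinearMap.snd ℂ (W' i) (W'' i))),
      (∀ i, Function.Injective (f.toFun i)) ∧ ∀ i x, g.toFun i (f.toFun i x) = 0 := by
  -- The subobject is generated by the images of `A'`; there `h` confines `B` to `W'`. On the
  -- quotient `A'` vanishes, so it is framed by `W''`.
  obtain ⟨v', R', f, hf, hr⟩ := exists_sub_model R.2.1 (fun i => LinearMap.inl ℂ (W' i) (W'' i))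
    (fun i => LinearMap.fst ℂ (W' i) (W'' i)) (fun i x hx => by
      ext
      · simp
      · simp [h i x hx])
  obtain ⟨v'', R'', g, hg, hk⟩ := exists_quotient_model R.2.1 R.2.2
    (R.1.gen (fun i => LinearMap.inl ℂ (W' i) (W'' i)))
    (fun i => LinearMap.snd ℂ (W' i) (W'' i)) (fun i => LinearMap.inr ℂ (W' i) (W'' i))
    (fun i w => by
      rw [← map_sub]
      convert R.1.A_mem_gen (fun i => LinearMap.inl ℂ (W' i) (W'' i)) i w.1 using 2
      ext <;> simp) h
  refine ⟨v', v'', dim_add_of_exact hf hg fun i => ?_, R', R'', f, g, hf, fun i x => ?_⟩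
  · rw [hr i]
    ext x
    exact (hk i x).symm
  · rw [hk, ← hr i]
    exact ⟨x, rfl⟩

/-- The degenerating family gives one direction. Conversely, the existence of a limit yields some
extension, which degenerates to its own direct sum; uniqueness of limits and of summands moves it to
the given representatives. -/
theorem limZero_sum_iff {v' v'' v : I → ℕ} (hv : v' + v'' = v) {R' : StableRep v' W'}
    {R'' : StableRep v'' W''} {R : StableRep v (FSum W' W'')} :
    LimZero (Nak.mk R) (Nak.sum hv (Nak.mk R') (Nak.mk R'')) ↔
      ∃ (f : FramedHom R'.1 R.1 (fun i => LinearMap.inl ℂ (W' i) (W'' i)))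
        (g : FramedHom R.1 R''.1 (fun i => LinearMap.snd ℂ (W' i) (W'' i))),
        (∀ i, Function.Injective (f.toFun i)) ∧ ∀ i x, g.toFun i (f.toFun i x) = 0 := by
  have hlim : ∀ {v' v'' : I → ℕ} (hv : v' + v'' = v) {R' : StableRep v' W'}
      {R'' : StableRep v'' W''}
      (f : FramedHom R'.1 R.1 (fun i => LinearMap.inl ℂ (W' i) (W'' i)))
      (g : FramedHom R.1 R''.1 (fun i => LinearMap.snd ℂ (W' i) (W'' i))),
      (∀ i, Function.Injective (f.toFun i)) → (∀ i x, g.toFun i (f.toFun i x) = 0) →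
      LimZero (Nak.mk R) (Nak.sum hv (Nak.mk R') (Nak.mk R'')) := by
    intro v' v'' hv R' R'' f g hf hgf
    obtain ⟨γ, hγ, h1, h0⟩ := exists_continuous_orbit hv f g hf hgf
    rw [LimZero, ← h0]
    simp only [← h1]
    exact (hγ.tendsto 0).comp tendsto_comap
  constructor
  · intro h
    obtain ⟨u', u'', hu, S', S'', f, g, hf, hgf⟩ := exists_extension R h.B_snd_eq_zero
    obtain ⟨⟨φ, hφ⟩, ⟨ψ, hψ⟩⟩ := (Nak.sum_eq_sum_iff hu hv).1
      (tendsto_nhds_unique (hlim hu f g hf hgf) h)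
    refine ⟨f.comp φ _ (fun _ _ => rfl), (ψ.symm hψ).comp g _ (fun _ _ => rfl),
      fun i => (hf i).comp (hφ i).1, fun i x => ?_⟩
    simp [hgf]
  · rintro ⟨f, g, hf, hgf⟩
    exact hlim hv f g hf hgf

theorem exists_sum_eq_of_limZero {v : I → ℕ} {x p : Nak v (FSum W' W'')} (h : LimZero x p) :
    ∃ (v' v'' : I → ℕ) (hv : v' + v'' = v) (R' : StableRep v' W') (R'' : StableRep v'' W''),
      p = Nak.sum hv (Nak.mk R') (Nak.mk R'') := by
  obtain ⟨R, rfl⟩ := x.exists_rep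
  obtain ⟨v', v'', hv, R', R'', f, g, hf, hgf⟩ := exists_extension R h.B_snd_eq_zero
  exact ⟨v', v'', hv, R', R'', tendsto_nhds_unique h ((limZero_sum_iff hv).2 ⟨f, g, hf, hgf⟩)⟩

/-- The points of the form `V' ⊕ V''` are the torus fixed points. -/
theorem bijective_fixedPair (v : I → ℕ) :
    Function.Bijective
      (fun m : (Σ d : {d : (I → ℕ) × (I → ℕ) // d.1 + d.2 = v}, Nak d.1.1 W' × Nak d.1.2 W'') =>
        fixedPair m.1.2 m.2.1 m.2.2) := by
  constructor
  · rintro ⟨⟨⟨u', u''⟩, hu⟩, m', m''⟩ ⟨⟨⟨v', v''⟩, hv⟩, n', n''⟩ h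
    obtain ⟨S', rfl⟩ := m'.exists_rep
    obtain ⟨S'', rfl⟩ := m''.exists_rep
    obtain ⟨R', rfl⟩ := n'.exists_rep
    obtain ⟨R'', rfl⟩ := n''.exists_rep
    obtain ⟨⟨φ', h'⟩, ⟨φ'', h''⟩⟩ := (Nak.sum_eq_sum_iff hu hv).1 (congrArg Subtype.val h)
    obtain rfl : v' = u' := dim_eq_of_bijective _ h'
    obtain rfl : v'' = u'' := dim_eq_of_bijective _ h''
    rw [Nak.mk_eq_mk_iff.2 ⟨φ', h'⟩, Nak.mk_eq_mk_iff.2 ⟨φ'', h''⟩]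
  · rintro ⟨x, hx⟩
    -- A fixed point is its own limit, hence of the form of every limit.
    have h : LimZero x x := by
      have : (fun t : ℂˣ => t • x) = fun _ => x := funext fun t => hx t
      rw [LimZero, this]
      exact tendsto_const_nhds
    obtain ⟨v', v'', hv, R', R'', h⟩ := exists_sum_eq_of_limZero h
    exact ⟨⟨⟨(v', v''), hv⟩, Nak.mk R', Nak.mk R''⟩, Subtype.ext h.symm⟩

end Degeneration

/-! ### Isomorphisms and factorizations of morphisms -/

section Isomorphisms

variable {I : Type*} [Quiver I] {V V₁ V₂ V₃ W W₁ W₂ W₃ : I → Type*}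
  [∀ i, AddCommGroup (V i)] [∀ i, Module ℂ (V i)]
  [∀ i, AddCommGroup (V₁ i)] [∀ i, Module ℂ (V₁ i)]
  [∀ i, AddCommGroup (V₂ i)] [∀ i, Module ℂ (V₂ i)]
  [∀ i, AddCommGroup (V₃ i)] [∀ i, Module ℂ (V₃ i)]
  [∀ i, AddCommGroup (W i)] [∀ i, Module ℂ (W i)]
  [∀ i, AddCommGroup (W₁ i)] [∀ i, Module ℂ (W₁ i)]
  [∀ i, AddCommGroup (W₂ i)] [∀ i, Module ℂ (W₂ i)]
  [∀ i, AddCommGroup (W₃ i)] [∀ i, Module ℂ (W₃ i)]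

/-- Composition of morphisms of double quiver representations. -/
def Hom.comp {R : DoubleRep V₁} {S : DoubleRep V₂} {T : DoubleRep V₃} (ψ : Hom S T) (φ : Hom R S) :
    Hom R T :=
  Hom.ofAct (fun i => ψ.toFun i ∘ₗ φ.toFun i) (fun i j d x => by simp [φ.comm, ψ.comm])

@[simp]
theorem Hom.comp_toFun {R : DoubleRep V₁} {S : DoubleRep V₂} {T : DoubleRep V₃} (ψ : Hom S T)
    (φ : Hom R S) (i : I) (x : V₁ i) : (ψ.comp φ).toFun i x = ψ.toFun i (φ.toFun i x) := rfl

/-- The inclusion of a subrepresentation. -/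
def SubRep.incl {R : DoubleRep V} (K : SubRep R) : Hom K.toRep R :=
  Hom.ofAct (fun i => (K.carrier i).subtype) (fun _ _ d x => K.coe_act_toRep d x)

@[simp]
theorem SubRep.incl_toFun {R : DoubleRep V} (K : SubRep R) (i : I) (x : K.carrier i) :
    K.incl.toFun i x = x := rfl

theorem DoubleRep.Isomorphic.symm {R : DoubleRep V₁} {S : DoubleRep V₂} (h : R.Isomorphic S) :
    S.Isomorphic R := by
  obtain ⟨φ, hφ⟩ := h
  refine ⟨Hom.ofAct (fun i => (LinearEquiv.ofBijective (φ.toFun i) (hφ i)).symm.toLinearMap)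
    (fun i j d x => ?_), fun i => (LinearEquiv.ofBijective (φ.toFun i) (hφ i)).symm.bijective⟩
  apply (hφ j).1
  refine ((LinearEquiv.ofBijective (φ.toFun j) (hφ j)).apply_symm_apply _).trans ?_
  rw [φ.comm]
  congr 1
  exact ((LinearEquiv.ofBijective (φ.toFun i) (hφ i)).apply_symm_apply _).symm

theorem DoubleRep.Isomorphic.trans {R : DoubleRep V₁} {S : DoubleRep V₂} {T : DoubleRep V₃}
    (h : R.Isomorphic S) (h' : S.Isomorphic T) : R.Isomorphic T := by
  obtain ⟨φ, hφ⟩ := h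
  obtain ⟨ψ, hψ⟩ := h'
  exact ⟨ψ.comp φ, fun i => (hψ i).comp (hφ i)⟩

theorem Hom.isomorphic_of_injective {R : DoubleRep V₁} {S : DoubleRep V₂} (φ : Hom R S)
    (h : ∀ i, Function.Injective (φ.toFun i)) (K : SubRep S)
    (hK : ∀ i, LinearMap.range (φ.toFun i) = K.carrier i) : R.Isomorphic K.toRep := by
  refine ⟨Hom.ofAct (fun i => (φ.toFun i).codRestrict (K.carrier i) fun x => ?_)
    (fun i j d x => Subtype.ext ?_), fun i => ⟨fun x y hxy => h i (congrArg Subtype.val hxy), ?_⟩⟩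
  · rw [← hK]
    exact ⟨x, rfl⟩
  · rw [K.coe_act_toRep]
    exact φ.comm d x
  · rintro ⟨y, hy⟩
    rw [← hK] at hy
    obtain ⟨x, rfl⟩ := hy
    exact ⟨x, rfl⟩

/-- Morphisms out of a stable representation are determined by their values on the framing. -/
theorem FramedRep.IsStable.hom_eq {R : FramedRep V₁ W} {S : DoubleRep V₂} (hR : R.IsStable)
    (φ ψ : Hom R.toDoubleRep S) (h : ∀ i w, φ.toFun i (R.A i w) = ψ.toFun i (R.A i w)) (i : I)
    (x : V₁ i) : φ.toFun i x = ψ.toFun i x := by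
  have := hR (SubRep.ofAct (fun i => LinearMap.eqLocus (φ.toFun i) (ψ.toFun i))
    (fun i j d x hx => by
      rw [LinearMap.mem_eqLocus] at hx ⊢
      rw [φ.comm, ψ.comm, hx])) h i
  have hx : x ∈ LinearMap.eqLocus (φ.toFun i) (ψ.toFun i) := by
    rw [show LinearMap.eqLocus (φ.toFun i) (ψ.toFun i) = ⊤ from this]; trivial
  exact hx

/-- A scalar multiple of a morphism. -/
def Hom.smul {R : DoubleRep V₁} {S : DoubleRep V₂} (c : ℂ) (φ : Hom R S) : Hom R S :=
  Hom.ofAct (fun i => c • φ.toFun i) (fun i j d x => by simp [φ.comm])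

@[simp]
theorem Hom.smul_toFun {R : DoubleRep V₁} {S : DoubleRep V₂} (c : ℂ) (φ : Hom R S) (i : I)
    (x : V₁ i) : (φ.smul c).toFun i x = c • φ.toFun i x := rfl

/-- Factorization of a framed morphism through a surjective one. -/
theorem FramedHom.exists_factor {R : FramedRep V₁ W₁} {S : FramedRep V₂ W₂} {T : FramedRep V₃ W₃}
    {α : ∀ i, W₁ i →ₗ[ℂ] W₂ i} {β : ∀ i, W₁ i →ₗ[ℂ] W₃ i} (φ : FramedHom R S α)
    (hφ : φ.toHom.Surjective) (hα : ∀ i, Function.Surjective (α i)) (ψ : FramedHom R T β)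
    (γ : ∀ i, W₂ i →ₗ[ℂ] W₃ i) (hγ : ∀ i w, γ i (α i w) = β i w)
    (h : ∀ i x, φ.toFun i x = 0 → ψ.toFun i x = 0) :
    ∃ χ : FramedHom S T γ, ∀ i x, χ.toFun i (φ.toFun i x) = ψ.toFun i x := by
  have hs : ∀ i, ∃ s : V₂ i →ₗ[ℂ] V₁ i, ∀ y, φ.toFun i (s y) = y := fun i => by
    obtain ⟨s, hs⟩ := (φ.toFun i).exists_rightInverse_of_surjective
      (LinearMap.range_eq_top.2 (hφ i))
    exact ⟨s, fun y => LinearMap.congr_fun hs y⟩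
  choose s hs using hs
  have key : ∀ i x, ψ.toFun i (s i (φ.toFun i x)) = ψ.toFun i x := fun i x => by
    rw [← sub_eq_zero, ← map_sub]
    exact h i _ (by rw [map_sub, hs, sub_self])
  refine ⟨{ toHom := Hom.ofAct (fun i => ψ.toFun i ∘ₗ s i) fun i j d y => ?_,
            comm_A := fun i w => ?_, comm_B := fun i y => ?_ }, key⟩
  · obtain ⟨x, rfl⟩ := hφ i y
    rw [← φ.toHom.comm]
    change ψ.toFun j (s j (φ.toFun j _)) = T.act d (ψ.toFun i (s i (φ.toFun i _)))
    rw [key, key, ψ.toHom.comm]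
  · obtain ⟨w, rfl⟩ := hα i w
    rw [← φ.comm_A]
    change ψ.toFun i (s i (φ.toFun i _)) = _
    rw [key, ψ.comm_A, hγ]
  · obtain ⟨x, rfl⟩ := hφ i y
    change T.B i (ψ.toFun i (s i (φ.toFun i _))) = _
    rw [key, ψ.comm_B, φ.comm_B, hγ]

end Isomorphisms

/-! ### Exchange of the two framings and limits for `t → ∞` -/

section Swap

variable {I : Type*} [Quiver I] {V W' W'' : I → Type*}
  [∀ i, AddCommGroup (V i)] [∀ i, Module ℂ (V i)]
  [∀ i, AddCommGroup (W' i)] [∀ i, Module ℂ (W' i)]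
  [∀ i, AddCommGroup (W'' i)] [∀ i, Module ℂ (W'' i)]

/-- Exchange of the two summands of the framing. -/
def FramedRep.swap (R : FramedRep V (FSum W' W'')) : FramedRep V (FSum W'' W') where
  toDoubleRep := R.toDoubleRep
  A i := R.A i ∘ₗ (LinearEquiv.prodComm ℂ (W'' i) (W' i)).toLinearMap
  B i := (LinearEquiv.prodComm ℂ (W' i) (W'' i)).toLinearMap ∘ₗ R.B i

/-- The identity as a morphism to the representation with swapped framing. -/
def FramedRep.toSwap (R : FramedRep V (FSum W' W'')) :
    FramedHom R R.swap (fun i => (LinearEquiv.prodComm ℂ (W' i) (W'' i)).toLinearMap) where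
  toFun _ := LinearMap.id
  comm_X _ _ := rfl
  comm_Y _ _ := rfl
  comm_A _ _ := rfl
  comm_B _ _ := rfl

/-- The identity as a morphism from the representation with swapped framing. -/
def FramedRep.ofSwap (R : FramedRep V (FSum W' W'')) :
    FramedHom R.swap R (fun i => (LinearEquiv.prodComm ℂ (W'' i) (W' i)).toLinearMap) where
  toFun _ := LinearMap.id
  comm_X _ _ := rfl
  comm_Y _ _ := rfl
  comm_A _ _ := rfl
  comm_B _ _ := rfl

variable [Fintype I] [∀ i j : I, Fintype (i ⟶ j)]

/-- Exchange of the two summands of the framing. -/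
def StableRep.swap {v : I → ℕ} (R : StableRep v (FSum W' W'')) : StableRep v (FSum W'' W') :=
  ⟨R.1.swap, R.1.toSwap.moment_eq_zero_of_surjective (fun _ => Function.surjective_id) R.2.1,
    R.2.2.of_surjective R.1.toSwap (fun _ => Function.surjective_id)⟩

/-- Exchange of the two summands of the framing. -/
def Nak.swap {v : I → ℕ} : Nak v (FSum W' W'') → Nak v (FSum W'' W') :=
  Quotient.map (sa := gaugeSetoid v (FSum W' W'')) (sb := gaugeSetoid v (FSum W'' W'))
    StableRep.swap (by
      rintro R S ⟨g, hg⟩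
      refine ⟨g, ?_⟩
      change R.1.swap.transport g = S.1.swap
      rw [← hg]
      rfl)

theorem Nak.swap_mk {v : I → ℕ} (R : StableRep v (FSum W' W'')) :
    Nak.swap (Nak.mk R) = Nak.mk R.swap := rfl

/-- After the exchange the torus element is `diag(1, t)`, which is `t` times `diag(t⁻¹, 1)`; the
scalar on the framing is absorbed by the gauge transformation `t`. -/
theorem Nak.swap_smul {v : I → ℕ} (t : ℂˣ) (x : Nak v (FSum W' W'')) :
    (t • x).swap = t⁻¹ • x.swap := by
  obtain ⟨R, rfl⟩ := x.exists_rep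
  rw [Nak.smul_mk, Nak.swap_mk, Nak.swap_mk, Nak.smul_mk, Nak.mk_eq_mk_iff]
  refine ⟨{ toHom := Hom.ofAct (fun i => (t : ℂ) • LinearMap.id) fun i j d x => ?_,
            comm_A := fun i w => ?_, comm_B := fun i x => ?_ },
    fun i => (LinearEquiv.smulOfUnit t).bijective⟩
  · change (t : ℂ) • (R.twist t).swap.1.act d x = (R.swap.twist t⁻¹).1.act d ((t : ℂ) • x)
    rw [map_smul]
    cases d <;> rfl
  · change (t : ℂ) • R.1.A i ((t⁻¹ : ℂˣ) • w.2, w.1) = R.1.A i (w.2, (t⁻¹⁻¹ : ℂˣ) • w.1)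
    rw [← map_smul]
    congr 1
    ext
    · simp [Units.smul_def]
    · simp [Units.smul_def]
  · change ((t⁻¹ : ℂˣ) • (R.1.B i ((t : ℂ) • x)).2, (R.1.B i ((t : ℂ) • x)).1) =
      ((R.1.B i x).2, (t : ℂˣ) • (R.1.B i x).1)
    rw [map_smul]
    ext
    · simp [Units.smul_def]
    · simp [Units.smul_def]

theorem Nak.swap_sum {v' v'' v : I → ℕ} (h : v' + v'' = v) (h' : v'' + v' = v)
    (R' : StableRep v' W') (R'' : StableRep v'' W'') :
    (Nak.sum h (Nak.mk R') (Nak.mk R'')).swap = Nak.sum h' (Nak.mk R'') (Nak.mk R') := by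
  rw [Nak.sum_mk_mk, Nak.swap_mk, Nak.mk_eq_sum_iff]
  let τ : FramedHom (R''.1.directSum R'.1) (R'.1.directSum R''.1)
      (fun i => (LinearEquiv.prodComm ℂ (W'' i) (W' i)).toLinearMap) :=
    { toHom := Hom.ofAct (fun i => (LinearEquiv.prodComm ℂ _ _).toLinearMap) (fun i j d x => by
        simp [FramedRep.act_directSum])
      comm_A := fun i w => rfl
      comm_B := fun i x => rfl }
  exact ⟨(StableRep.sum h R' R'').1.toSwap.comp
    (((R'.1.directSum R''.1).transportHom (sumEquiv h)).comp τ
      (fun i => (LinearEquiv.prodComm ℂ (W'' i) (W' i)).toLinearMap) (fun _ _ => rfl)) _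
    (fun _ _ => rfl),
    fun i => (sumEquiv h i).bijective.comp (LinearEquiv.prodComm ℂ _ _).bijective⟩

theorem Nak.continuous_swap {v : I → ℕ} [∀ i, TopologicalSpace (W' i)]
    [∀ i, TopologicalSpace (W'' i)] :
    Continuous (Nak.swap : Nak v (FSum W' W'') → Nak v (FSum W'' W')) := by
  refine continuous_quot_lift _ (Nak.continuous_mk.comp (continuous_induced_rng.2 ?_))
  have h0 := FramedRep.continuous_iff.1 (continuous_subtype_val :
    Continuous (Subtype.val : StableRep v (FSum W' W'') → FramedRep (Cn v) (FSum W' W'')))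
  exact FramedRep.continuous_iff.2 ⟨fun i j d x => h0.1 i j d x, fun i w => h0.2.1 i w.swap,
    fun i x => (h0.2.2 i x).snd.prodMk (h0.2.2 i x).fst⟩

variable
  [∀ i, TopologicalSpace (W' i)] [∀ i, IsTopologicalAddGroup (W' i)]
  [∀ i, ContinuousSMul ℂ (W' i)] [∀ i, T2Space (W' i)]
  [∀ i, TopologicalSpace (W'' i)] [∀ i, IsTopologicalAddGroup (W'' i)]
  [∀ i, ContinuousSMul ℂ (W'' i)] [∀ i, T2Space (W'' i)]

/-- `lim_{t → ∞} t · x = p`. -/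
def LimInfty {M : Type*} [TopologicalSpace M] [MulAction ℂˣ M] (x p : M) : Prop :=
  Tendsto (fun t : ℂˣ => t⁻¹ • x) (comap ((↑) : ℂˣ → ℂ) (𝓝 0)) (𝓝 p)

/-- At infinity the `W''`-framed representation becomes the subobject, and the family at `t = 0` is
applied after exchanging the framings. -/
theorem exists_continuous_orbit_inv {v' v'' v : I → ℕ} (hv : v' + v'' = v) {R' : StableRep v' W'}
    {R'' : StableRep v'' W''} {R : StableRep v (FSum W' W'')}
    (f : FramedHom R''.1 R.1 (fun i => LinearMap.inr ℂ (W' i) (W'' i)))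
    (g : FramedHom R.1 R'.1 (fun i => LinearMap.fst ℂ (W' i) (W'' i)))
    (hf : ∀ i, Function.Injective (f.toFun i)) (hgf : ∀ i x, g.toFun i (f.toFun i x) = 0) :
    ∃ γ : ℂ → Nak v (FSum W' W''), Continuous γ ∧ (∀ t : ℂˣ, γ t = t⁻¹ • Nak.mk R) ∧
      γ 0 = Nak.sum hv (Nak.mk R') (Nak.mk R'') := by
  have hv' : v'' + v' = v := by rw [add_comm, hv]
  obtain ⟨γ, hγ, h1, h0⟩ := exists_continuous_orbit hv' (R := R.swap)
    (R.1.toSwap.comp f (fun i => LinearMap.inl ℂ (W'' i) (W' i)) (fun _ _ => rfl))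
    (g.comp R.1.ofSwap (fun i => LinearMap.snd ℂ (W'' i) (W' i)) (fun _ _ => rfl)) hf hgf
  refine ⟨fun t => (γ t).swap, Nak.continuous_swap.comp hγ, fun t => ?_, ?_⟩
  · simp only [h1, Nak.swap_smul]
    rfl
  · simp only [h0]
    exact Nak.swap_sum hv' hv R'' R'

theorem limInfty_sum_iff {v' v'' v : I → ℕ} (hv : v' + v'' = v) {R' : StableRep v' W'}
    {R'' : StableRep v'' W''} {R : StableRep v (FSum W' W'')} :
    LimInfty (Nak.mk R) (Nak.sum hv (Nak.mk R') (Nak.mk R'')) ↔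
      ∃ (f : FramedHom R''.1 R.1 (fun i => LinearMap.inr ℂ (W' i) (W'' i)))
        (g : FramedHom R.1 R'.1 (fun i => LinearMap.fst ℂ (W' i) (W'' i))),
        (∀ i, Function.Injective (f.toFun i)) ∧ ∀ i x, g.toFun i (f.toFun i x) = 0 := by
  have hv' : v'' + v' = v := by rw [add_comm, hv]
  constructor
  · intro h
    have h' : LimZero (Nak.mk R.swap) (Nak.sum hv' (Nak.mk R'') (Nak.mk R')) := by
      rw [← Nak.swap_sum hv hv' R' R'', ← Nak.swap_mk]
      refine ((Nak.continuous_swap.tendsto _).comp h).congr fun t => ?_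
      rw [Function.comp_apply, Nak.swap_smul, inv_inv]
    obtain ⟨f, g, hf, hgf⟩ := (limZero_sum_iff hv').1 h'
    exact ⟨R.1.ofSwap.comp f _ (fun _ _ => rfl), g.comp R.1.toSwap _ (fun _ _ => rfl), hf, hgf⟩
  · rintro ⟨f, g, hf, hgf⟩
    obtain ⟨γ, hγ, h1, h0⟩ := exists_continuous_orbit_inv hv f g hf hgf
    rw [LimInfty, ← h0]
    simp only [← h1]
    exact (hγ.tendsto 0).comp tendsto_comap

end Swap

/-! ### Closed flow lines and pairs of limits -/

section FlowLines

variable {M : Type*} [TopologicalSpace M] [MulAction ℂˣ M]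

/-- Injectivity on the sphere separates the endpoints; continuity at infinity gives the second limit
because inversion takes small units to large ones. -/
theorem ClosedFlowLine.exists_limits {q p : M} (h : ClosedFlowLine q p) :
    p ≠ q ∧ ∃ x : M, LimZero x p ∧ LimInfty x q := by
  obtain ⟨x, φ, hφ, hx, rfl, rfl⟩ := h
  refine ⟨fun h => OnePoint.coe_ne_infty _ (hφ.injective h), x, ?_, ?_⟩
  · rw [LimZero]
    simp only [← hx]
    exact ((hφ.continuous.comp OnePoint.continuous_coe).tendsto 0).comp tendsto_comap
  · rw [LimInfty]
    simp only [← hx]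
    have h1 : Tendsto (fun z : ℂ => φ z) (cocompact ℂ) (𝓝 (φ OnePoint.infty)) := by
      rw [← Filter.coclosedCompact_eq_cocompact]
      exact ((OnePoint.continuous_iff φ).1 hφ.continuous).1
    refine h1.comp ?_
    rw [← Metric.cobounded_eq_cocompact]
    have h2 : Tendsto (fun t : ℂˣ => (t : ℂ)) (comap ((↑) : ℂˣ → ℂ) (𝓝 0)) (𝓝[≠] 0) :=
      tendsto_nhdsWithin_iff.2 ⟨tendsto_comap, Eventually.of_forall fun t => t.ne_zero⟩
    exact (tendsto_inv₀_nhdsNE_zero.comp h2).congr fun t => (Units.val_inv_eq_inv_val t).symm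

/-- The charts `γ` at 0 and `δ` at infinity glue to a continuous map on a compact space. It is
injective because the stabilizer is trivial and the endpoints are distinct fixed points, and a
continuous injection into a Hausdorff space is then a closed embedding. -/
theorem closedFlowLine_of_orbit [T2Space M] {q p x : M} (hp : ∀ t : ℂˣ, t • p = p)
    (hq : ∀ t : ℂˣ, t • q = q) (hpq : p ≠ q) (hx : ∀ t : ℂˣ, t • x = x → t = 1)
    {γ δ : ℂ → M} (hγ : Continuous γ) (hδ : Continuous δ) (hγ' : ∀ t : ℂˣ, γ t = t • x)
    (hδ' : ∀ t : ℂˣ, δ t = t⁻¹ • x) (h0 : γ 0 = p) (h0' : δ 0 = q) : ClosedFlowLine q p := by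
  have hne : ∀ (t : ℂˣ) {y : M}, (∀ s : ℂˣ, s • y = y) → t • x ≠ y := by
    intro t y hy h
    have hxy : x = y := by rw [← hy t] at h; exact smul_left_cancel t h
    -- An orbit through a fixed point consists of it alone, so its stabilizer would contain 2.
    have h2 := hx (Units.mk0 2 two_ne_zero) (by rw [hxy, hy])
    have := congrArg Units.val h2
    norm_num at this
  have hγ0 : ∀ z : ℂ, z ≠ 0 → ∃ t : ℂˣ, (t : ℂ) = z := fun z hz => ⟨Units.mk0 z hz, rfl⟩
  let φ : OnePoint ℂ → M := fun z => OnePoint.rec q γ z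
  have hcont : Continuous φ := by
    rw [OnePoint.continuous_iff, Filter.coclosedCompact_eq_cocompact]
    refine ⟨?_, hγ⟩
    change Tendsto γ _ (𝓝 q)
    rw [← h0', ← Metric.cobounded_eq_cocompact]
    refine ((hδ.tendsto 0).comp tendsto_inv₀_cobounded).congr' ?_
    filter_upwards [Bornology.eventually_ne_cobounded (0 : ℂ)] with z hz
    obtain ⟨t, rfl⟩ := hγ0 z hz
    rw [Function.comp_apply, hγ', ← Units.val_inv_eq_inv_val, hδ', inv_inv]
  have hinj : Function.Injective φ := by
    have key : ∀ z : ℂ, γ z ≠ q := by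
      intro z
      rcases eq_or_ne z 0 with rfl | hz
      · rwa [h0]
      · obtain ⟨t, rfl⟩ := hγ0 z hz
        rw [hγ']
        exact hne t hq
    intro a b hab
    induction a using OnePoint.rec with
    | infty =>
      induction b using OnePoint.rec with
      | infty => rfl
      | coe b => exact absurd hab.symm (key b)
    | coe a =>
      induction b using OnePoint.rec with
      | infty => exact absurd hab (key a)
      | coe b =>
        change γ a = γ b at hab
        congr 1
        rcases eq_or_ne a 0 with rfl | ha
        · rcases eq_or_ne b 0 with rfl | hb
          · rfl
          · obtain ⟨t, rfl⟩ := hγ0 b hb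
            rw [h0, hγ'] at hab
            exact absurd hab.symm (hne t hp)
        · obtain ⟨s, rfl⟩ := hγ0 a ha
          rcases eq_or_ne b 0 with rfl | hb
          · rw [h0, hγ'] at hab
            exact absurd hab (hne s hp)
          · obtain ⟨t, rfl⟩ := hγ0 b hb
            rw [hγ', hγ', ← inv_smul_eq_iff, smul_smul] at hab
            rw [inv_mul_eq_one.1 (hx _ hab)]
  exact ⟨x, φ, hcont.isClosedEmbedding hinj, hγ', h0, rfl⟩

end FlowLines

/-! ### Amalgamated sums and the description of flow lines by kernels -/

section Gluing

variable {I : Type*} [Quiver I] [Fintype I] [∀ i j : I, Fintype (i ⟶ j)] {W W' W'' : I → Type*}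
  [∀ i, AddCommGroup (W i)] [∀ i, Module ℂ (W i)]
  [∀ i, AddCommGroup (W' i)] [∀ i, Module ℂ (W' i)]
  [∀ i, AddCommGroup (W'' i)] [∀ i, Module ℂ (W'' i)]

/-- The amalgamated sum of two stable representations along isomorphic kernels of framed
surjections. -/
theorem exists_amalgam {u' u'' v' v'' v : I → ℕ} (hv : v' + v'' = v)
    {S' : StableRep u' W'} {S'' : StableRep u'' W''} {R' : StableRep v' W'}
    {R'' : StableRep v'' W''} (π' : FramedHom R'.1 S'.1 (fun _ => LinearMap.id))
    (π'' : FramedHom S''.1 R''.1 (fun _ => LinearMap.id))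
    (h : π'.toHom.ker.toRep.Isomorphic π''.toHom.ker.toRep) :
    ∃ (R : StableRep v (FSum W' W''))
      (f₀ : FramedHom R'.1 R.1 (fun i => LinearMap.inl ℂ (W' i) (W'' i)))
      (g₀ : FramedHom R.1 R''.1 (fun i => LinearMap.snd ℂ (W' i) (W'' i)))
      (f₁ : FramedHom S''.1 R.1 (fun i => LinearMap.inr ℂ (W' i) (W'' i)))
      (g₁ : FramedHom R.1 S'.1 (fun i => LinearMap.fst ℂ (W' i) (W'' i))),
      (∀ i, Function.Injective (f₀.toFun i)) ∧ (∀ i x, g₀.toFun i (f₀.toFun i x) = 0) ∧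
      (∀ i, Function.Injective (f₁.toFun i)) ∧ (∀ i x, g₁.toFun i (f₁.toFun i x) = 0) ∧
      (∀ i x, π'.toFun i x = 0 → ∃ y, f₀.toFun i x = f₁.toFun i y) ∧
      ∀ i x, g₁.toFun i (f₀.toFun i x) = π'.toFun i x := by
  obtain ⟨θ, hθ⟩ := h
  let D := R'.1.directSum S''.1
  -- The amalgam is the quotient of `R' ⊕ S''` by the antidiagonal copy of the common kernel.
  let κ : Hom π'.toHom.ker.toRep D.toDoubleRep := Hom.ofAct
    (fun i => (π'.toHom.ker.incl.toFun i).prod (-(π''.toHom.ker.incl.toFun i ∘ₗ θ.toFun i)))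
    (fun i j d x => by
      change (_, _) = (R'.1.directSum S''.1).act d _
      rw [FramedRep.act_directSum]
      ext1
      · exact π'.toHom.ker.incl.comm d x
      · change -(π''.toHom.ker.incl.toFun j (θ.toFun j _)) = S''.1.act d (-_)
        rw [θ.comm, π''.toHom.ker.incl.comm, map_neg]
        rfl)
  have hκ : ∀ i k, κ.toFun i k = ((k : Cn v' i), -(θ.toFun i k : Cn u'' i)) := fun i k => rfl
  -- `B` vanishes on the kernels because the surjections are the identity on framings; this is why
  -- `B` descends to the amalgam.
  have hB' : ∀ i (k : π'.toHom.ker.carrier i), R'.1.B i (k : Cn v' i) = 0 := fun i k => by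
    have := π'.comm_B i k
    rw [show π'.toFun i (k : Cn v' i) = 0 from k.2, map_zero] at this
    exact this.symm
  have hB'' : ∀ i (k : π''.toHom.ker.carrier i), S''.1.B i (k : Cn u'' i) = 0 := fun i k => by
    have := π''.comm_B i k
    rw [show π''.toFun i (k : Cn u'' i) = 0 from k.2, map_zero] at this
    exact this.symm
  obtain ⟨u, R, φ, hφ, hker⟩ := exists_quotient_model
    (FramedRep.moment_directSum R'.2.1 S''.2.1) (R'.2.2.directSum S''.2.2) κ.range
    (fun _ => LinearMap.id) (fun _ => LinearMap.id) (fun i w => by simp) (by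
      rintro i _ ⟨k, rfl⟩
      rw [hκ]
      change (R'.1.B i (k : Cn v' i), S''.1.B i (-(θ.toFun i k : Cn u'' i))) = 0
      rw [map_neg, hB', hB'', neg_zero]
      rfl)
  obtain ⟨g₀, hg₀⟩ := φ.exists_factor hφ (fun _ => Function.surjective_id)
    (π''.comp (R'.1.sndHom S''.1) (fun i => LinearMap.snd ℂ (W' i) (W'' i)) (fun _ _ => rfl))
    (fun i => LinearMap.snd ℂ (W' i) (W'' i)) (fun _ _ => rfl) (by
      intro i x hx
      obtain ⟨k, rfl⟩ := (hker i x).1 hx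
      change π''.toFun i (-(θ.toFun i k : Cn u'' i)) = 0
      rw [map_neg, show π''.toFun i (θ.toFun i k : Cn u'' i) = 0 from (θ.toFun i k).2, neg_zero])
  obtain ⟨g₁, hg₁⟩ := φ.exists_factor hφ (fun _ => Function.surjective_id)
    (π'.comp (R'.1.fstHom S''.1) (fun i => LinearMap.fst ℂ (W' i) (W'' i)) (fun _ _ => rfl))
    (fun i => LinearMap.fst ℂ (W' i) (W'' i)) (fun _ _ => rfl) (by
      intro i x hx
      obtain ⟨k, rfl⟩ := (hker i x).1 hx
      exact k.2)
  let f₀ : FramedHom R'.1 R.1 (fun i => LinearMap.inl ℂ (W' i) (W'' i)) :=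
    φ.comp (R'.1.inlHom S''.1) _ (fun _ _ => rfl)
  let f₁ : FramedHom S''.1 R.1 (fun i => LinearMap.inr ℂ (W' i) (W'' i)) :=
    φ.comp (R'.1.inrHom S''.1) _ (fun _ _ => rfl)
  have hf₀ : ∀ i, Function.Injective (f₀.toFun i) := by
    intro i
    rw [injective_iff_map_eq_zero]
    intro x hx
    obtain ⟨k, hk⟩ := (hker i (x, 0)).1 hx
    rw [hκ] at hk
    have h2 : (θ.toFun i k : Cn u'' i) = 0 := neg_eq_zero.1 (congrArg Prod.snd hk)
    have h3 : k = 0 := (map_eq_zero_iff _ (hθ i).1).1 (Subtype.ext h2)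
    have h4 : (k : Cn v' i) = x := congrArg Prod.fst hk
    rw [← h4, h3]
    rfl
  have hf₁ : ∀ i, Function.Injective (f₁.toFun i) := by
    intro i
    rw [injective_iff_map_eq_zero]
    intro y hy
    obtain ⟨k, hk⟩ := (hker i (0, y)).1 hy
    rw [hκ] at hk
    have h3 : k = 0 := Subtype.ext (congrArg Prod.fst hk)
    have h4 : -(θ.toFun i k : Cn u'' i) = y := congrArg Prod.snd hk
    rw [← h4, h3, map_zero]
    exact neg_zero
  have hglue : ∀ i (k : π'.toHom.ker.carrier i),
      f₀.toFun i (k : Cn v' i) = f₁.toFun i (θ.toFun i k : Cn u'' i) := by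
    intro i k
    change φ.toFun i ((k : Cn v' i), (0 : Cn u'' i)) = φ.toFun i (0, (θ.toFun i k : Cn u'' i))
    rw [← sub_eq_zero, ← map_sub]
    refine (hker i _).2 ⟨k, ?_⟩
    rw [hκ]
    ext <;> simp
  have hgf₀ : ∀ i x, g₀.toFun i (f₀.toFun i x) = 0 := fun i x =>
    (hg₀ i _).trans (map_zero (π''.toFun i))
  have hg₀s : g₀.toHom.Surjective := g₀.surjective R''.2.2 fun i => LinearMap.snd_surjective
  -- The dimension is that of an extension of `R''` by `R'`: the class of a pair with second entry
  -- in the kernel of `π''` can be moved entirely into `R'` by the gluing.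
  obtain rfl : u = v := by
    rw [← hv]
    refine (dim_add_of_exact hf₀ hg₀s fun i => ?_).symm
    ext z
    constructor
    · rintro ⟨x, rfl⟩
      exact hgf₀ i x
    · intro hz
      obtain ⟨⟨x, y⟩, rfl⟩ := hφ i z
      have hy : π''.toFun i y = 0 := (hg₀ i (x, y)).symm.trans hz
      obtain ⟨k, hk⟩ := (hθ i).2 ⟨y, hy⟩
      refine ⟨x + k, ?_⟩
      rw [map_add, hglue, hk]
      change φ.toFun i (x, 0) + φ.toFun i (0, y) = _
      rw [← map_add]
      simp
  exact ⟨R, f₀, g₀, f₁, g₁, hf₀, hgf₀, hf₁,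
    fun i x => (hg₁ i _).trans (map_zero (π'.toFun i)),
    fun i x hx => ⟨_, hglue i ⟨x, hx⟩⟩, fun i x => hg₁ i _⟩

variable
  [∀ i, TopologicalSpace (W' i)] [∀ i, IsTopologicalAddGroup (W' i)]
  [∀ i, ContinuousSMul ℂ (W' i)] [∀ i, T2Space (W' i)]
  [∀ i, TopologicalSpace (W'' i)] [∀ i, IsTopologicalAddGroup (W'' i)]
  [∀ i, ContinuousSMul ℂ (W'' i)] [∀ i, T2Space (W'' i)]

/-- Closed flow lines between fixed points correspond to pairs of framed surjections with
isomorphic non-zero kernels. -/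
theorem closedFlowLine_iff {u' u'' v' v'' v : I → ℕ} (hu : u' + u'' = v) (hv : v' + v'' = v)
    (S' : StableRep u' W') (S'' : StableRep u'' W'') (R' : StableRep v' W')
    (R'' : StableRep v'' W'') :
    ClosedFlowLine (Nak.sum hu (Nak.mk S') (Nak.mk S'')) (Nak.sum hv (Nak.mk R') (Nak.mk R'')) ↔
      ∃ (π' : FramedHom R'.1 S'.1 (fun _ => LinearMap.id))
        (π'' : FramedHom S''.1 R''.1 (fun _ => LinearMap.id)),
        π'.toHom.Surjective ∧ π''.toHom.Surjective ∧
        π'.toHom.ker.toRep.Isomorphic π''.toHom.ker.toRep ∧ π'.toHom.ker ≠ ⊥ := by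
  constructor
  · intro h
    obtain ⟨hne, x, h0, h1⟩ := h.exists_limits
    obtain ⟨R, rfl⟩ := x.exists_rep
    obtain ⟨f₀, g₀, hf₀, hgf₀⟩ := (limZero_sum_iff hv).1 h0
    obtain ⟨f₁, g₁, hf₁, hgf₁⟩ := (limInfty_sum_iff hu).1 h1
    have hg₀ : g₀.toHom.Surjective := g₀.surjective R''.2.2 fun i => LinearMap.snd_surjective
    have hg₁ : g₁.toHom.Surjective := g₁.surjective S'.2.2 fun i => LinearMap.fst_surjective
    have hex₀ := range_eq_ker_of_dim hv hf₀ hg₀ hgf₀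
    have hex₁ := range_eq_ker_of_dim (by rw [add_comm, hu]) hf₁ hg₁ hgf₁
    -- The subobject at one end maps to the quotient at the other. Both composites have as kernel
    -- the intersection of the two subobjects.
    let π' : FramedHom R'.1 S'.1 (fun _ => LinearMap.id) := g₁.comp f₀ _ (fun _ _ => rfl)
    let π'' : FramedHom S''.1 R''.1 (fun _ => LinearMap.id) := g₀.comp f₁ _ (fun _ _ => rfl)
    have hπ' : π'.toHom.Surjective := π'.surjective S'.2.2 fun _ => Function.surjective_id
    have hπ'' : π''.toHom.Surjective := π''.surjective R''.2.2 fun _ => Function.surjective_id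
    let N : SubRep R.1.toDoubleRep :=
      SubRep.ofAct (fun i => f₀.toHom.range.carrier i ⊓ f₁.toHom.range.carrier i)
        (fun i j d x hx => ⟨f₀.toHom.range.act_mem d hx.1, f₁.toHom.range.act_mem d hx.2⟩)
    have hN' : π'.toHom.ker.toRep.Isomorphic N.toRep :=
      (f₀.toHom.comp π'.toHom.ker.incl).isomorphic_of_injective
        (fun i => (hf₀ i).comp Subtype.val_injective) N fun i => by
          ext y
          constructor
          · rintro ⟨x, rfl⟩
            refine ⟨⟨x, rfl⟩, ?_⟩
            change _ ∈ LinearMap.range (f₁.toFun i)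
            rw [hex₁]
            exact x.2
          · rintro ⟨⟨x, rfl⟩, hx⟩
            change _ ∈ LinearMap.range (f₁.toFun i) at hx
            rw [hex₁] at hx
            exact ⟨⟨x, hx⟩, rfl⟩
    have hN'' : π''.toHom.ker.toRep.Isomorphic N.toRep :=
      (f₁.toHom.comp π''.toHom.ker.incl).isomorphic_of_injective
        (fun i => (hf₁ i).comp Subtype.val_injective) N fun i => by
          ext y
          constructor
          · rintro ⟨x, rfl⟩
            refine ⟨?_, ⟨x, rfl⟩⟩
            change _ ∈ LinearMap.range (f₀.toFun i)
            rw [hex₀]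
            exact x.2
          · rintro ⟨hx, ⟨x, rfl⟩⟩
            change _ ∈ LinearMap.range (f₀.toFun i) at hx
            rw [hex₀] at hx
            exact ⟨⟨x, hx⟩, rfl⟩
    -- With zero kernels both surjections would be isomorphisms, and the distinct endpoints would
    -- coincide.
    refine ⟨π', π'', hπ', hπ'', hN'.trans hN''.symm, fun hbot => hne ?_⟩
    have hinj' : ∀ i, Function.Injective (π'.toFun i) := fun i => by
      rw [← LinearMap.ker_eq_bot]
      exact congrFun (congrArg SubRep.carrier hbot) i
    obtain rfl := dim_eq_of_bijective _ fun i => ⟨hinj' i, hπ' i⟩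
    obtain rfl : u'' = v'' := add_left_cancel (hu.trans hv.symm)
    have hbij'' : ∀ i, Function.Bijective (π''.toFun i) := fun i =>
      ⟨LinearMap.injective_iff_surjective.2 (hπ'' i), hπ'' i⟩
    rw [Nak.mk_eq_mk_iff.2 ⟨π', fun i => ⟨hinj' i, hπ' i⟩⟩, ← Nak.mk_eq_mk_iff.2 ⟨π'', hbij''⟩]
  · rintro ⟨π', π'', hπ', hπ'', hiso, hbot⟩
    obtain ⟨R, f₀, g₀, f₁, g₁, hf₀, hgf₀, hf₁, hgf₁, hglue, -⟩ := exists_amalgam hv π' π'' hiso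
    obtain ⟨γ, hγ, hγt, hγ0⟩ := exists_continuous_orbit hv f₀ g₀ hf₀ hgf₀
    obtain ⟨δ, hδ, hδt, hδ0⟩ := exists_continuous_orbit_inv hu f₁ g₁ hf₁ hgf₁
    obtain ⟨i, k, hk, hk0⟩ : ∃ i, ∃ k : Cn v' i, π'.toFun i k = 0 ∧ k ≠ 0 := by
      by_contra! hcon
      refine hbot (SubRep.ext (funext fun i => ?_))
      exact (Submodule.eq_bot_iff _).2 fun x hx => hcon i x hx
    refine closedFlowLine_of_orbit (Nak.smul_sum hv _ _) (Nak.smul_sum hu _ _) (fun hpq => ?_)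
      (fun t ht => ?_) hγ hδ hγt hδt hγ0 hδ0
    · obtain ⟨⟨φ, hφ⟩, -⟩ := (Nak.sum_eq_sum_iff hv hu).1 hpq
      have hb := FramedHom.bijective_of_isStable R'.2.2 S'.2.2 π' φ i
      exact hk0 (hb.1 (by rw [hk, map_zero]))
    -- An isomorphism from the twist by `t` to `R` multiplies the image of `R'` by `t` and fixes
    -- that of `S''`, as the framings show. The glued vector `f₀ k ≠ 0` lies in both.
    · rw [Nak.smul_mk, Nak.mk_eq_mk_iff] at ht
      obtain ⟨φ, hφ⟩ := ht
      let φ' : Hom R.1.toDoubleRep R.1.toDoubleRep := φ.toHom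
      have h0 := R'.2.2.hom_eq (φ'.comp f₀.toHom) (f₀.toHom.smul t) (fun i w => by
        change φ.toFun i (f₀.toFun i _) = (t : ℂ) • f₀.toFun i _
        rw [f₀.comm_A]
        have h1 : φ.toFun i (R.1.A i ((t⁻¹ : ℂˣ) • (t • w), 0)) = R.1.A i ((t : ℂ) • w, 0) :=
          φ.comm_A i ((t : ℂ) • w, 0)
        rw [inv_smul_smul] at h1
        change φ.toFun i (R.1.A i (w, 0)) = (t : ℂ) • R.1.A i (w, 0)
        rw [h1, ← map_smul, Prod.smul_mk, smul_zero])
      have h1 := S''.2.2.hom_eq (φ'.comp f₁.toHom) f₁.toHom (fun i w => by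
        change φ.toFun i (f₁.toFun i _) = f₁.toFun i _
        rw [f₁.comm_A]
        have h1 : φ.toFun i (R.1.A i ((t⁻¹ : ℂˣ) • (0 : W' i), w)) = R.1.A i (0, w) :=
          φ.comm_A i (0, w)
        rw [smul_zero] at h1
        exact h1)
      obtain ⟨y, hy⟩ := hglue i k hk
      have h2 : φ'.toFun i (f₀.toFun i k) = (t : ℂ) • f₀.toFun i k := h0 i k
      have h3 : φ'.toFun i (f₁.toFun i y) = f₁.toFun i y := h1 i y
      rw [← hy, h2] at h3
      have hne : f₀.toFun i k ≠ 0 := fun h => hk0 (hf₀ i (by rw [h, map_zero]))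
      have h4 : ((t : ℂ) - 1) • f₀.toFun i k = 0 := by rw [sub_smul, one_smul, h3, sub_self]
      rcases smul_eq_zero.1 h4 with h5 | h5
      · exact Units.ext (sub_eq_zero.1 h5)
      · exact absurd h5 hne

end Gluing

/-! ### Kernels of framed surjections and the stacks of exact sequences -/

section Correspondences

variable {I : Type*} [Quiver I] [Fintype I] [∀ i j : I, Fintype (i ⟶ j)] {W W' W'' : I → Type*}
  [∀ i, AddCommGroup (W i)] [∀ i, Module ℂ (W i)]
  [∀ i, AddCommGroup (W' i)] [∀ i, Module ℂ (W' i)]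
  [∀ i, AddCommGroup (W'' i)] [∀ i, Module ℂ (W'' i)]

/-- `B` vanishes on the kernel of a morphism over the identity of framings, so `A B` drops out of
the moment equation. -/
theorem FramedHom.moment_eq_zero_of_ker {n v u : I → ℕ} {K : DoubleRep (Cn n)} {R : StableRep v W}
    {S : StableRep u W} (π : FramedHom R.1 S.1 (fun _ => LinearMap.id))
    (κ : Hom K R.1.toDoubleRep) (hκ : ∀ i, Function.Injective (κ.toFun i))
    (hκπ : ∀ i, LinearMap.range (κ.toFun i) = LinearMap.ker (π.toFun i)) (i : I) :
    K.moment i = 0 := by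
  refine LinearMap.ext fun x => hκ i ?_
  rw [κ.comm_moment]
  have h1 : R.1.B i (κ.toFun i x) = 0 := by
    have h2 : π.toFun i (κ.toFun i x) = 0 := by
      rw [← LinearMap.mem_ker, ← hκπ]
      exact ⟨x, rfl⟩
    have := π.comm_B i (κ.toFun i x)
    rw [h2, map_zero] at this
    exact this.symm
  have h3 := LinearMap.congr_fun (R.2.1 i) (κ.toFun i x)
  simpa [FramedRep.moment, h1] using h3

/-- The short exact sequence given by a framed surjection and a model of its kernel. -/
def FramedHom.toNPoint {n v u : I → ℕ} {K : DoubleRep (Cn n)} {R : StableRep v W}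
    {S : StableRep u W} (π : FramedHom R.1 S.1 (fun _ => LinearMap.id)) (hπ : π.toHom.Surjective)
    (κ : Hom K R.1.toDoubleRep) (hκ : ∀ i, Function.Injective (κ.toFun i))
    (hκπ : ∀ i, LinearMap.range (κ.toFun i) = LinearMap.ker (π.toFun i)) : NPoint u v n W where
  K := ⟨K, π.moment_eq_zero_of_ker κ hκ hκπ⟩
  Vp := R
  Vm := S
  incl := κ
  proj := π
  incl_injective := hκ
  exact := hκπ
  proj_surjective := hπ

/-- The sequence is moved to other representatives of its last two terms while `K` itself is kept,
so that its class need not be compared again. -/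
theorem NPoint.exists_hom {n v u : I → ℕ} (ν : NPoint u v n W) {R : StableRep v W}
    {S : StableRep u W} (hm : ν.piMinus = Nak.mk S) (hp : ν.piPlus = Nak.mk R) :
    ∃ (π : FramedHom R.1 S.1 (fun _ => LinearMap.id)) (κ : Hom ν.K.1 R.1.toDoubleRep),
      π.toHom.Surjective ∧ (∀ i, Function.Injective (κ.toFun i)) ∧
      ∀ i, LinearMap.range (κ.toFun i) = LinearMap.ker (π.toFun i) := by
  obtain ⟨φ, hφ⟩ := Nak.mk_eq_mk_iff.1 hp
  obtain ⟨ψ, hψ⟩ := Nak.mk_eq_mk_iff.1 hm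
  let π : FramedHom R.1 S.1 (fun _ => LinearMap.id) :=
    (ψ.comp ν.proj (fun _ => LinearMap.id) (fun _ _ => rfl)).comp (φ.symm hφ) _ (fun _ _ => rfl)
  refine ⟨π, φ.toHom.comp ν.incl, π.surjective S.2.2 fun _ => Function.surjective_id,
    fun i => (hφ i).1.comp (ν.incl_injective i), fun i => ?_⟩
  ext y
  obtain ⟨x, rfl⟩ := (hφ i).2 y
  have h1 : φ.toFun i x ∈ LinearMap.ker (π.toFun i) ↔ x ∈ LinearMap.ker (ν.proj.toFun i) := by
    rw [LinearMap.mem_ker, LinearMap.mem_ker]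
    change ψ.toFun i (ν.proj.toFun i ((φ.symm hφ).toFun i (φ.toFun i x))) = 0 ↔ _
    rw [FramedHom.symm_apply, map_eq_zero_iff _ (hψ i).1]
  rw [h1, ← ν.exact]
  constructor
  · rintro ⟨z, hz⟩
    exact ⟨z, (hφ i).1 hz⟩
  · rintro ⟨z, rfl⟩
    exact ⟨z, rfl⟩

theorem dim_eq_add_of_exact {n v u : I → ℕ} {κ : ∀ i, Cn n i →ₗ[ℂ] Cn v i}
    {π : ∀ i, Cn v i →ₗ[ℂ] Cn u i} (hκ : ∀ i, Function.Injective (κ i))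
    (hπ : ∀ i, Function.Surjective (π i))
    (hκπ : ∀ i, LinearMap.range (κ i) = LinearMap.ker (π i)) : v = u + n := by
  rw [add_comm]
  exact (dim_add_of_exact hκ hπ hκπ).symm

/-- Pairs of framed surjections with isomorphic non-zero kernels are the same as pairs of points of
the correspondences over the same representation. -/
theorem exists_surjections_iff {u' u'' v' v'' : I → ℕ}
    (S' : StableRep u' W') (S'' : StableRep u'' W'') (R' : StableRep v' W')
    (R'' : StableRep v'' W'') :
    (∃ (π' : FramedHom R'.1 S'.1 (fun _ => LinearMap.id))
        (π'' : FramedHom S''.1 R''.1 (fun _ => LinearMap.id)),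
        π'.toHom.Surjective ∧ π''.toHom.Surjective ∧
        π'.toHom.ker.toRep.Isomorphic π''.toHom.ker.toRep ∧ π'.toHom.ker ≠ ⊥) ↔
      ∃ n : I → ℕ, n ≠ 0 ∧ v' = u' + n ∧ u'' = v'' + n ∧
          ∃ (ν' : NPoint u' v' n W') (ν'' : NPoint v'' u'' n W''),
            ν'.piMinus = Nak.mk S' ∧ ν'.piPlus = Nak.mk R' ∧
            ν''.piMinus = Nak.mk R'' ∧ ν''.piPlus = Nak.mk S'' ∧ ν'.p = ν''.p := by
  constructor
  · rintro ⟨π', π'', hπ', hπ'', ⟨θ, hθ⟩, hbot⟩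
    let n : I → ℕ := fun i => Module.finrank ℂ (π'.toHom.ker.carrier i)
    let e : ∀ i, π'.toHom.ker.carrier i ≃ₗ[ℂ] Cn n i := fun i => (Module.finBasis ℂ _).equivFun
    -- One model of the common kernel is embedded on both sides, through `θ` on the second, which
    -- makes the two images equal by definition.
    let K : DoubleRep (Cn n) := π'.toHom.ker.toRep.transport e
    let ε : Hom K π'.toHom.ker.toRep := Hom.ofAct (fun i => (e i).symm.toLinearMap)
      (fun i j d x => by
        change (e j).symm ((π'.toHom.ker.toRep.transport e).act d x) = _
        rw [DoubleRep.act_transport, LinearEquiv.symm_apply_apply]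
        rfl)
    let κ' : Hom K R'.1.toDoubleRep := π'.toHom.ker.incl.comp ε
    let κ'' : Hom K S''.1.toDoubleRep := π''.toHom.ker.incl.comp (θ.comp ε)
    have hκ' : ∀ i, Function.Injective (κ'.toFun i) := fun i =>
      Subtype.val_injective.comp (e i).symm.injective
    have hκ'' : ∀ i, Function.Injective (κ''.toFun i) := fun i =>
      Subtype.val_injective.comp ((hθ i).1.comp (e i).symm.injective)
    have hr' : ∀ i, LinearMap.range (κ'.toFun i) = LinearMap.ker (π'.toFun i) := by
      intro i
      ext x
      constructor
      · rintro ⟨y, rfl⟩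
        exact ((e i).symm y).2
      · intro hx
        refine ⟨e i ⟨x, hx⟩, ?_⟩
        change (((e i).symm (e i ⟨x, hx⟩) : π'.toHom.ker.carrier i) : Cn v' i) = x
        rw [LinearEquiv.symm_apply_apply]
    have hr'' : ∀ i, LinearMap.range (κ''.toFun i) = LinearMap.ker (π''.toFun i) := by
      intro i
      ext x
      constructor
      · rintro ⟨y, rfl⟩
        exact (θ.toFun i ((e i).symm y)).2
      · intro hx
        obtain ⟨z, hz⟩ := (hθ i).2 ⟨x, hx⟩
        refine ⟨e i z, ?_⟩
        change ((θ.toFun i ((e i).symm (e i z)) : π''.toHom.ker.carrier i) : Cn u'' i) = x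
        rw [LinearEquiv.symm_apply_apply, hz]
    refine ⟨n, fun hn => hbot ?_, dim_eq_add_of_exact hκ' hπ' hr',
      dim_eq_add_of_exact hκ'' hπ'' hr'', π'.toNPoint hπ' κ' hκ' hr', π''.toNPoint hπ'' κ'' hκ'' hr'',
      rfl, rfl, rfl, rfl, rfl⟩
    refine SubRep.ext (funext fun i => ?_)
    exact Submodule.finrank_eq_zero.1 (congrFun hn i)
  · rintro ⟨n, hn, -, -, ν', ν'', h1, h2, h3, h4, h5⟩
    obtain ⟨π', κ', hπ', hκ', hr'⟩ := ν'.exists_hom h1 h2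
    obtain ⟨π'', κ'', hπ'', hκ'', hr''⟩ := ν''.exists_hom h3 h4
    obtain ⟨g, hg⟩ := Quotient.exact h5
    have hK : ν'.K.1.Isomorphic ν''.K.1 := by
      rw [← hg]
      exact ⟨Hom.ofAct (fun i => (g i).toLinearMap) (fun i j d x => by
        rw [DoubleRep.act_transport]
        simp), fun i => (g i).bijective⟩
    refine ⟨π', π'', hπ', hπ'', (κ'.isomorphic_of_injective hκ' π'.toHom.ker hr').symm.trans
      (hK.trans (κ''.isomorphic_of_injective hκ'' π''.toHom.ker hr'')), fun hbot => hn ?_⟩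
    funext i
    have h6 : LinearMap.ker (π'.toFun i) = ⊥ := congrFun (congrArg SubRep.carrier hbot) i
    have h7 := LinearMap.finrank_range_of_inj (hκ' i)
    rw [hr', h6] at h7
    simpa using h7.symm

end Correspondences

/-! ### A common partial inverse of `f` and of its perturbation -/

section LinearAlgebra

variable {k E F : Type*} [Field k] [AddCommGroup E] [Module k E] [AddCommGroup F] [Module k F]

/-- The map is forced on the range of `h` and extended arbitrarily. -/
theorem LinearMap.exists_comp_eq_of_ker_le {G : Type*} [AddCommGroup G] [Module k G]
    (h : E →ₗ[k] F) (c : E →ₗ[k] G) (hle : LinearMap.ker h ≤ LinearMap.ker c) :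
    ∃ r : F →ₗ[k] G, ∀ x, r (h x) = c x := by
  obtain ⟨r, hr⟩ := LinearMap.exists_extend
    ((LinearMap.ker h).liftQ c hle ∘ₗ h.quotKerEquivRange.symm.toLinearMap)
  refine ⟨r, fun x => ?_⟩
  have h1 := LinearMap.congr_fun hr ⟨h x, ⟨x, rfl⟩⟩
  have h2 : h.quotKerEquivRange.symm ⟨h x, ⟨x, rfl⟩⟩ = (LinearMap.ker h).mkQ x := by
    rw [LinearEquiv.symm_apply_eq]
    rfl
  simpa [h2] using h1

/-- A linear map `θ` which identifies `ker f / P` with a subspace of `coker f` can be modified so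
that together with `f` it has a common partial inverse. -/
theorem exists_partial_inverse (f θ : E →ₗ[k] F) (P : Submodule k E) (hP : P ≤ LinearMap.ker f)
    (hθ : ∀ x ∈ LinearMap.ker f, θ x ∈ LinearMap.range f → x ∈ P)
    (hθ' : ∀ x ∈ P, θ x ∈ LinearMap.range f) :
    ∃ (T : E →ₗ[k] F) (r : F →ₗ[k] E), (∀ x, f (r (f x)) = f x) ∧ (∀ x, r (T x) = 0) ∧
      (∀ y, T (r y) = 0) ∧ (∀ x ∈ P, T x = 0) ∧
      (∀ x ∈ LinearMap.ker f, T x - θ x ∈ LinearMap.range f) ∧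
      ∀ x, ∃ y ∈ LinearMap.ker f, T x = θ y := by
  obtain ⟨pr, hpr⟩ := (LinearMap.ker f).subtype.exists_leftInverse_of_injective
    (Submodule.ker_subtype _)
  have hpr' : ∀ x : LinearMap.ker f, pr x = x := fun x => LinearMap.congr_fun hpr x
  let P' : Submodule k (LinearMap.ker f) := P.comap (LinearMap.ker f).subtype
  obtain ⟨σ, hσ⟩ := P'.mkQ.exists_rightInverse_of_surjective P'.range_mkQ
  have hσ' : ∀ q, P'.mkQ (σ q) = q := fun q => LinearMap.congr_fun hσ q
  -- `G` projects onto a complement of `P` in `ker f`, killing `P` and a complement of `ker f`. As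
  -- `θ` sends `P` into the range of `f`, replacing `θ` by `θ ∘ G` changes it on `ker f` only modulo
  -- that range.
  let G : E →ₗ[k] E := (LinearMap.ker f).subtype ∘ₗ σ ∘ₗ P'.mkQ ∘ₗ pr
  have hGker : ∀ x, f (G x) = 0 := fun x => (σ (P'.mkQ (pr x))).2
  have hGapp : ∀ x, G x = (σ (P'.mkQ (pr x)) : E) := fun x => rfl
  have hGP : ∀ x ∈ P, G x = 0 := by
    intro x hx
    have h1 : pr x = ⟨x, hP hx⟩ := hpr' ⟨x, hP hx⟩
    have h2 : P'.mkQ (pr x) = 0 := by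
      rw [h1]
      exact (Submodule.Quotient.mk_eq_zero _).2 hx
    rw [hGapp, h2, map_zero]
    rfl
  have hGsub : ∀ x ∈ LinearMap.ker f, G x - x ∈ P := by
    intro x hx
    have h1 : pr x = ⟨x, hx⟩ := hpr' ⟨x, hx⟩
    have h2 := hσ' (P'.mkQ ⟨x, hx⟩)
    rw [hGapp, h1]
    exact (Submodule.Quotient.eq P').1 h2
  let c : E →ₗ[k] E := LinearMap.id - (LinearMap.ker f).subtype ∘ₗ pr
  have hcapp : ∀ x, c x = x - (pr x : E) := fun x => rfl
  have hfc : ∀ x, f (c x) = f x := fun x => by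
    rw [hcapp, map_sub, show f (pr x : E) = 0 from (pr x).2, sub_zero]
  have hprc : ∀ x, pr (c x) = 0 := fun x => by rw [hcapp, map_sub, hpr', sub_self]
  have hGc : ∀ x, G (c x) = 0 := fun x => by rw [hGapp, hprc, map_zero, map_zero]; rfl
  have hcc : ∀ x, c (c x) = c x := fun x => by rw [hcapp (c x), hprc]; simp
  have hcker : ∀ x, f x = 0 → c x = 0 := fun x hx => by
    have h1 : pr x = ⟨x, hx⟩ := hpr' ⟨x, hx⟩
    rw [hcapp, h1, sub_self]
  have hGG : ∀ x, θ (G x) ∈ LinearMap.range f → G x = 0 := by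
    intro x hx
    have h1 : P'.mkQ (σ (P'.mkQ (pr x))) = 0 :=
      (Submodule.Quotient.mk_eq_zero _).2 (hθ _ (hGker x) hx)
    rw [hσ'] at h1
    rw [hGapp, h1, map_zero]
    rfl
  -- If `f x + θ (G x) = 0`, then `G x = 0` by the independence of `θ ∘ G` from the range of `f`,
  -- hence `f x = 0`. So the projection `c` along `ker f` factors through the sum; its factor
  -- inverts `f` and kills `θ ∘ G`. Composing with `c` once more secures `T ∘ r = 0`.
  obtain ⟨r₀, hr₀⟩ := LinearMap.exists_comp_eq_of_ker_le (f + θ ∘ₗ G) c (by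
    intro x hx
    have h1 : f x + θ (G x) = 0 := hx
    have h2 : G x = 0 := hGG x ⟨-x, by rw [map_neg, neg_eq_iff_add_eq_zero, h1]⟩
    rw [h2, map_zero, add_zero] at h1
    exact hcker x h1)
  have hr₀' : ∀ x, r₀ (f x + θ (G x)) = c x := hr₀
  have hr₀f : ∀ x, r₀ (f x) = c x := fun x => by
    have := hr₀' (c x)
    rwa [hfc, hGc, map_zero, add_zero, hcc] at this
  refine ⟨θ ∘ₗ G, c ∘ₗ r₀, fun x => ?_, fun x => ?_, fun y => ?_, fun x hx => ?_, fun x hx => ?_,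
    fun x => ⟨G x, hGker x, rfl⟩⟩
  · rw [LinearMap.comp_apply, hfc, hr₀f, hfc]
  · have h1 := hr₀' x
    rw [map_add, hr₀f, add_eq_left] at h1
    simp [h1]
  · simp [hGc]
  · simp [hGP x hx]
  · rw [LinearMap.comp_apply, ← map_sub]
    exact hθ' _ (hGsub x hx)

end LinearAlgebra

/-! ### Matching chains of subspaces and their deformation -/

section Chains

variable {I : Type*} [Quiver I] {V V' V'' : I → Type*}
  [∀ i, AddCommGroup (V i)] [∀ i, Module ℂ (V i)]
  [∀ i, AddCommGroup (V' i)] [∀ i, Module ℂ (V' i)]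
  [∀ i, AddCommGroup (V'' i)] [∀ i, Module ℂ (V'' i)]

/-- Matching filtrations in terms of subspaces: filtrations `0 = P 0 ≤ ⋯ ≤ P k = Ker f` and
`Im f = Q k ≤ ⋯ ≤ Q 0 = Ker g`, and linear maps `θ l` which induce isomorphisms of representations
`P (l + 1) / P l → Q l / Q (l + 1)`. -/
structure MatchingChain (k : ℕ) (R' : DoubleRep V') (R : DoubleRep V)
    (f : ∀ i, V' i →ₗ[ℂ] V i) (g : ∀ i, V i →ₗ[ℂ] V'' i)
    (P : ℕ → ∀ i, Submodule ℂ (V' i)) (Q : ℕ → ∀ i, Submodule ℂ (V i))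
    (θ : ℕ → ∀ i, V' i →ₗ[ℂ] V i) : Prop where
  f_act : ∀ {i j : I} (d : DArrow i j) x, f j (R'.act d x) = R.act d (f i x)
  P_zero : ∀ i, P 0 i = ⊥
  P_last : ∀ i, P k i = LinearMap.ker (f i)
  Q_last : ∀ i, Q k i = LinearMap.range (f i)
  Q_zero : ∀ i, Q 0 i = LinearMap.ker (g i)
  P_act : ∀ l ≤ k, ∀ {i j : I} (d : DArrow i j), ∀ x ∈ P l i, R'.act d x ∈ P l j
  Q_act : ∀ l ≤ k, ∀ {i j : I} (d : DArrow i j), ∀ x ∈ Q l i, R.act d x ∈ Q l j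
  P_mono : ∀ l < k, ∀ i, P l i ≤ P (l + 1) i
  Q_anti : ∀ l < k, ∀ i, Q (l + 1) i ≤ Q l i
  θ_mem : ∀ l < k, ∀ i, ∀ x ∈ P (l + 1) i, θ l i x ∈ Q l i
  θ_mem_iff : ∀ l < k, ∀ i, ∀ x ∈ P (l + 1) i, θ l i x ∈ Q (l + 1) i ↔ x ∈ P l i
  θ_surj : ∀ l < k, ∀ i, ∀ y ∈ Q l i, ∃ x ∈ P (l + 1) i, y - θ l i x ∈ Q (l + 1) i
  θ_act : ∀ l < k, ∀ {i j : I} (d : DArrow i j), ∀ x ∈ P (l + 1) i,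
    θ l j (R'.act d x) - R.act d (θ l i x) ∈ Q (l + 1) j

namespace MatchingChain

variable {k : ℕ} {R' : DoubleRep V'} {R : DoubleRep V} {f : ∀ i, V' i →ₗ[ℂ] V i}
  {g : ∀ i, V i →ₗ[ℂ] V'' i} {P : ℕ → ∀ i, Submodule ℂ (V' i)} {Q : ℕ → ∀ i, Submodule ℂ (V i)}
  {θ : ℕ → ∀ i, V' i →ₗ[ℂ] V i}

theorem P_le (h : MatchingChain k R' R f g P Q θ) {l m : ℕ} (hlm : l ≤ m) (hm : m ≤ k) (i : I) :
    P l i ≤ P m i := by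
  induction m, hlm using Nat.le_induction with
  | base => exact le_rfl
  | succ n hn ih => exact (ih (by omega)).trans (h.P_mono n (by omega) i)

theorem Q_le (h : MatchingChain k R' R f g P Q θ) {l m : ℕ} (hlm : l ≤ m) (hm : m ≤ k) (i : I) :
    Q m i ≤ Q l i := by
  induction m, hlm using Nat.le_induction with
  | base => exact le_rfl
  | succ n hn ih => exact (h.Q_anti n (by omega) i).trans (ih (by omega))

/-- A matching chain is a limit of shorter ones. -/
theorem exists_deformation (h : MatchingChain (k + 1) R' R f g P Q θ) :
    ∃ (η : ∀ i j : I, DArrow i j → V' i →ₗ[ℂ] V' j) (ν : ∀ i j : I, DArrow i j → V i →ₗ[ℂ] V j)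
      (T : ∀ i, V' i →ₗ[ℂ] V i), ∀ s : ℂ, s ≠ 0 →
      MatchingChain k (DoubleRep.ofAct fun i j d => R'.act d + s • η i j d)
        (DoubleRep.ofAct fun i j d => R.act d + s • ν i j d) (fun i => f i + s • T i) g P Q θ := by
  have hex := fun i => exists_partial_inverse (f i) (θ k i) (P k i)
    ((h.P_mono k k.lt_succ_self i).trans_eq (h.P_last i))
    (fun x hx hθ => by
      rw [← h.P_last] at hx
      rw [← h.Q_last] at hθ
      exact (h.θ_mem_iff k k.lt_succ_self i x hx).1 hθ)
    (fun x hx => by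
      rw [← h.Q_last]
      exact (h.θ_mem_iff k k.lt_succ_self i x (h.P_mono k k.lt_succ_self i hx)).2 hx)
  choose T r hfrf hrT hTr hTP hTθ hTmem using hex
  have hTQ : ∀ i x, T i x ∈ Q k i := fun i x => by
    obtain ⟨y, hy, hxy⟩ := hTmem i x
    rw [hxy]
    exact h.θ_mem k k.lt_succ_self i y (by rw [h.P_last]; exact hy)
  have hff : ∀ i y, y ∈ LinearMap.range (f i) → f i (r i y) = y := by
    rintro i _ ⟨x, rfl⟩
    exact hfrf i x
  have hPf : ∀ i, ∀ x ∈ P k i, f i x = 0 := fun i x hx =>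
    ((h.P_mono k k.lt_succ_self i).trans_eq (h.P_last i)) hx
  -- On `ker f` the map `T` agrees with `θ k` modulo the range of `f`, which is `Q (k + 1)`, and so
  -- is equivariant modulo it.
  have hcomm : ∀ {i j : I} (d : DArrow i j) (x : V' i), f i x = 0 →
      R.act d (T i x) - T j (R'.act d x) ∈ LinearMap.range (f j) := by
    intro i j d x hx
    have h1 := hTθ i x hx
    have hx' : f j (R'.act d x) = 0 := by rw [h.f_act, hx, map_zero]
    have h2 := hTθ j (R'.act d x) hx'
    have h3 := h.θ_act k k.lt_succ_self d x (by rw [h.P_last]; exact hx)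
    rw [← h.Q_last] at h1 h2 ⊢
    have h4 := h.Q_act (k + 1) le_rfl d _ h1
    have h5 := Submodule.sub_mem _ (Submodule.sub_mem _ h4 h2) h3
    convert h5 using 1
    rw [map_sub]
    abel
  -- The equation `(f + sT)(R' + sη) = (R + sν)(f + sT)` requires `fη + TR' = RT + νf` and `Tη =
  -- νT`. With `ν = TR'r` and values of `η` in the range of `r`, both sides of the second vanish.
  -- The first prescribes `fη`, and `hcomm` ensures that the prescribed values lie in the range of
  -- `f`.
  let η : ∀ i j : I, DArrow i j → V' i →ₗ[ℂ] V' j := fun i j d =>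
    r j ∘ₗ (R.act d ∘ₗ T i - T j ∘ₗ R'.act d ∘ₗ (LinearMap.id - r i ∘ₗ f i))
  let ν : ∀ i j : I, DArrow i j → V i →ₗ[ℂ] V j := fun i j d => T j ∘ₗ R'.act d ∘ₗ r i
  have hη : ∀ {i j : I} (d : DArrow i j) x,
      η i j d x = r j (R.act d (T i x) - T j (R'.act d (x - r i (f i x)))) := fun d x => rfl
  have hν : ∀ {i j : I} (d : DArrow i j) x, ν i j d x = T j (R'.act d (r i x)) := fun d x => rfl
  have hηP : ∀ {i j : I} (d : DArrow i j), ∀ x ∈ P k i, η i j d x = 0 := by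
    intro i j d x hx
    rw [hη, hPf i x hx, map_zero, sub_zero, hTP i x hx,
      hTP j _ (h.P_act k (by omega) d x hx)]
    simp
  have hηf : ∀ {i j : I} (d : DArrow i j) x,
      f j (η i j d x) = R.act d (T i x) - T j (R'.act d x) + T j (R'.act d (r i (f i x))) := by
    intro i j d x
    have hy : f i (x - r i (f i x)) = 0 := by rw [map_sub, hfrf, sub_self]
    have h1 := hcomm d _ hy
    have hT : T i (x - r i (f i x)) = T i x := by rw [map_sub, hTr, sub_zero]
    rw [hT] at h1
    rw [hη, hff j _ h1, map_sub (R'.act d), map_sub (T j)]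
    abel
  refine ⟨η, ν, T, fun s hs => ?_⟩
  -- Applying `f ∘ r`, which kills `T`, shows that both summands vanish. Vanishing of `T x` on `ker
  -- f` means that `θ k x` lies in the range of `f`, that is, `x ∈ P k`.
  have hker : ∀ i x, f i x + s • T i x = 0 ↔ x ∈ P k i := by
    intro i x
    constructor
    · intro hx
      have h1 : f i x = 0 := by
        have := congrArg (fun y => f i (r i y)) hx
        simpa [hrT, hfrf] using this
      rw [h1, zero_add, smul_eq_zero_iff_right hs] at hx
      have h2 := hTθ i x h1
      rw [hx, zero_sub, Submodule.neg_mem_iff, ← h.Q_last] at h2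
      exact (h.θ_mem_iff k k.lt_succ_self i x (by rw [h.P_last]; exact h1)).1 h2
    · intro hx
      rw [hPf i x hx, hTP i x hx, smul_zero, add_zero]
  have hrange : ∀ i y, y ∈ Q k i ↔ ∃ x, f i x + s • T i x = y := by
    intro i y
    constructor
    · intro hy
      obtain ⟨x, hx, hyx⟩ := h.θ_surj k k.lt_succ_self i y hy
      rw [h.P_last] at hx
      have h1 := hTθ i x hx
      rw [h.Q_last] at hyx
      obtain ⟨z, hz⟩ := Submodule.sub_mem _ hyx h1
      -- The first term hits `T x` after scaling, the second one the remainder `y - T x = f z`;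
      -- neither disturbs the other.
      refine ⟨s⁻¹ • x + r i (f i z), ?_⟩
      rw [map_add, map_add, map_smul, map_smul, show f i x = 0 from hx, hfrf, hTr, hz]
      rw [smul_zero, zero_add, add_zero, smul_inv_smul₀ hs]
      abel
    · rintro ⟨x, rfl⟩
      refine Submodule.add_mem _ ?_ (Submodule.smul_mem _ _ (hTQ i x))
      exact h.Q_anti k k.lt_succ_self i (by rw [h.Q_last]; exact ⟨x, rfl⟩)
  exact
    { f_act := fun {i j} d x => by
        have h1 := h.f_act d x
        have h2 := hηf d x
        have h3 : T j (η i j d x) = 0 := by rw [hη, hTr]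
        simp only [DoubleRep.act_ofAct, LinearMap.add_apply, LinearMap.smul_apply, map_add,
          map_smul, h1, h2, h3, hν, hrT, map_zero, smul_zero, add_zero, smul_add, smul_sub]
        abel
      P_zero := h.P_zero
      P_last := fun i => by
        ext x
        exact (hker i x).symm
      Q_last := fun i => by
        ext y
        exact hrange i y
      Q_zero := h.Q_zero
      P_act := fun l hl i j d x hx => by
        rw [DoubleRep.act_ofAct, LinearMap.add_apply, LinearMap.smul_apply,
          hηP d x (h.P_le hl (by omega) i hx), smul_zero, add_zero]
        exact h.P_act l (by omega) d x hx
      Q_act := fun l hl i j d x hx => by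
        rw [DoubleRep.act_ofAct]
        exact Submodule.add_mem _ (h.Q_act l (by omega) d x hx)
          (Submodule.smul_mem _ _ (h.Q_le hl (by omega) j (hTQ j _)))
      P_mono := fun l hl => h.P_mono l (by omega)
      Q_anti := fun l hl => h.Q_anti l (by omega)
      θ_mem := fun l hl => h.θ_mem l (by omega)
      θ_mem_iff := fun l hl => h.θ_mem_iff l (by omega)
      θ_surj := fun l hl => h.θ_surj l (by omega)
      θ_act := fun l hl i j d x hx => by
        have hx' := h.P_le (show l + 1 ≤ k from hl) (by omega) i hx
        have h1 := h.θ_act l (by omega) d x hx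
        have h2 : s • ν i j d (θ l i x) ∈ Q (l + 1) j :=
          Submodule.smul_mem _ _ (h.Q_le (show l + 1 ≤ k from hl) (by omega) j (hTQ j _))
        have h3 := Submodule.sub_mem _ h1 h2
        rw [DoubleRep.act_ofAct, DoubleRep.act_ofAct, LinearMap.add_apply, LinearMap.add_apply,
          LinearMap.smul_apply, LinearMap.smul_apply, hηP d x hx', smul_zero, add_zero]
        convert h3 using 1
        abel }

end MatchingChain

/-- Subquotients related by linear maps `θ` as in a matching chain are isomorphic. -/
theorem isomorphic_of_step {R' : DoubleRep V'} {R : DoubleRep V} {P P' : SubRep R'}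
    {Q Q' : SubRep R} (hP : P ≤ P') (hQ : Q' ≤ Q) (θ : ∀ i, V' i →ₗ[ℂ] V i)
    (hmem : ∀ i, ∀ x ∈ P'.carrier i, θ i x ∈ Q.carrier i)
    (hiff : ∀ i, ∀ x ∈ P'.carrier i, θ i x ∈ Q'.carrier i ↔ x ∈ P.carrier i)
    (hsurj : ∀ i, ∀ y ∈ Q.carrier i, ∃ x ∈ P'.carrier i, y - θ i x ∈ Q'.carrier i)
    (hact : ∀ {i j : I} (d : DArrow i j), ∀ x ∈ P'.carrier i,
      θ j (R'.act d x) - R.act d (θ i x) ∈ Q'.carrier j) :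
    (SubRep.factor hP).ker.toRep.Isomorphic (SubRep.factor hQ).ker.toRep := by
  have hP' : ∀ i (x : V' i), (P.carrier i).mkQ x ∈ (SubRep.factor hP).ker.carrier i ↔
      x ∈ P'.carrier i := fun i x => Submodule.Quotient.mk_eq_zero _
  have hQ' : ∀ i (x : V i), (Q'.carrier i).mkQ x ∈ (SubRep.factor hQ).ker.carrier i ↔
      x ∈ Q.carrier i := fun i x => Submodule.Quotient.mk_eq_zero _
  let Θ : ∀ i, (V' i ⧸ P.carrier i) →ₗ[ℂ] (V i ⧸ Q'.carrier i) := fun i =>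
    (P.carrier i).mapQ (Q'.carrier i) (θ i) fun x hx => (hiff i x (hP i hx)).2 hx
  have hΘ : ∀ i x, Θ i ((P.carrier i).mkQ x) = (Q'.carrier i).mkQ (θ i x) := fun i x => rfl
  have hmaps : ∀ i, ∀ x ∈ (SubRep.factor hP).ker.carrier i,
      Θ i x ∈ (SubRep.factor hQ).ker.carrier i := by
    intro i x hx
    obtain ⟨x, rfl⟩ := (P.carrier i).mkQ_surjective x
    rw [hΘ, hQ']
    exact hmem i x ((hP' i x).1 hx)
  refine ⟨Hom.ofAct (fun i => (Θ i).restrict (hmaps i)) fun i j d x => Subtype.ext ?_, fun i =>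
    ⟨?_, ?_⟩⟩
  · obtain ⟨x, hx⟩ := x
    obtain ⟨x, rfl⟩ := (P.carrier i).mkQ_surjective x
    rw [SubRep.coe_act_toRep]
    refine (congrArg (Θ j) (SubRep.coe_act_toRep _ d ⟨_, hx⟩)).trans ?_
    change _ = Q'.quotient.act d (Θ i ((P.carrier i).mkQ x))
    rw [P.act_quotient, hΘ, hΘ, Q'.act_quotient]
    exact (Submodule.Quotient.eq _).2 (hact d x ((hP' i x).1 hx))
  · rw [injective_iff_map_eq_zero]
    rintro ⟨x, hx⟩ h0
    obtain ⟨x, rfl⟩ := (P.carrier i).mkQ_surjective x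
    have h1 : (Q'.carrier i).mkQ (θ i x) = 0 := congrArg Subtype.val h0
    refine Subtype.ext ((Submodule.Quotient.mk_eq_zero _).2 ?_)
    exact (hiff i x ((hP' i x).1 hx)).1 ((Submodule.Quotient.mk_eq_zero _).1 h1)
  · rintro ⟨y, hy⟩
    obtain ⟨y, rfl⟩ := (Q'.carrier i).mkQ_surjective y
    obtain ⟨x, hx, hxy⟩ := hsurj i y ((hQ' i y).1 hy)
    refine ⟨⟨(P.carrier i).mkQ x, (hP' i x).2 hx⟩, Subtype.ext ?_⟩
    exact ((Submodule.Quotient.eq _).2 hxy).symm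

/-- Isomorphic subquotients are related by linear maps `θ` as in a matching chain. -/
theorem exists_step_of_isomorphic {R' : DoubleRep V'} {R : DoubleRep V} {P P' : SubRep R'}
    {Q Q' : SubRep R} (hP : P ≤ P') (hQ : Q' ≤ Q)
    (h : (SubRep.factor hP).ker.toRep.Isomorphic (SubRep.factor hQ).ker.toRep) :
    ∃ θ : ∀ i, V' i →ₗ[ℂ] V i,
      (∀ i, ∀ x ∈ P'.carrier i, θ i x ∈ Q.carrier i) ∧
      (∀ i, ∀ x ∈ P'.carrier i, θ i x ∈ Q'.carrier i ↔ x ∈ P.carrier i) ∧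
      (∀ i, ∀ y ∈ Q.carrier i, ∃ x ∈ P'.carrier i, y - θ i x ∈ Q'.carrier i) ∧
      ∀ {i j : I} (d : DArrow i j), ∀ x ∈ P'.carrier i,
        θ j (R'.act d x) - R.act d (θ i x) ∈ Q'.carrier j := by
  obtain ⟨ψ, hψ⟩ := h
  have hP' : ∀ i (x : V' i), (P.carrier i).mkQ x ∈ (SubRep.factor hP).ker.carrier i ↔
      x ∈ P'.carrier i := fun i x => Submodule.Quotient.mk_eq_zero _
  have hQ' : ∀ i (x : V i), (Q'.carrier i).mkQ x ∈ (SubRep.factor hQ).ker.carrier i ↔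
      x ∈ Q.carrier i := fun i x => Submodule.Quotient.mk_eq_zero _
  have hex : ∀ i, ∃ θ : V' i →ₗ[ℂ] V i, ∀ x (hx : x ∈ P'.carrier i),
      (Q'.carrier i).mkQ (θ x) = ψ.toFun i ⟨(P.carrier i).mkQ x, (hP' i x).2 hx⟩ := by
    intro i
    -- The isomorphism is extended linearly to the whole space and lifted through the quotient; only
    -- its values on `P'` matter.
    obtain ⟨τ, hτ⟩ := LinearMap.exists_extend
      (((SubRep.factor hQ).ker.carrier i).subtype ∘ₗ ψ.toFun i ∘ₗ
        LinearMap.codRestrict ((SubRep.factor hP).ker.carrier i)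
          ((P.carrier i).mkQ ∘ₗ (P'.carrier i).subtype) fun x => (hP' i x).2 x.2)
    obtain ⟨σ, hσ⟩ := (Q'.carrier i).mkQ.exists_rightInverse_of_surjective
      (Q'.carrier i).range_mkQ
    refine ⟨σ ∘ₗ τ, fun x hx => ?_⟩
    have h1 := LinearMap.congr_fun hσ (τ x)
    have h2 := LinearMap.congr_fun hτ ⟨x, hx⟩
    exact h1.trans h2
  choose θ hθ using hex
  refine ⟨θ, fun i x hx => ?_, fun i x hx => ?_, fun i y hy => ?_, fun {i j} d x hx => ?_⟩
  · rw [← hQ', hθ i x hx]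
    exact Subtype.prop _
  · rw [← Submodule.Quotient.mk_eq_zero (Q'.carrier i), ← Submodule.Quotient.mk_eq_zero]
    change (Q'.carrier i).mkQ (θ i x) = 0 ↔ (P.carrier i).mkQ x = 0
    rw [hθ i x hx, ZeroMemClass.coe_eq_zero, map_eq_zero_iff _ (hψ i).1]
    exact Subtype.ext_iff
  · obtain ⟨⟨x, hx⟩, hxy⟩ := (hψ i).2 ⟨(Q'.carrier i).mkQ y, (hQ' i y).2 hy⟩
    obtain ⟨x, rfl⟩ := (P.carrier i).mkQ_surjective x
    refine ⟨x, (hP' i x).1 hx, ?_⟩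
    rw [← Submodule.Quotient.eq]
    change (Q'.carrier i).mkQ y = (Q'.carrier i).mkQ (θ i x)
    rw [hθ i x ((hP' i x).1 hx), hxy]
  · rw [← Submodule.Quotient.eq]
    change (Q'.carrier j).mkQ (θ j _) = (Q'.carrier j).mkQ (R.act d _)
    rw [hθ j _ (P'.act_mem d hx), ← Q'.act_quotient, hθ i x hx, ← SubRep.coe_act_toRep, ← ψ.comm]
    congr 2
    refine Subtype.ext ?_
    rw [SubRep.coe_act_toRep]
    exact (P.act_quotient d x).symm

end Chains

/-! ### Filtrations by subrepresentations versus matching chains -/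

section Filtrations

variable {I : Type*} [Quiver I] {V V' V'' : I → Type*}
  [∀ i, AddCommGroup (V i)] [∀ i, Module ℂ (V i)]
  [∀ i, AddCommGroup (V' i)] [∀ i, Module ℂ (V' i)]
  [∀ i, AddCommGroup (V'' i)] [∀ i, Module ℂ (V'' i)]

/-- The filtration of the cokernel is pulled back to `V`, and the maps representing the isomorphisms
are lifted by a linear section of the quotient map. -/
theorem MatchingFiltrations.exists_matchingChain {R' : DoubleRep V'} {R : DoubleRep V}
    {R'' : DoubleRep V''} {f : Hom R' R} {g : Hom R R''}
    {h : ∀ i x, g.toFun i (f.toFun i x) = 0} (hm : MatchingFiltrations f g h) :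
    ∃ k P Q θ, MatchingChain k R' R f.toFun g.toFun P Q θ := by
  obtain ⟨k, P, Q, hP, hQ, hP0, hPk, hQk, hQ0, -, hiso⟩ := hm
  have hstep : ∀ l, ∃ θ : ∀ i, V' i →ₗ[ℂ] (V i ⧸ f.range.carrier i), l < k →
      (∀ i, ∀ x ∈ (P (l + 1)).carrier i, θ i x ∈ (Q l).carrier i) ∧
      (∀ i, ∀ x ∈ (P (l + 1)).carrier i, θ i x ∈ (Q (l + 1)).carrier i ↔ x ∈ (P l).carrier i) ∧
      (∀ i, ∀ y ∈ (Q l).carrier i, ∃ x ∈ (P (l + 1)).carrier i,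
        y - θ i x ∈ (Q (l + 1)).carrier i) ∧
      ∀ {i j : I} (d : DArrow i j), ∀ x ∈ (P (l + 1)).carrier i,
        θ j (R'.act d x) - f.range.quotient.act d (θ i x) ∈ (Q (l + 1)).carrier j := by
    intro l
    by_cases hl : l < k
    · obtain ⟨θ, hθ⟩ := exists_step_of_isomorphic (hP l) (hQ l) (hiso l hl)
      exact ⟨θ, fun _ => hθ⟩
    -- Beyond the length of the chain the value is immaterial.
    · exact ⟨fun _ => 0, fun h => absurd h hl⟩
  choose θ hθ using hstep
  have hσ : ∀ i, ∃ σ : (V i ⧸ f.range.carrier i) →ₗ[ℂ] V i,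
      ∀ q, (f.range.carrier i).mkQ (σ q) = q := fun i => by
    obtain ⟨σ, hσ⟩ := (f.range.carrier i).mkQ.exists_rightInverse_of_surjective
      (f.range.carrier i).range_mkQ
    exact ⟨σ, fun q => LinearMap.congr_fun hσ q⟩
  choose σ hσ using hσ
  refine ⟨k, fun l => (P l).carrier, fun l i => ((Q l).carrier i).comap (f.range.carrier i).mkQ,
    fun l i => σ i ∘ₗ θ l i, ?_⟩
  exact
    { f_act := f.comm
      P_zero := fun i => by rw [hP0]; rfl
      P_last := fun i => by rw [hPk]; rfl
      Q_last := fun i => by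
        rw [hQk]
        exact (f.range.carrier i).ker_mkQ
      Q_zero := fun i => by
        rw [hQ0]
        rfl
      P_act := fun l _ i j d x hx => (P l).act_mem d hx
      Q_act := fun l _ i j d x hx => by
        rw [Submodule.mem_comap, ← SubRep.act_quotient]
        exact (Q l).act_mem d hx
      P_mono := fun l _ i => hP l i
      Q_anti := fun l _ i => Submodule.comap_mono (hQ l i)
      θ_mem := fun l hl i x hx => by
        rw [Submodule.mem_comap, LinearMap.comp_apply, hσ]
        exact (hθ l hl).1 i x hx
      θ_mem_iff := fun l hl i x hx => by
        rw [Submodule.mem_comap, LinearMap.comp_apply, hσ]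
        exact (hθ l hl).2.1 i x hx
      θ_surj := fun l hl i y hy => by
        obtain ⟨x, hx, hxy⟩ := (hθ l hl).2.2.1 i _ hy
        refine ⟨x, hx, ?_⟩
        rwa [Submodule.mem_comap, map_sub, LinearMap.comp_apply, hσ]
      θ_act := fun l hl i j d x hx => by
        rw [Submodule.mem_comap, map_sub, LinearMap.comp_apply, LinearMap.comp_apply, hσ,
          ← SubRep.act_quotient, hσ]
        exact (hθ l hl).2.2.2 d x hx }

theorem MatchingChain.matchingFiltrations {R' : DoubleRep V'} {R : DoubleRep V}
    {R'' : DoubleRep V''} {f : Hom R' R} {g : Hom R R''}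
    {h : ∀ i x, g.toFun i (f.toFun i x) = 0} {k : ℕ} {P : ℕ → ∀ i, Submodule ℂ (V' i)}
    {Q : ℕ → ∀ i, Submodule ℂ (V i)} {θ : ℕ → ∀ i, V' i →ₗ[ℂ] V i}
    (hm : MatchingChain k R' R f.toFun g.toFun P Q θ) (hg : g.Surjective) :
    MatchingFiltrations f g h := by
  have hQmem : ∀ l ≤ k, ∀ i y, (f.range.carrier i).mkQ y ∈ (Q l i).map (f.range.carrier i).mkQ ↔
      y ∈ Q l i := by
    intro l hl i y
    rw [← Submodule.mem_comap, Submodule.comap_map_mkQ, sup_eq_right.2]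
    exact (hm.Q_last i).symm.trans_le (hm.Q_le hl le_rfl i)
  -- The chain is frozen after index `k`, because inclusions of consecutive terms are demanded for
  -- all indices.
  let P' : ℕ → SubRep R' := fun l =>
    SubRep.ofAct (P (min l k)) fun i j d x hx => hm.P_act _ (min_le_right l k) d x hx
  let Q' : ℕ → SubRep f.range.quotient := fun l =>
    SubRep.ofAct (fun i => (Q (min l k) i).map (f.range.carrier i).mkQ) (by
      rintro i j d _ ⟨x, hx, rfl⟩
      exact ⟨_, hm.Q_act _ (min_le_right l k) d x hx, (SubRep.act_quotient _ d x).symm⟩)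
  have hP' : ∀ l ≤ k, (P' l).carrier = P l := fun l hl => by
    change P (min l k) = P l
    rw [min_eq_left hl]
  have hQ' : ∀ l ≤ k, ∀ i y, (f.range.carrier i).mkQ y ∈ (Q' l).carrier i ↔ y ∈ Q l i := by
    intro l hl i y
    change _ ∈ (Q (min l k) i).map _ ↔ _
    rw [min_eq_left hl, hQmem l hl]
  refine ⟨k, P', Q', fun l i => hm.P_le (by omega) (by omega) i,
    fun l i => Submodule.map_mono (hm.Q_le (by omega) (by omega) i), ?_, ?_, ?_, ?_, ?_, ?_⟩
  · refine SubRep.ext ?_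
    rw [hP' 0 k.zero_le]
    exact funext hm.P_zero
  · refine SubRep.ext ?_
    rw [hP' k le_rfl]
    exact funext hm.P_last
  · refine SubRep.ext (funext fun i => ?_)
    ext q
    obtain ⟨y, rfl⟩ := (f.range.carrier i).mkQ_surjective q
    rw [hQ' k le_rfl, hm.Q_last]
    exact (Submodule.Quotient.mk_eq_zero (f.range.carrier i)).symm
  · refine SubRep.ext (funext fun i => ?_)
    ext q
    obtain ⟨y, rfl⟩ := (f.range.carrier i).mkQ_surjective q
    rw [hQ' 0 k.zero_le, hm.Q_zero]
    rfl
  · intro i z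
    obtain ⟨y, rfl⟩ := hg i z
    exact ⟨(f.range.carrier i).mkQ y, rfl⟩
  · intro l hl
    have h1 := congrFun (hP' l hl.le)
    have h2 := congrFun (hP' (l + 1) hl)
    refine isomorphic_of_step _ _ (fun i => (f.range.carrier i).mkQ ∘ₗ θ l i) ?_ ?_ ?_ ?_
    · intro i x hx
      rw [h2] at hx
      exact (hQ' l hl.le i _).2 (hm.θ_mem l hl i x hx)
    · intro i x hx
      rw [h2] at hx
      rw [LinearMap.comp_apply, hQ' (l + 1) hl, h1]
      exact hm.θ_mem_iff l hl i x hx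
    · intro i q hq
      obtain ⟨y, rfl⟩ := (f.range.carrier i).mkQ_surjective q
      obtain ⟨x, hx, hxy⟩ := hm.θ_surj l hl i y ((hQ' l hl.le i y).1 hq)
      refine ⟨x, by rwa [h2], ?_⟩
      rwa [LinearMap.comp_apply, ← map_sub, hQ' (l + 1) hl]
    · intro i j d x hx
      rw [h2] at hx
      rw [LinearMap.comp_apply, LinearMap.comp_apply, SubRep.act_quotient, ← map_sub,
        hQ' (l + 1) hl]
      exact hm.θ_act l hl d x hx

end Filtrations

/-! ### Matching chains from adapted bases -/

section Bases

variable {I : Type*} [Quiver I] {v' v v'' : I → ℕ}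

/-- A matching chain in terms of bases adapted to the filtrations. -/
theorem MatchingChain.of_bases {R' : DoubleRep (Cn v')} {R : DoubleRep (Cn v)}
    {f : ∀ i, Cn v' i →ₗ[ℂ] Cn v i} {g : ∀ i, Cn v i →ₗ[ℂ] Cn v'' i}
    (hf : ∀ {i j : I} (d : DArrow i j) x, f j (R'.act d x) = R.act d (f i x))
    (e : ∀ i, Cn v' i ≃ₗ[ℂ] Cn v' i) (b : ∀ i, Cn v' i →ₗ[ℂ] Cn v i)
    (hb : ∀ i, Function.Injective (b i))
    (hbg : ∀ i, LinearMap.range (b i) = LinearMap.ker (g i))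
    (γ : ∀ i, Fin (v' i) → ℂ) (hfe : ∀ i u, f i (e i u) = b i (fun a => γ i a * u a))
    (x z : ∀ i j : I, DArrow i j → Matrix (Fin (v' j)) (Fin (v' i)) ℂ)
    (hx : ∀ {i j : I} (d : DArrow i j) u, R'.act d (e i u) = e j ((x i j d).mulVec u))
    (hz : ∀ {i j : I} (d : DArrow i j) u, R.act d (b i u) = b j ((z i j d).mulVec u))
    (lev : ∀ i, Fin (v' i) → ℕ) (k : ℕ)
    (hx0 : ∀ {i j : I} (d : DArrow i j) a c, lev i a < lev j c → x i j d c a = 0)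
    (hz0 : ∀ {i j : I} (d : DArrow i j) a c, lev j c < lev i a → z i j d c a = 0)
    (hγ0 : ∀ i a, γ i a = 0 → lev i a < k) (hγ1 : ∀ i a, γ i a ≠ 0 → lev i a = k)
    (μ : ℕ → ∀ i, Fin (v' i) → ℂ) (hμ0 : ∀ l i a, lev i a = l → μ l i a ≠ 0)
    (hμ1 : ∀ l i a, lev i a ≠ l → μ l i a = 0)
    (hxz : ∀ (l : ℕ) {i j : I} (d : DArrow i j) a c, lev i a = l → lev j c = l →
      z i j d c a * μ l i a = μ l j c * x i j d c a) :
    ∃ P Q θ, MatchingChain k R' R f g P Q θ := by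
  -- `P₀ l` is spanned by the coordinates of level below `l`, `Q₀ l` by those of level at least `l`.
  -- The isomorphism at step `l` is `m l`, which rescales the coordinates of level `l` and kills the
  -- others.
  let P₀ : ℕ → ∀ i, Submodule ℂ (Cn v' i) := fun l i =>
    { carrier := {u | ∀ a, l ≤ lev i a → u a = 0}
      add_mem' := fun hu hw a ha => by simp [hu a ha, hw a ha]
      zero_mem' := fun _ _ => rfl
      smul_mem' := fun c u hu a ha => by simp [hu a ha] }
  let Q₀ : ℕ → ∀ i, Submodule ℂ (Cn v' i) := fun l i =>
    { carrier := {u | ∀ a, lev i a < l → u a = 0}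
      add_mem' := fun hu hw a ha => by simp [hu a ha, hw a ha]
      zero_mem' := fun _ _ => rfl
      smul_mem' := fun c u hu a ha => by simp [hu a ha] }
  let m : ℕ → ∀ i, Cn v' i →ₗ[ℂ] Cn v' i := fun l i =>
    LinearMap.pi fun a => μ l i a • LinearMap.proj a
  have hm : ∀ l i u a, m l i u a = μ l i a * u a := fun l i u a => rfl
  have hle : ∀ i a, lev i a ≤ k := fun i a => by
    by_cases h : γ i a = 0
    · exact (hγ0 i a h).le
    · exact (hγ1 i a h).le
  have hmemP : ∀ l i y, y ∈ (P₀ l i).map (e i).toLinearMap ↔ (e i).symm y ∈ P₀ l i := by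
    intro l i y
    rw [Submodule.mem_map]
    constructor
    · rintro ⟨u, hu, rfl⟩
      simpa using hu
    · intro hu
      exact ⟨_, hu, by simp⟩
  have hmemQ : ∀ l i u, b i u ∈ (Q₀ l i).map (b i) ↔ u ∈ Q₀ l i := fun l i u =>
    (Function.Injective.mem_set_image (hb i) : _)
  have hxP : ∀ {i j : I} (d : DArrow i j) l, ∀ u ∈ P₀ l i, (x i j d).mulVec u ∈ P₀ l j := by
    intro i j d l u hu c hc
    change ∑ a, x i j d c a * u a = 0
    refine Finset.sum_eq_zero fun a _ => ?_
    by_cases ha : l ≤ lev i a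
    · rw [hu a ha, mul_zero]
    · rw [hx0 d a c (by omega), zero_mul]
  have hzQ : ∀ {i j : I} (d : DArrow i j) l, ∀ u ∈ Q₀ l i, (z i j d).mulVec u ∈ Q₀ l j := by
    intro i j d l u hu c hc
    change ∑ a, z i j d c a * u a = 0
    refine Finset.sum_eq_zero fun a _ => ?_
    by_cases ha : lev i a < l
    · rw [hu a ha, mul_zero]
    · rw [hz0 d a c (by omega), zero_mul]
  have hfe' : ∀ i y, f i y = b i (fun a => γ i a * (e i).symm y a) := fun i y => by
    rw [← hfe, LinearEquiv.apply_symm_apply]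
  refine ⟨fun l i => (P₀ l i).map (e i).toLinearMap, fun l i => (Q₀ l i).map (b i),
    fun l i => b i ∘ₗ m l i ∘ₗ (e i).symm.toLinearMap, ?_⟩
  have hθ : ∀ l i y, (b i ∘ₗ m l i ∘ₗ (e i).symm.toLinearMap) y = b i (m l i ((e i).symm y)) :=
    fun l i y => rfl
  exact
    { f_act := hf
      P_zero := fun i => by
        rw [Submodule.eq_bot_iff]
        intro y hy
        rw [hmemP] at hy
        rw [← (e i).symm.map_eq_zero_iff]
        exact funext fun a => hy a (Nat.zero_le _)
      P_last := fun i => by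
        ext y
        rw [hmemP, LinearMap.mem_ker, hfe', map_eq_zero_iff _ (hb i)]
        constructor
        · intro hy
          funext a
          by_cases ha : γ i a = 0
          · simp [ha]
          · simp [hy a (hγ1 i a ha).ge]
        · intro hy a ha
          have h1 : γ i a ≠ 0 := fun h => by have := hγ0 i a h; omega
          exact (mul_eq_zero.1 (congrFun hy a)).resolve_left h1
      Q_last := fun i => by
        ext y
        constructor
        · rintro ⟨u, hu, rfl⟩
          refine ⟨e i (fun a => (γ i a)⁻¹ * u a), ?_⟩
          rw [hfe]
          congr 1
          funext a
          by_cases ha : γ i a = 0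
          · simp [ha, hu a (hγ0 i a ha)]
          · rw [mul_inv_cancel_left₀ ha]
        · rintro ⟨y, rfl⟩
          rw [hfe', hmemQ]
          intro a ha
          have h1 : γ i a = 0 := by
            by_contra h
            have := hγ1 i a h
            omega
          change γ i a * _ = 0
          rw [h1, zero_mul]
      Q_zero := fun i => by
        rw [← hbg]
        ext y
        constructor
        · rintro ⟨u, -, rfl⟩
          exact ⟨u, rfl⟩
        · rintro ⟨u, rfl⟩
          exact ⟨u, fun a ha => absurd ha (Nat.not_lt_zero _), rfl⟩
      P_act := fun l _ i j d y hy => by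
        rw [hmemP] at hy ⊢
        have h1 := hx d ((e i).symm y)
        rw [LinearEquiv.apply_symm_apply] at h1
        rw [h1, LinearEquiv.symm_apply_apply]
        exact hxP d l _ hy
      Q_act := fun l _ i j d y hy => by
        obtain ⟨u, hu, rfl⟩ := hy
        rw [hz, hmemQ]
        exact hzQ d l u hu
      P_mono := fun l _ i => Submodule.map_mono fun u hu a ha => hu a (by omega)
      Q_anti := fun l _ i => Submodule.map_mono fun u hu a ha => hu a (by omega)
      θ_mem := fun l _ i y hy => by
        rw [hθ, hmemQ]
        intro a ha
        rw [hm, hμ1 l i a (by omega), zero_mul]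
      θ_mem_iff := fun l _ i y hy => by
        rw [hmemP] at hy
        rw [hθ, hmemQ, hmemP]
        constructor
        · intro h a ha
          rcases ha.lt_or_eq with h1 | h1
          · exact hy a h1
          · have h2 := h a (by omega)
            rw [hm] at h2
            exact (mul_eq_zero.1 h2).resolve_left (hμ0 l i a h1.symm)
        · intro h a ha
          rw [hm]
          by_cases h1 : lev i a = l
          · rw [h a (by omega), mul_zero]
          · rw [hμ1 l i a h1, zero_mul]
      θ_surj := fun l _ i y hy => by
        obtain ⟨u, hu, rfl⟩ := hy
        refine ⟨e i (fun a => if lev i a = l then (μ l i a)⁻¹ * u a else 0), ?_, ?_⟩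
        · rw [hmemP, LinearEquiv.symm_apply_apply]
          intro a ha
          exact if_neg (by omega)
        · rw [hθ, LinearEquiv.symm_apply_apply, ← map_sub, hmemQ]
          intro a ha
          rw [Pi.sub_apply, hm]
          by_cases h1 : lev i a = l
          · rw [if_pos h1, mul_inv_cancel_left₀ (hμ0 l i a h1), sub_self]
          · rw [if_neg h1, mul_zero, sub_zero]
            exact hu a (by omega)
      θ_act := fun l _ i j d y hy => by
        rw [hmemP] at hy
        have h1 := hx d ((e i).symm y)
        rw [LinearEquiv.apply_symm_apply] at h1
        rw [hθ, hθ, h1, LinearEquiv.symm_apply_apply, hz, ← map_sub, hmemQ]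
        intro c hc
        rw [Pi.sub_apply, hm, sub_eq_zero]
        change μ l j c * ∑ a, x i j d c a * _ = ∑ a, z i j d c a * (m l i _) a
        rw [Finset.mul_sum]
        refine Finset.sum_congr rfl fun a _ => ?_
        rw [hm]
        -- Levels above `l` are absent from `y`, lower ones are killed by `m l` and do not reach
        -- level `l` by triangularity of `x`. Within level `l` the relation `hxz` applies, and
        -- triangularity of `z` prevents descent below `l`.
        rcases lt_trichotomy (lev i a) l with h2 | h2 | h2
        · rw [hμ1 l i a h2.ne]
          rcases lt_or_eq_of_le (Nat.le_of_lt_succ hc) with h3 | h3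
          · rw [hμ1 l j c h3.ne]
            simp
          · rw [hx0 d a c (by omega)]
            simp
        · rcases lt_or_eq_of_le (Nat.le_of_lt_succ hc) with h3 | h3
          · rw [hμ1 l j c h3.ne, hz0 d a c (by omega)]
            simp
          · rw [← mul_assoc, ← mul_assoc, hxz l d a c h2 h3]
        · rw [hy a (by omega)]
          simp }

end Bases

/-! ### Singular values and their rates of decay along an ultrafilter -/

section SingularValues

open Matrix ComplexOrder in
/-- Singular value decomposition of an injective matrix. -/
theorem exists_singular_value_decomposition {m n : ℕ} (F : Matrix (Fin n) (Fin m) ℂ)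
    (hF : Function.Injective F.mulVec) :
    ∃ (E : Matrix (Fin m) (Fin m) ℂ) (B : Matrix (Fin n) (Fin m) ℂ) (c : Fin m → ℂ),
      Eᴴ * E = 1 ∧ Bᴴ * B = 1 ∧ (∀ a, c a ≠ 0) ∧ F * E = B * diagonal c := by
  -- `U` collects orthonormal eigenvectors of this positive definite matrix and `c` the square roots
  -- of its eigenvalues; then `F U c⁻¹` has orthonormal columns.
  have hpos : (Fᴴ * F).PosDef := PosDef.conjTranspose_mul_self F hF
  let hA := hpos.isHermitian
  let U : Matrix (Fin m) (Fin m) ℂ := hA.eigenvectorUnitary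
  have hU : Uᴴ * U = 1 := Unitary.coe_star_mul_self hA.eigenvectorUnitary
  have hspec : Uᴴ * (Fᴴ * F) * U = diagonal (fun a => ((hA.eigenvalues a : ℝ) : ℂ)) := by
    have h1 := hA.spectral_theorem
    rw [Unitary.conjStarAlgAut_apply] at h1
    have h2 : Fᴴ * F = U * diagonal (fun a => ((hA.eigenvalues a : ℝ) : ℂ)) * Uᴴ := h1
    calc Uᴴ * (Fᴴ * F) * U
        = Uᴴ * (U * diagonal (fun a => ((hA.eigenvalues a : ℝ) : ℂ)) * Uᴴ) * U :=
          congrArg (fun M => Uᴴ * M * U) h2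
      _ = (Uᴴ * U) * diagonal (fun a => ((hA.eigenvalues a : ℝ) : ℂ)) * (Uᴴ * U) := by
          simp only [Matrix.mul_assoc]
      _ = _ := by rw [hU, Matrix.one_mul, Matrix.mul_one]
  let c : Fin m → ℂ := fun a => ((Real.sqrt (hA.eigenvalues a) : ℝ) : ℂ)
  have hev : ∀ a, 0 < hA.eigenvalues a := fun a => hpos.eigenvalues_pos a
  have hc : ∀ a, c a ≠ 0 := fun a => by
    have := Real.sqrt_pos.2 (hev a)
    exact Complex.ofReal_ne_zero.2 this.ne'
  have hcc : ∀ a, ((hA.eigenvalues a : ℝ) : ℂ) = c a * c a := fun a => by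
    rw [← Complex.ofReal_mul, Real.mul_self_sqrt (hev a).le]
  have hstar : ∀ a, star (c a)⁻¹ = (c a)⁻¹ := fun a => by
    rw [star_inv₀]
    congr 1
    exact Complex.conj_ofReal _
  refine ⟨U, F * U * diagonal (fun a => (c a)⁻¹), c, hU, ?_, hc, ?_⟩
  · have : (F * U * diagonal (fun a => (c a)⁻¹))ᴴ * (F * U * diagonal (fun a => (c a)⁻¹)) =
        diagonal (fun a => (c a)⁻¹) * (Uᴴ * (Fᴴ * F) * U) * diagonal (fun a => (c a)⁻¹) := by
      rw [conjTranspose_mul, conjTranspose_mul, diagonal_conjTranspose]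
      rw [show star (fun a => (c a)⁻¹) = fun a => (c a)⁻¹ from funext hstar]
      simp only [Matrix.mul_assoc]
    rw [this, hspec, diagonal_mul_diagonal, diagonal_mul_diagonal, ← diagonal_one]
    congr 1
    funext a
    rw [hcc]
    field_simp [hc a]
  · rw [Matrix.mul_assoc, diagonal_mul_diagonal]
    have : (fun a => (c a)⁻¹ * c a) = fun _ => (1 : ℂ) := funext fun a => inv_mul_cancel₀ (hc a)
    rw [this, diagonal_one, Matrix.mul_one]

open Matrix ComplexOrder in
-- The columns are unit vectors.
theorem norm_entry_le_one {m n : ℕ} {B : Matrix (Fin n) (Fin m) ℂ} (hB : Bᴴ * B = 1) (r : Fin n)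
    (a : Fin m) : ‖B r a‖ ≤ 1 := by
  have h1 : ∑ r, ((‖B r a‖ ^ 2 : ℝ) : ℂ) = 1 := by
    have := congrFun (congrFun hB a) a
    rw [Matrix.mul_apply, Matrix.one_apply_eq] at this
    rw [← this]
    refine Finset.sum_congr rfl fun r _ => ?_
    rw [Matrix.conjTranspose_apply, Complex.ofReal_pow]
    exact (Complex.conj_mul' _).symm
  have h2 : ∑ r, ‖B r a‖ ^ 2 = 1 := by exact_mod_cast h1
  have h3 : ‖B r a‖ ^ 2 ≤ 1 := by
    rw [← h2]
    exact Finset.single_le_sum (f := fun r => ‖B r a‖ ^ 2) (fun _ _ => sq_nonneg _)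
      (Finset.mem_univ r)
  exact (sq_le_one_iff₀ (norm_nonneg _)).1 h3

variable {ι : Type*} (u : Ultrafilter ι)

/-- Closed discs are compact. Along an ultrafilter all bounded quantities converge at once, with no
passage to subsequences. -/
theorem exists_tendsto_of_norm_le {h : ι → ℂ} {C : ℝ} (hh : ∀ᶠ z in (u : Filter ι), ‖h z‖ ≤ C) :
    ∃ a, Tendsto h u (𝓝 a) := by
  have hc := isCompact_iff_ultrafilter_le_nhds'.1 (isCompact_closedBall (0 : ℂ) C) (u.map h) (by
    change ∀ᶠ z in (u : Filter ι), h z ∈ Metric.closedBall 0 C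
    filter_upwards [hh] with z hz
    simpa using hz)
  obtain ⟨a, -, ha⟩ := hc
  exact ⟨a, ha⟩

open Matrix ComplexOrder in
theorem exists_tendsto_matrix {m n : ℕ} {B : ι → Matrix (Fin n) (Fin m) ℂ}
    (hB : ∀ z, (B z)ᴴ * B z = 1) : ∃ B₀, Tendsto B u (𝓝 B₀) := by
  have h := fun r a => exists_tendsto_of_norm_le u (h := fun z => B z r a)
    (Eventually.of_forall fun z => norm_entry_le_one (hB z) r a)
  choose b hb using h
  exact ⟨b, tendsto_pi_nhds.2 fun r => tendsto_pi_nhds.2 fun a => hb r a⟩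

/-- Finitely many families of non-zero numbers, sorted by their order of growth along an
ultrafilter. -/
theorem exists_growth_levels {Λ : Type*} [Fintype Λ] (c : Λ → ι → ℂ) (hc : ∀ a z, c a z ≠ 0)
    (γ : Λ → ℂ) (hγ : ∀ a, Tendsto (c a) u (𝓝 (γ a))) :
    ∃ (lev : Λ → ℕ) (k : ℕ) (μ : ℕ → Λ → ℂ) (s : ℕ → ι → ℂ),
      (∀ a b, lev b < lev a → Tendsto (fun z => c b z / c a z) u (𝓝 0)) ∧
      (∀ a, γ a = 0 → lev a < k) ∧ (∀ a, γ a ≠ 0 → lev a = k) ∧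
      (∀ l a, lev a = l → μ l a ≠ 0 ∧ Tendsto (fun z => c a z / s l z) u (𝓝 (μ l a))) ∧
      ∀ l a, lev a ≠ l → μ l a = 0 := by
  classical
  let small : Λ → Λ → Prop := fun b a => Tendsto (fun z => c b z / c a z) u (𝓝 0)
  -- The ultrafilter decides which of the two reciprocal ratios is bounded by 1; its limit is zero
  -- or not.
  have htri : ∀ a b, small b a ∨ small a b ∨
      ∃ ρ, ρ ≠ 0 ∧ Tendsto (fun z => c b z / c a z) u (𝓝 ρ) := by
    intro a b
    have hor : (∀ᶠ z in (u : Filter ι), ‖c b z / c a z‖ ≤ 1) ∨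
        ∀ᶠ z in (u : Filter ι), ‖c a z / c b z‖ ≤ 1 := by
      rw [← Ultrafilter.eventually_or]
      refine Eventually.of_forall fun z => ?_
      rw [norm_div, norm_div, div_le_one (norm_pos_iff.2 (hc a z)),
        div_le_one (norm_pos_iff.2 (hc b z))]
      exact le_total _ _
    rcases hor with h | h
    · obtain ⟨ρ, hρ⟩ := exists_tendsto_of_norm_le u h
      by_cases h0 : ρ = 0
      · subst h0
        exact Or.inl hρ
      · exact Or.inr (Or.inr ⟨ρ, h0, hρ⟩)
    · obtain ⟨ρ, hρ⟩ := exists_tendsto_of_norm_le u h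
      by_cases h0 : ρ = 0
      · subst h0
        exact Or.inr (Or.inl hρ)
      · refine Or.inr (Or.inr ⟨ρ⁻¹, inv_ne_zero h0, ?_⟩)
        simpa using hρ.inv₀ h0
  have htrans : ∀ {a b d : Λ} {ρ : ℂ}, small d b →
      Tendsto (fun z => c b z / c a z) u (𝓝 ρ) → small d a := by
    intro a b d ρ h1 h2
    have h3 := h1.mul h2
    rw [zero_mul] at h3
    exact h3.congr fun z => div_mul_div_cancel₀ (hc b z)
  have hirr : ∀ a, ¬ small a a := by
    intro a h
    have h1 : (fun z => c a z / c a z) = fun _ => (1 : ℂ) := funext fun z => div_self (hc a z)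
    change Tendsto (fun z => c a z / c a z) u (𝓝 0) at h
    rw [h1] at h
    exact one_ne_zero (tendsto_nhds_unique tendsto_const_nhds h)
  -- Counting the families of strictly smaller order turns the comparison of orders into a numerical
  -- level.
  let lev : Λ → ℕ := fun a => (Finset.univ.filter fun b => small b a).card
  have hlt : ∀ {a b}, small b a → lev b < lev a := by
    intro a b h
    refine Finset.card_lt_card (Finset.ssubset_iff_subset_ne.2 ⟨fun d hd => ?_, fun heq => ?_⟩)
    · simp only [Finset.mem_filter, Finset.mem_univ, true_and] at hd ⊢
      exact htrans hd h
    · have : b ∈ Finset.univ.filter fun d => small d b := by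
        rw [heq]
        simpa using h
      exact hirr b (by simpa using this)
  have hle : ∀ {a b ρ}, Tendsto (fun z => c b z / c a z) u (𝓝 ρ) → lev b ≤ lev a := by
    intro a b ρ h
    refine Finset.card_le_card fun d hd => ?_
    simp only [Finset.mem_filter, Finset.mem_univ, true_and] at hd ⊢
    exact htrans hd h
  have hsmall : ∀ a b, lev b < lev a → small b a := by
    intro a b h
    rcases htri a b with h1 | h1 | ⟨ρ, h0, h1⟩
    · exact h1
    · exact absurd (hlt h1) h.not_gt
    · have h2 := h1.inv₀ h0
      simp only [inv_div] at h2
      exact absurd (hle h2) h.not_ge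
  have heqv : ∀ a b, lev b = lev a → ∃ ρ, ρ ≠ 0 ∧ Tendsto (fun z => c b z / c a z) u (𝓝 ρ) := by
    intro a b h
    rcases htri a b with h1 | h1 | h1
    · exact absurd (hlt h1) h.not_lt
    · exact absurd (hlt h1) h.not_gt
    · exact h1
  have hγsmall : ∀ a b, small b a → γ b = 0 := by
    intro a b h
    have h1 := h.mul (hγ a)
    rw [zero_mul] at h1
    exact tendsto_nhds_unique (hγ b) (h1.congr fun z => div_mul_cancel₀ _ (hc a z))
  -- Any family of level `l` serves as the common scale of that level.
  have hμ : ∀ l, ∃ (s : ι → ℂ) (μ : Λ → ℂ), (∀ a, lev a = l → μ a ≠ 0 ∧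
      Tendsto (fun z => c a z / s z) u (𝓝 (μ a))) ∧ ∀ a, lev a ≠ l → μ a = 0 := by
    intro l
    by_cases hl : ∃ a, lev a = l
    · obtain ⟨a₀, rfl⟩ := hl
      have h1 : ∀ a, ∃ μ : ℂ, (lev a = lev a₀ → μ ≠ 0 ∧
          Tendsto (fun z => c a z / c a₀ z) u (𝓝 μ)) ∧ (lev a ≠ lev a₀ → μ = 0) := by
        intro a
        by_cases h : lev a = lev a₀
        · obtain ⟨ρ, hρ⟩ := heqv a₀ a h
          exact ⟨ρ, fun _ => hρ, fun h' => absurd h h'⟩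
        · exact ⟨0, fun h' => absurd h' h, fun _ => rfl⟩
      choose μ hμ using h1
      exact ⟨c a₀, μ, fun a => (hμ a).1, fun a => (hμ a).2⟩
    · exact ⟨fun _ => 0, fun _ => 0, fun a ha => absurd ⟨a, ha⟩ hl, fun _ _ => rfl⟩
  choose s μ hμ using hμ
  -- The families of strictly smaller order than one with non-zero limit are exactly those tending
  -- to 0; their number is the top level `k`.
  refine ⟨lev, (Finset.univ.filter fun b => γ b = 0).card, μ, s, hsmall, fun a ha => ?_,
    fun a ha => ?_, fun l => (hμ l).1, fun l => (hμ l).2⟩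
  · refine Finset.card_lt_card (Finset.ssubset_iff_subset_ne.2 ⟨fun d hd => ?_, fun heq => ?_⟩)
    · simp only [Finset.mem_filter, Finset.mem_univ, true_and] at hd ⊢
      exact hγsmall a d hd
    · have : a ∈ Finset.univ.filter fun d => small d a := by
        rw [heq]
        simpa using ha
      exact hirr a (by simpa using this)
  · refine congrArg Finset.card (Finset.filter_congr fun b _ => ⟨hγsmall a b, fun hb => ?_⟩)
    have h1 := (hγ b).div (hγ a) ha
    rwa [hb, zero_div] at h1

end SingularValues

/-! ### Limits of matrix operations -/

section MatrixLimits

variable {ι : Type*} {l : Filter ι} {m n p : ℕ}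

theorem tendsto_matrix_mul {A : ι → Matrix (Fin m) (Fin n) ℂ} {A₀ : Matrix (Fin m) (Fin n) ℂ}
    {B : ι → Matrix (Fin n) (Fin p) ℂ} {B₀ : Matrix (Fin n) (Fin p) ℂ}
    (hA : Tendsto A l (𝓝 A₀)) (hB : Tendsto B l (𝓝 B₀)) :
    Tendsto (fun z => A z * B z) l (𝓝 (A₀ * B₀)) := by
  refine tendsto_pi_nhds.2 fun r => tendsto_pi_nhds.2 fun a => ?_
  simp only [Matrix.mul_apply]
  exact tendsto_finsetSum _ fun j _ =>
    (tendsto_pi_nhds.1 (tendsto_pi_nhds.1 hA r) j).mul (tendsto_pi_nhds.1 (tendsto_pi_nhds.1 hB j) a)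

open Matrix in
theorem tendsto_matrix_conjTranspose {A : ι → Matrix (Fin m) (Fin n) ℂ}
    {A₀ : Matrix (Fin m) (Fin n) ℂ} (hA : Tendsto A l (𝓝 A₀)) :
    Tendsto (fun z => (A z)ᴴ) l (𝓝 A₀ᴴ) :=
  ((continuous_id.matrix_conjTranspose
    (A := fun q : Matrix (Fin m) (Fin n) ℂ => q)).tendsto A₀).comp hA

theorem tendsto_matrix_entry {A : ι → Matrix (Fin m) (Fin n) ℂ}
    {A₀ : Matrix (Fin m) (Fin n) ℂ} (hA : Tendsto A l (𝓝 A₀)) (r : Fin m) (a : Fin n) :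
    Tendsto (fun z => A z r a) l (𝓝 (A₀ r a)) :=
  tendsto_pi_nhds.1 (tendsto_pi_nhds.1 hA r) a

theorem tendsto_toMatrix {L : ι → (Fin n → ℂ) →ₗ[ℂ] (Fin m → ℂ)}
    {L₀ : (Fin n → ℂ) →ₗ[ℂ] (Fin m → ℂ)} (hL : ∀ x, Tendsto (fun z => L z x) l (𝓝 (L₀ x))) :
    Tendsto (fun z => LinearMap.toMatrix' (L z)) l (𝓝 (LinearMap.toMatrix' L₀)) := by
  refine tendsto_pi_nhds.2 fun r => tendsto_pi_nhds.2 fun a => ?_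
  simp only [LinearMap.toMatrix'_apply]
  exact tendsto_pi_nhds.1 (hL _) r

end MatrixLimits

/-! ### Matching chains as limits of short exact sequences -/

section Closure

variable {I : Type*} [Quiver I] {v' v v'' : I → ℕ}

open Matrix in
/-- A limit of short exact sequences carries matching filtrations. -/
theorem exists_matchingChain_of_ultrafilter [Fintype I] (hv : v' + v'' = v) {ι : Type*}
    (u : Ultrafilter ι)
    {R' : ι → DoubleRep (Cn v')} {R : ι → DoubleRep (Cn v)} {f : ι → ∀ i, Cn v' i →ₗ[ℂ] Cn v i}
    {g : ι → ∀ i, Cn v i →ₗ[ℂ] Cn v'' i} {R₀' : DoubleRep (Cn v')} {R₀ : DoubleRep (Cn v)}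
    {f₀ : ∀ i, Cn v' i →ₗ[ℂ] Cn v i} {g₀ : ∀ i, Cn v i →ₗ[ℂ] Cn v'' i}
    (hf : ∀ n i, Function.Injective (f n i)) (hgf : ∀ n i x, g n i (f n i x) = 0)
    (hact : ∀ n {i j : I} (d : DArrow i j) x, f n j ((R' n).act d x) = (R n).act d (f n i x))
    (hact₀ : ∀ {i j : I} (d : DArrow i j) x, f₀ j (R₀'.act d x) = R₀.act d (f₀ i x))
    (hR' : ∀ {i j : I} (d : DArrow i j) x,
      Tendsto (fun n => (R' n).act d x) u (𝓝 (R₀'.act d x)))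
    (hR : ∀ {i j : I} (d : DArrow i j) x, Tendsto (fun n => (R n).act d x) u (𝓝 (R₀.act d x)))
    (hf₀ : ∀ i x, Tendsto (fun n => f n i x) u (𝓝 (f₀ i x)))
    (hg₀ : ∀ i x, Tendsto (fun n => g n i x) u (𝓝 (g₀ i x)))
    (hsurj : ∀ i, Function.Surjective (g₀ i)) :
    ∃ k P Q θ, MatchingChain k R₀' R₀ f₀ g₀ P Q θ := by
  -- The orthonormal bases `E` and `B` range over bounded sets and converge along the ultrafilter;
  -- only the singular values record the degeneration of `f`.
  have hsvd := fun n i => exists_singular_value_decomposition (LinearMap.toMatrix' (f n i)) (by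
    intro x y hxy
    rw [LinearMap.toMatrix'_mulVec, LinearMap.toMatrix'_mulVec] at hxy
    exact hf n i hxy)
  choose E B c hE hB hc hFE using hsvd
  have hE₀ := fun i => exists_tendsto_matrix u fun n => hE n i
  have hB₀ := fun i => exists_tendsto_matrix u fun n => hB n i
  choose E₀ hE₀ using hE₀
  choose B₀ hB₀ using hB₀
  have hEE : ∀ i, (E₀ i)ᴴ * E₀ i = 1 := fun i =>
    tendsto_nhds_unique (tendsto_matrix_mul (tendsto_matrix_conjTranspose (hE₀ i)) (hE₀ i))
      (by simp only [hE]; exact tendsto_const_nhds)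
  have hBB : ∀ i, (B₀ i)ᴴ * B₀ i = 1 := fun i =>
    tendsto_nhds_unique (tendsto_matrix_mul (tendsto_matrix_conjTranspose (hB₀ i)) (hB₀ i))
      (by simp only [hB]; exact tendsto_const_nhds)
  have hEE' : ∀ i, E₀ i * (E₀ i)ᴴ = 1 := fun i => mul_eq_one_comm.1 (hEE i)
  have hF : ∀ i, Tendsto (fun n => LinearMap.toMatrix' (f n i)) u
      (𝓝 (LinearMap.toMatrix' (f₀ i))) := fun i => tendsto_toMatrix (hf₀ i)
  have hcdiag : ∀ n i, (B n i)ᴴ * (LinearMap.toMatrix' (f n i) * E n i) = diagonal (c n i) := by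
    intro n i
    rw [hFE, ← Matrix.mul_assoc, hB, Matrix.one_mul]
  let D : ∀ i, Matrix (Fin (v' i)) (Fin (v' i)) ℂ := fun i =>
    (B₀ i)ᴴ * (LinearMap.toMatrix' (f₀ i) * E₀ i)
  have hD : ∀ i, Tendsto (fun n => diagonal (c n i)) u (𝓝 (D i)) := fun i => by
    simp only [← hcdiag]
    exact tendsto_matrix_mul (tendsto_matrix_conjTranspose (hB₀ i))
      (tendsto_matrix_mul (hF i) (hE₀ i))
  let γ : ∀ i, Fin (v' i) → ℂ := fun i a => D i a a
  have hγ : ∀ i a, Tendsto (fun n => c n i a) u (𝓝 (γ i a)) := fun i a => by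
    have := tendsto_matrix_entry (hD i) a a
    simpa only [diagonal_apply_eq] using this
  have hFE₀ : ∀ i, LinearMap.toMatrix' (f₀ i) * E₀ i = B₀ i * diagonal (γ i) := by
    intro i
    have h2 : Tendsto (fun n => diagonal (c n i)) u (𝓝 (diagonal (γ i))) := by
      refine tendsto_pi_nhds.2 fun r => tendsto_pi_nhds.2 fun a => ?_
      by_cases h : r = a
      · subst h
        simpa only [diagonal_apply_eq] using hγ i r
      · simp only [diagonal_apply_ne _ h]
        exact tendsto_const_nhds
    have h1 : diagonal (γ i) = D i := tendsto_nhds_unique h2 (hD i)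
    rw [h1]
    refine tendsto_nhds_unique (tendsto_matrix_mul (hF i) (hE₀ i)) ?_
    simp only [hFE]
    exact tendsto_matrix_mul (hB₀ i) (hD i)
  have hcancel : ∀ {m} n i (M N : Matrix (Fin m) (Fin (v' i)) ℂ),
      M * diagonal (c n i) = N * diagonal (c n i) → M = N := by
    intro m n i M N h
    ext r a
    have := congrFun (congrFun h r) a
    rw [mul_diagonal, mul_diagonal] at this
    exact mul_right_cancel₀ (hc n i a) this
  -- `x` and `z` are the matrices of the arrows on `V'` and on the range of `f` in the singular
  -- bases. Equivariance of `f` becomes `z c = c x`, and both converge.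
  let x : ι → ∀ i j : I, DArrow i j → Matrix (Fin (v' j)) (Fin (v' i)) ℂ := fun n i j d =>
    (E n j)ᴴ * (LinearMap.toMatrix' ((R' n).act d) * E n i)
  let z : ι → ∀ i j : I, DArrow i j → Matrix (Fin (v' j)) (Fin (v' i)) ℂ := fun n i j d =>
    (B n j)ᴴ * (LinearMap.toMatrix' ((R n).act d) * B n i)
  let x₀ : ∀ i j : I, DArrow i j → Matrix (Fin (v' j)) (Fin (v' i)) ℂ := fun i j d =>
    (E₀ j)ᴴ * (LinearMap.toMatrix' (R₀'.act d) * E₀ i)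
  let z₀ : ∀ i j : I, DArrow i j → Matrix (Fin (v' j)) (Fin (v' i)) ℂ := fun i j d =>
    (B₀ j)ᴴ * (LinearMap.toMatrix' (R₀.act d) * B₀ i)
  have hx : ∀ {i j : I} (d : DArrow i j), Tendsto (fun n => x n i j d) u (𝓝 (x₀ i j d)) :=
    fun d => tendsto_matrix_mul (tendsto_matrix_conjTranspose (hE₀ _))
      (tendsto_matrix_mul (tendsto_toMatrix (hR' d)) (hE₀ _))
  have hz : ∀ {i j : I} (d : DArrow i j), Tendsto (fun n => z n i j d) u (𝓝 (z₀ i j d)) :=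
    fun d => tendsto_matrix_mul (tendsto_matrix_conjTranspose (hB₀ _))
      (tendsto_matrix_mul (tendsto_toMatrix (hR d)) (hB₀ _))
  have hxE : ∀ {i j : I} (d : DArrow i j),
      LinearMap.toMatrix' (R₀'.act d) * E₀ i = E₀ j * x₀ i j d := fun d => by
    rw [← Matrix.mul_assoc, hEE', Matrix.one_mul]
  have hxEn : ∀ n {i j : I} (d : DArrow i j),
      LinearMap.toMatrix' ((R' n).act d) * E n i = E n j * x n i j d := fun n _ _ d => by
    rw [← Matrix.mul_assoc, mul_eq_one_comm.1 (hE n _), Matrix.one_mul]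
  have hRB : ∀ n {i j : I} (d : DArrow i j), LinearMap.toMatrix' ((R n).act d) * B n i *
      diagonal (c n i) = B n j * (diagonal (c n j) * x n i j d) := by
    intro n i j d
    have h1 : LinearMap.toMatrix' ((R n).act d) * LinearMap.toMatrix' (f n i) =
        LinearMap.toMatrix' (f n j) * LinearMap.toMatrix' ((R' n).act d) := by
      rw [← LinearMap.toMatrix'_comp, ← LinearMap.toMatrix'_comp]
      exact congrArg _ (LinearMap.ext fun y => (hact n d y).symm)
    rw [Matrix.mul_assoc, ← hFE, ← Matrix.mul_assoc, h1, Matrix.mul_assoc, hxEn,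
      ← Matrix.mul_assoc, hFE, Matrix.mul_assoc]
  have hzx : ∀ n {i j : I} (d : DArrow i j),
      z n i j d * diagonal (c n i) = diagonal (c n j) * x n i j d := by
    intro n i j d
    change (B n j)ᴴ * (_ * B n i) * _ = _
    rw [Matrix.mul_assoc, hRB, ← Matrix.mul_assoc, hB, Matrix.one_mul]
  -- For each `n` the range of `B n` is that of `f n`, hence invariant. Invariance survives in the
  -- limit, although the range of `f₀` may be smaller.
  have hzB : ∀ {i j : I} (d : DArrow i j),
      LinearMap.toMatrix' (R₀.act d) * B₀ i = B₀ j * z₀ i j d := by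
    intro i j d
    refine tendsto_nhds_unique (tendsto_matrix_mul (tendsto_toMatrix (hR d)) (hB₀ i)) ?_
    have h1 : ∀ n, LinearMap.toMatrix' ((R n).act d) * B n i = B n j * z n i j d := fun n => by
      refine hcancel n i _ _ ?_
      rw [hRB, Matrix.mul_assoc, hzx]
    simp only [h1]
    exact tendsto_matrix_mul (hB₀ j) (hz d)
  have hgB : ∀ i, LinearMap.toMatrix' (g₀ i) * B₀ i = 0 := by
    intro i
    refine tendsto_nhds_unique (tendsto_matrix_mul (tendsto_toMatrix (hg₀ i)) (hB₀ i)) ?_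
    have h1 : ∀ n, LinearMap.toMatrix' (g n i) * B n i = 0 := fun n => by
      refine hcancel n i _ _ ?_
      rw [Matrix.mul_assoc, ← hFE, ← Matrix.mul_assoc, ← LinearMap.toMatrix'_comp,
        show g n i ∘ₗ f n i = 0 from LinearMap.ext (hgf n i)]
      simp
    simp only [h1]
    exact tendsto_const_nhds
  have hentry : ∀ n {i j : I} (d : DArrow i j) a b,
      z n i j d b a * c n i a = c n j b * x n i j d b a := fun n i j d a b => by
    have := congrFun (congrFun (hzx n d) b) a
    rwa [mul_diagonal, diagonal_mul] at this
  -- The singular values of all vertices are sorted together, as arrows compare different vertices.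
  obtain ⟨lev, k, μ, s, hlev, hlev0, hlev1, hμ, hμ0⟩ := exists_growth_levels u
    (fun (q : Σ i, Fin (v' i)) n => c n q.1 q.2) (fun q n => hc n q.1 q.2)
    (fun q => γ q.1 q.2) (fun q => hγ q.1 q.2)
  let e : ∀ i, Cn v' i ≃ₗ[ℂ] Cn v' i := fun i => Matrix.toLin'OfInv (hEE i) (hEE' i)
  have he : ∀ i y, e i y = (E₀ i).mulVec y := fun i y => toLin'_apply _ _
  have hBinj : ∀ i, Function.Injective (Matrix.toLin' (B₀ i)) := fun i => by
    refine Function.LeftInverse.injective (g := (B₀ i)ᴴ.mulVec) fun y => ?_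
    rw [toLin'_apply, mulVec_mulVec, hBB, one_mulVec]
  refine ⟨k, MatchingChain.of_bases hact₀ e (fun i => Matrix.toLin' (B₀ i)) hBinj
    (fun i => ?_) γ (fun i y => ?_) x₀ z₀ (fun d y => ?_) (fun d y => ?_)
    (fun i a => lev ⟨i, a⟩) k (fun {i j} d a b hab => ?_) (fun {i j} d a b hab => ?_)
    (fun i a => hlev0 ⟨i, a⟩) (fun i a => hlev1 ⟨i, a⟩) (fun l i a => μ l ⟨i, a⟩)
    (fun l i a h => (hμ l ⟨i, a⟩ h).1) (fun l i a => hμ0 l ⟨i, a⟩)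
    (fun l i j d a b ha hb => ?_)⟩
  -- The inclusion passes to the limit; equality follows by dimension because `g₀` is surjective.
  · refine range_eq_ker_of_dim hv hBinj hsurj (fun i y => ?_) i
    rw [toLin'_apply, ← LinearMap.toMatrix'_mulVec, mulVec_mulVec, hgB, zero_mulVec]
  · rw [he, toLin'_apply, ← LinearMap.toMatrix'_mulVec, mulVec_mulVec, hFE₀, ← mulVec_mulVec]
    congr 1
    funext a
    exact mulVec_diagonal _ _ _
  · rw [he, he, ← LinearMap.toMatrix'_mulVec, mulVec_mulVec, mulVec_mulVec, hxE]
  · rw [toLin'_apply, toLin'_apply, ← LinearMap.toMatrix'_mulVec, mulVec_mulVec, mulVec_mulVec,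
      hzB]
  -- In this and the next two cases, `z c = c x` reads entrywise `z_ba c_a = c_b x_ba`: a convergent
  -- entry times a ratio tending to 0 gives triangularity, and equal levels give conjugate blocks.
  · have h1 := (tendsto_matrix_entry (hz d) b a).mul (hlev ⟨j, b⟩ ⟨i, a⟩ hab)
    rw [mul_zero] at h1
    refine tendsto_nhds_unique ((tendsto_matrix_entry (hx d) b a)) (h1.congr fun n => ?_)
    rw [← mul_div_assoc, hentry, mul_div_cancel_left₀ _ (hc n j b)]
  · have h1 := (hlev ⟨i, a⟩ ⟨j, b⟩ hab).mul (tendsto_matrix_entry (hx d) b a)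
    rw [zero_mul] at h1
    refine tendsto_nhds_unique ((tendsto_matrix_entry (hz d) b a)) (h1.congr fun n => ?_)
    rw [div_mul_eq_mul_div, ← hentry, mul_div_cancel_right₀ _ (hc n i a)]
  · have h1 := (tendsto_matrix_entry (hz d) b a).mul (hμ l ⟨i, a⟩ ha).2
    have h2 := (hμ l ⟨j, b⟩ hb).2.mul (tendsto_matrix_entry (hx d) b a)
    refine tendsto_nhds_unique h1 (h2.congr fun n => ?_)
    rw [div_mul_eq_mul_div, ← hentry, mul_div_assoc]

/-- The linear maps constituting a complex `V' → V → V''` of double quiver representations, with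
the topology of pointwise convergence. -/
abbrev ComplexData (v' v v'' : I → ℕ) : Type _ :=
  (∀ i j : I, DArrow i j → Cn v' i → Cn v' j) × (∀ i j : I, DArrow i j → Cn v i → Cn v j) ×
    (∀ i : I, Cn v' i → Cn v i) × ∀ i : I, Cn v i → Cn v'' i

/-- The data of a complex as a point of the space of all data. -/
def complexData (R' : DoubleRep (Cn v')) (R : DoubleRep (Cn v)) (f : ∀ i, Cn v' i →ₗ[ℂ] Cn v i)
    (g : ∀ i, Cn v i →ₗ[ℂ] Cn v'' i) : ComplexData v' v v'' :=
  (fun _ _ d x => R'.act d x, fun _ _ d x => R.act d x, fun i x => f i x, fun i x => g i x)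

theorem tendsto_complexData {ι : Type*} {l : Filter ι}
    {R' : ι → DoubleRep (Cn v')} {R : ι → DoubleRep (Cn v)} {f : ι → ∀ i, Cn v' i →ₗ[ℂ] Cn v i}
    {g : ι → ∀ i, Cn v i →ₗ[ℂ] Cn v'' i} {R₀' : DoubleRep (Cn v')} {R₀ : DoubleRep (Cn v)}
    {f₀ : ∀ i, Cn v' i →ₗ[ℂ] Cn v i} {g₀ : ∀ i, Cn v i →ₗ[ℂ] Cn v'' i} :
    Tendsto (fun n => complexData (R' n) (R n) (f n) (g n)) l
        (𝓝 (complexData R₀' R₀ f₀ g₀)) ↔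
      (∀ (i j : I) (d : DArrow i j) x, Tendsto (fun n => (R' n).act d x) l (𝓝 (R₀'.act d x))) ∧
      (∀ (i j : I) (d : DArrow i j) x, Tendsto (fun n => (R n).act d x) l (𝓝 (R₀.act d x))) ∧
      (∀ i x, Tendsto (fun n => f n i x) l (𝓝 (f₀ i x))) ∧
      ∀ i x, Tendsto (fun n => g n i x) l (𝓝 (g₀ i x)) := by
  simp only [complexData, Prod.tendsto_iff, tendsto_pi_nhds]

/-- The data of short exact sequences. -/
def exactData (v' v v'' : I → ℕ) : Set (ComplexData v' v v'') :=
  {z | ∃ R' R f g P Q θ, z = complexData R' R f g ∧ MatchingChain 0 R' R f g P Q θ}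

/-- Each deformation shortens the chain by one and tends back to it as `s → 0`; chains of length 0
are exact sequences. The moment equation and stability play no role, so the deformation need not
respect them. -/
theorem MatchingChain.mem_closure {k : ℕ} {R' : DoubleRep (Cn v')} {R : DoubleRep (Cn v)}
    {f : ∀ i, Cn v' i →ₗ[ℂ] Cn v i} {g : ∀ i, Cn v i →ₗ[ℂ] Cn v'' i}
    {P : ℕ → ∀ i, Submodule ℂ (Cn v' i)} {Q : ℕ → ∀ i, Submodule ℂ (Cn v i)}
    {θ : ℕ → ∀ i, Cn v' i →ₗ[ℂ] Cn v i} (h : MatchingChain k R' R f g P Q θ) :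
    complexData R' R f g ∈ closure (exactData v' v v'') := by
  induction k generalizing R' R f with
  | zero => exact subset_closure ⟨R', R, f, g, P, Q, θ, rfl, h⟩
  | succ k ih =>
    obtain ⟨η, ν, T, hdef⟩ := h.exists_deformation
    have hlim : Tendsto (fun s : ℂ => complexData
        (DoubleRep.ofAct fun i j d => R'.act d + s • η i j d)
        (DoubleRep.ofAct fun i j d => R.act d + s • ν i j d) (fun i => f i + s • T i) g)
        (𝓝[≠] 0) (𝓝 (complexData R' R f g)) := by
      have h0 : ∀ {n : ℕ} (a b : Fin n → ℂ), Tendsto (fun s : ℂ => a + s • b) (𝓝[≠] 0) (𝓝 a) := by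
        intro n a b
        have h1 : Continuous fun s : ℂ => a + s • b := by fun_prop
        have h2 := h1.tendsto 0
        rw [zero_smul, add_zero] at h2
        exact h2.mono_left nhdsWithin_le_nhds
      refine tendsto_complexData.2 ⟨fun i j d x => ?_, fun i j d x => ?_, fun i x => h0 _ _,
        fun i x => tendsto_const_nhds⟩
      · simp only [DoubleRep.act_ofAct]
        exact h0 _ _
      · simp only [DoubleRep.act_ofAct]
        exact h0 _ _
    exact isClosed_closure.mem_of_tendsto hlim
      (eventually_mem_nhdsWithin.mono fun s hs => ih (hdef s hs))

/-- The existence of matching filtrations is a closed condition. -/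
theorem exists_matchingChain_of_tendsto [Fintype I] (hv : v' + v'' = v) {ι : Type*} {l : Filter ι}
    [l.NeBot]
    {R' : ι → DoubleRep (Cn v')} {R : ι → DoubleRep (Cn v)} {f : ι → ∀ i, Cn v' i →ₗ[ℂ] Cn v i}
    {g : ι → ∀ i, Cn v i →ₗ[ℂ] Cn v'' i} {R₀' : DoubleRep (Cn v')} {R₀ : DoubleRep (Cn v)}
    {f₀ : ∀ i, Cn v' i →ₗ[ℂ] Cn v i} {g₀ : ∀ i, Cn v i →ₗ[ℂ] Cn v'' i}
    (hR' : ∀ (i j : I) (d : DArrow i j) x,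
      Tendsto (fun n => (R' n).act d x) l (𝓝 (R₀'.act d x)))
    (hR : ∀ (i j : I) (d : DArrow i j) x, Tendsto (fun n => (R n).act d x) l (𝓝 (R₀.act d x)))
    (hf₀ : ∀ i x, Tendsto (fun n => f n i x) l (𝓝 (f₀ i x)))
    (hg₀ : ∀ i x, Tendsto (fun n => g n i x) l (𝓝 (g₀ i x)))
    (hact₀ : ∀ {i j : I} (d : DArrow i j) x, f₀ j (R₀'.act d x) = R₀.act d (f₀ i x))
    (hsurj : ∀ i, Function.Surjective (g₀ i))
    (h : ∀ᶠ n in l, ∃ k P Q θ, MatchingChain k (R' n) (R n) (f n) (g n) P Q θ) :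
    ∃ k P Q θ, MatchingChain k R₀' R₀ f₀ g₀ P Q θ := by
  have hmem : complexData R₀' R₀ f₀ g₀ ∈ closure (exactData v' v v'') :=
    isClosed_closure.mem_of_tendsto (tendsto_complexData.2 ⟨hR', hR, hf₀, hg₀⟩)
      (h.mono fun n ⟨k, P, Q, θ, hn⟩ => hn.mem_closure)
  rw [mem_closure_iff_comap_neBot] at hmem
  -- The given family is traded for short exact sequences with the same limit, refined to an
  -- ultrafilter.
  let u : Ultrafilter (exactData v' v v'') :=
    Ultrafilter.of (comap Subtype.val (𝓝 (complexData R₀' R₀ f₀ g₀)))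
  have hu : Tendsto (fun q : exactData v' v v'' => q.1) u (𝓝 (complexData R₀' R₀ f₀ g₀)) :=
    tendsto_comap.mono_left (Ultrafilter.of_le _)
  choose S' S φ ψ P Q θ hz hm using fun q : exactData v' v v'' => q.2
  simp only [hz] at hu
  obtain ⟨h1, h2, h3, h4⟩ := tendsto_complexData.1 hu
  refine exists_matchingChain_of_ultrafilter hv u (R' := S') (R := S) (f := φ) (g := ψ)
    (fun q i => ?_) (fun q i x => ?_) (fun q => (hm q).f_act) hact₀ (fun d => h1 _ _ d)
    (fun d => h2 _ _ d) h3 h4 hsurj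
  · rw [← LinearMap.ker_eq_bot, ← (hm q).P_last, (hm q).P_zero]
  · have : φ q i x ∈ Q q 0 i := by
      rw [(hm q).Q_last]
      exact ⟨x, rfl⟩
    rwa [(hm q).Q_zero] at this

end Closure

/-! ### Transport of matching chains through a common cokernel -/

section Transfer

variable {I : Type*} [Quiver I] {V V' V'' U U' U'' C : I → Type*}
  [∀ i, AddCommGroup (V i)] [∀ i, Module ℂ (V i)]
  [∀ i, AddCommGroup (V' i)] [∀ i, Module ℂ (V' i)]
  [∀ i, AddCommGroup (V'' i)] [∀ i, Module ℂ (V'' i)]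
  [∀ i, AddCommGroup (U i)] [∀ i, Module ℂ (U i)]
  [∀ i, AddCommGroup (U' i)] [∀ i, Module ℂ (U' i)]
  [∀ i, AddCommGroup (U'' i)] [∀ i, Module ℂ (U'' i)]
  [∀ i, AddCommGroup (C i)] [∀ i, Module ℂ (C i)]

/-- The projection onto a quotient representation. -/
def SubRep.proj {R : DoubleRep V} (K : SubRep R) : Hom R K.quotient :=
  Hom.ofAct (fun i => (K.carrier i).mkQ) fun _ _ d x => (K.act_quotient d x).symm

/-- A matching chain only depends on the source and on the cokernel of `f`. -/
theorem MatchingChain.transfer {k : ℕ} {R' : DoubleRep V'} {R : DoubleRep V}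
    {f : ∀ i, V' i →ₗ[ℂ] V i} {g : ∀ i, V i →ₗ[ℂ] V'' i} {P : ℕ → ∀ i, Submodule ℂ (V' i)}
    {Q : ℕ → ∀ i, Submodule ℂ (V i)} {θ : ℕ → ∀ i, V' i →ₗ[ℂ] V i}
    (h : MatchingChain k R' R f g P Q θ) {S' : DoubleRep U'} {S : DoubleRep U} {D : DoubleRep C}
    {f' : ∀ i, U' i →ₗ[ℂ] U i} {g' : ∀ i, U i →ₗ[ℂ] U'' i}
    (hact : ∀ {i j : I} (d : DArrow i j) x, f' j (S'.act d x) = S.act d (f' i x))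
    (a : Hom S' R') (ha : ∀ i, Function.Bijective (a.toFun i))
    (hfa : ∀ i x, f' i x = 0 ↔ f i (a.toFun i x) = 0)
    (q : Hom R D) (hq : q.Surjective) (hqf : ∀ i x, q.toFun i x = 0 ↔ x ∈ LinearMap.range (f i))
    (q' : Hom S D) (hq' : q'.Surjective)
    (hqf' : ∀ i y, q'.toFun i y = 0 ↔ y ∈ LinearMap.range (f' i))
    (hg : ∀ i x y, q.toFun i x = q'.toFun i y → (g i x = 0 ↔ g' i y = 0)) :
    ∃ P' Q' θ', MatchingChain k S' S f' g' P' Q' θ' := by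
  have hσ : ∀ i, ∃ σ : C i →ₗ[ℂ] U i, ∀ c, q'.toFun i (σ c) = c := fun i => by
    obtain ⟨σ, hσ⟩ := (q'.toFun i).exists_rightInverse_of_surjective
      (LinearMap.range_eq_top.2 (hq' i))
    exact ⟨σ, fun c => LinearMap.congr_fun hσ c⟩
  choose σ hσ using hσ
  -- Up to index `k`, `Q l` contains the range of `f`, so it is determined by its image in the
  -- cokernel `D`, through which it is carried to `U`.
  let Q' : ℕ → ∀ i, Submodule ℂ (U i) := fun l i => ((Q l i).map (q.toFun i)).comap (q'.toFun i)
  let θ' : ℕ → ∀ i, U' i →ₗ[ℂ] U i := fun l i => σ i ∘ₗ q.toFun i ∘ₗ θ l i ∘ₗ a.toFun i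
  have hθ' : ∀ l i x, q.toFun i (θ l i (a.toFun i x)) = q'.toFun i (θ' l i x) :=
    fun l i x => (hσ i _).symm
  have key : ∀ l ≤ k, ∀ i x y, q.toFun i x = q'.toFun i y → (y ∈ Q' l i ↔ x ∈ Q l i) := by
    intro l hl i x y hxy
    constructor
    · rintro ⟨z, hz, hzy⟩
      have h1 : x - z ∈ Q l i := by
        refine h.Q_le hl le_rfl i ?_
        rw [h.Q_last, ← hqf, map_sub, hxy, hzy, sub_self]
      simpa using Submodule.add_mem _ h1 hz
    · exact fun hx => ⟨x, hx, hxy⟩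
  refine ⟨fun l i => (P l i).comap (a.toFun i), Q', θ', ?_⟩
  exact
    { f_act := hact
      P_zero := fun i => by
        rw [h.P_zero]
        exact LinearMap.ker_eq_bot.2 (ha i).1
      P_last := fun i => by
        ext x
        rw [Submodule.mem_comap, h.P_last, LinearMap.mem_ker, LinearMap.mem_ker, hfa]
      Q_last := fun i => by
        ext y
        obtain ⟨x, hx⟩ := hq i (q'.toFun i y)
        rw [key k le_rfl i x y hx, h.Q_last, ← hqf, hx, hqf']
      Q_zero := fun i => by
        ext y
        obtain ⟨x, hx⟩ := hq i (q'.toFun i y)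
        rw [key 0 k.zero_le i x y hx, h.Q_zero, LinearMap.mem_ker, LinearMap.mem_ker, hg i x y hx]
      P_act := fun l hl i j d x hx => by
        rw [Submodule.mem_comap, a.comm]
        exact h.P_act l hl d _ hx
      Q_act := fun l hl i j d y hy => by
        obtain ⟨x, hx⟩ := hq i (q'.toFun i y)
        refine (key l hl j (R.act d x) _ ?_).2 (h.Q_act l hl d _ ((key l hl i x y hx).1 hy))
        rw [q.comm, q'.comm, hx]
      P_mono := fun l hl i => Submodule.comap_mono (h.P_mono l hl i)
      Q_anti := fun l hl i => Submodule.comap_mono (Submodule.map_mono (h.Q_anti l hl i))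
      θ_mem := fun l hl i x hx => (key l hl.le i _ _ (hθ' l i x)).2 (h.θ_mem l hl i _ hx)
      θ_mem_iff := fun l hl i x hx =>
        (key (l + 1) hl i _ _ (hθ' l i x)).trans (h.θ_mem_iff l hl i _ hx)
      θ_surj := fun l hl i y hy => by
        obtain ⟨x, hx⟩ := hq i (q'.toFun i y)
        obtain ⟨z, hz, hxz⟩ := h.θ_surj l hl i x ((key l hl.le i x y hx).1 hy)
        obtain ⟨w, rfl⟩ := (ha i).2 z
        refine ⟨w, hz, (key (l + 1) hl i _ _ ?_).2 hxz⟩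
        rw [map_sub, map_sub, hx, hθ']
      θ_act := fun l hl i j d x hx => by
        refine (key (l + 1) hl j _ _ ?_).2 (h.θ_act l hl d _ hx)
        rw [map_sub, map_sub, q.comm, q'.comm, hθ', ← a.comm, hθ'] }

end Transfer

/-! ### Matching complexes under isomorphism, torus action and attraction -/

section MatchingComplexes

variable {I : Type*} [Quiver I] {V V' V'' U U' U'' W' W'' : I → Type*}
  [∀ i, AddCommGroup (V i)] [∀ i, Module ℂ (V i)]
  [∀ i, AddCommGroup (V' i)] [∀ i, Module ℂ (V' i)]
  [∀ i, AddCommGroup (V'' i)] [∀ i, Module ℂ (V'' i)]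
  [∀ i, AddCommGroup (U i)] [∀ i, Module ℂ (U i)]
  [∀ i, AddCommGroup (U' i)] [∀ i, Module ℂ (U' i)]
  [∀ i, AddCommGroup (U'' i)] [∀ i, Module ℂ (U'' i)]
  [∀ i, AddCommGroup (W' i)] [∀ i, Module ℂ (W' i)]
  [∀ i, AddCommGroup (W'' i)] [∀ i, Module ℂ (W'' i)]

/-- The existence of framed morphisms `V' → V → V''` with a matching chain. -/
def HasMatchingComplex (R' : FramedRep V' W') (R'' : FramedRep V'' W'')
    (R : FramedRep V (FSum W' W'')) : Prop :=
  ∃ (f : FramedHom R' R (fun i => LinearMap.inl ℂ (W' i) (W'' i)))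
    (g : FramedHom R R'' (fun i => LinearMap.snd ℂ (W' i) (W'' i))) (k : ℕ)
    (P : ℕ → ∀ i, Submodule ℂ (V' i)) (Q : ℕ → ∀ i, Submodule ℂ (V i))
    (θ : ℕ → ∀ i, V' i →ₗ[ℂ] V i),
    MatchingChain k R'.toDoubleRep R.toDoubleRep f.toFun g.toFun P Q θ

theorem HasMatchingComplex.congr {R' : FramedRep V' W'} {R'' : FramedRep V'' W''}
    {R : FramedRep V (FSum W' W'')} {S' : FramedRep U' W'} {S'' : FramedRep U'' W''}
    {S : FramedRep U (FSum W' W'')} (h : HasMatchingComplex R' R'' R)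
    (φ' : FramedHom R' S' (fun _ => LinearMap.id)) (hφ' : ∀ i, Function.Bijective (φ'.toFun i))
    (φ'' : FramedHom R'' S'' (fun _ => LinearMap.id)) (hφ'' : ∀ i, Function.Bijective (φ''.toFun i))
    (φ : FramedHom R S (fun _ => LinearMap.id)) (hφ : ∀ i, Function.Bijective (φ.toFun i)) :
    HasMatchingComplex S' S'' S := by
  obtain ⟨f, g, k, P, Q, θ, hm⟩ := h
  let f' : FramedHom S' S (fun i => LinearMap.inl ℂ (W' i) (W'' i)) :=
    φ.comp (f.comp (φ'.symm hφ') (fun i => LinearMap.inl ℂ (W' i) (W'' i)) fun _ _ => rfl) _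
      fun _ _ => rfl
  let g' : FramedHom S S'' (fun i => LinearMap.snd ℂ (W' i) (W'' i)) :=
    φ''.comp (g.comp (φ.symm hφ) (fun i => LinearMap.snd ℂ (W' i) (W'' i)) fun _ _ => rfl) _
      fun _ _ => rfl
  have hf' : ∀ i x, f'.toFun i x = φ.toFun i (f.toFun i ((φ'.symm hφ').toFun i x)) :=
    fun _ _ => rfl
  have hg' : ∀ i x, g'.toFun i x = φ''.toFun i (g.toFun i ((φ.symm hφ).toFun i x)) :=
    fun _ _ => rfl
  have hproj : ∀ i x, f.toHom.range.proj.toFun i x = 0 ↔ x ∈ LinearMap.range (f.toFun i) :=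
    fun i x => Submodule.Quotient.mk_eq_zero _
  refine ⟨f', g', k, hm.transfer f'.toHom.comm (φ'.symm hφ').toHom (φ'.symm_bijective hφ')
    (fun i x => ?_) f.toHom.range.proj (fun i => Submodule.mkQ_surjective _) hproj
    (f.toHom.range.proj.comp (φ.symm hφ).toHom)
    (fun i => (Submodule.mkQ_surjective _).comp (φ.symm_bijective hφ i).2) (fun i y => ?_)
    fun i x y hxy => ?_⟩
  · rw [hf', map_eq_zero_iff _ (hφ i).1]
  · rw [Hom.comp_toFun, hproj]
    constructor
    · rintro ⟨x, hx⟩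
      exact ⟨φ'.toFun i x, by rw [hf', φ'.symm_apply, hx, φ.apply_symm]⟩
    · rintro ⟨x, rfl⟩
      exact ⟨_, by rw [hf', φ.symm_apply]⟩
  · rw [hg', map_eq_zero_iff _ (hφ'' i).1]
    have h1 : x - (φ.symm hφ).toFun i y ∈ LinearMap.range (f.toFun i) := by
      rw [← hproj, map_sub, hxy, Hom.comp_toFun, sub_self]
    have h2 : g.toFun i (x - (φ.symm hφ).toFun i y) = 0 := by
      have h3 := hm.Q_le k.zero_le le_rfl i
      rw [hm.Q_last, hm.Q_zero] at h3
      exact h3 h1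
    rw [map_sub, sub_eq_zero] at h2
    rw [h2]

theorem HasMatchingComplex.directSum (R' : FramedRep V' W') (R'' : FramedRep V'' W'') :
    HasMatchingComplex R' R'' (R'.directSum R'') := by
  refine ⟨R'.inlHom R'', R'.sndHom R'', 0, fun _ _ => ⊥,
    fun _ i => LinearMap.range (LinearMap.inl ℂ (V' i) (V'' i)), fun _ _ => 0, ?_⟩
  exact
    { f_act := (R'.inlHom R'').toHom.comm
      P_zero := fun _ => rfl
      P_last := fun i => (LinearMap.ker_eq_bot.2 LinearMap.inl_injective).symm
      Q_last := fun _ => rfl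
      Q_zero := fun i => LinearMap.range_inl ℂ _ _
      P_act := fun l _ i j d x hx => by
        rw [(Submodule.mem_bot ℂ).1 hx, map_zero]
        exact Submodule.zero_mem _
      Q_act := fun l _ i j d x hx => by
        obtain ⟨y, rfl⟩ := hx
        exact ⟨_, (R'.inlHom R'').toHom.comm d y⟩
      P_mono := fun l hl => absurd hl l.not_lt_zero
      Q_anti := fun l hl => absurd hl l.not_lt_zero
      θ_mem := fun l hl => absurd hl l.not_lt_zero
      θ_mem_iff := fun l hl => absurd hl l.not_lt_zero
      θ_surj := fun l hl => absurd hl l.not_lt_zero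
      θ_act := fun l hl => absurd hl l.not_lt_zero }

/-- Scaling `f` by `t⁻¹` compensates the twist on the `W'` part and changes neither its kernel nor
its range; `g` only sees the untwisted part. -/
theorem HasMatchingComplex.reframe {R' : FramedRep V' W'} {R'' : FramedRep V'' W''}
    {R : FramedRep V (FSum W' W'')} (h : HasMatchingComplex R' R'' R) (t : ℂˣ) :
    HasMatchingComplex R' R'' (R.reframe (torus W' W'' t)) := by
  obtain ⟨f, g, k, P, Q, θ, hm⟩ := h
  let f' : FramedHom R' (R.reframe (torus W' W'' t))
      (fun i => LinearMap.inl ℂ (W' i) (W'' i)) :=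
    { toHom := f.toHom.smul ((t⁻¹ : ℂˣ) : ℂ)
      comm_A := fun i w => by
        rw [FramedRep.reframe_torus_A]
        change ((t⁻¹ : ℂˣ) : ℂ) • f.toFun i _ = _
        rw [f.comm_A, ← map_smul]
        congr 1
        ext1 <;> simp [Units.smul_def]
      comm_B := fun i x => by
        rw [FramedRep.reframe_torus_B]
        change (t • (R.B i (((t⁻¹ : ℂˣ) : ℂ) • f.toFun i x)).1, _) = _
        change (_, (R.B i (((t⁻¹ : ℂˣ) : ℂ) • f.toFun i x)).2) = _
        rw [map_smul, f.comm_B]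
        ext1 <;> simp [Units.smul_def, smul_smul] }
  let g' : FramedHom (R.reframe (torus W' W'' t)) R''
      (fun i => LinearMap.snd ℂ (W' i) (W'' i)) :=
    { toHom := g.toHom
      comm_A := fun i w => by
        rw [FramedRep.reframe_torus_A, g.comm_A]
        rfl
      comm_B := fun i x => by
        rw [FramedRep.reframe_torus_B]
        exact g.comm_B i x }
  have ht : ((t⁻¹ : ℂˣ) : ℂ) ≠ 0 := (t⁻¹).ne_zero
  have hf' : ∀ i x, f'.toFun i x = ((t⁻¹ : ℂˣ) : ℂ) • f.toFun i x := fun _ _ => rfl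
  have hproj : ∀ i x, f.toHom.range.proj.toFun i x = 0 ↔ x ∈ LinearMap.range (f.toFun i) :=
    fun i x => Submodule.Quotient.mk_eq_zero _
  refine ⟨f', g', k, hm.transfer f'.toHom.comm R'.idHom.toHom (fun i => Function.bijective_id)
    (fun i x => ?_) f.toHom.range.proj (fun i => Submodule.mkQ_surjective _) hproj
    f.toHom.range.proj (fun i => Submodule.mkQ_surjective _) (fun i y => ?_)
    fun i x y hxy => ?_⟩
  · rw [hf', smul_eq_zero_iff_right ht]
    rfl
  · refine (hproj i y).trans ⟨?_, ?_⟩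
    · rintro ⟨x, rfl⟩
      exact ⟨(t : ℂ) • x, by rw [hf', map_smul, smul_smul, Units.inv_mul, one_smul]⟩
    · rintro ⟨x, rfl⟩
      rw [hf']
      exact Submodule.smul_mem _ _ ⟨x, rfl⟩
  · have h1 : x - y ∈ LinearMap.range (f.toFun i) := by
      rw [← hproj, map_sub, hxy, sub_self]
    have h2 : g.toFun i (x - y) = 0 := by
      have h3 := hm.Q_le k.zero_le le_rfl i
      rw [hm.Q_last, hm.Q_zero] at h3
      exact h3 h1
    rw [map_sub, sub_eq_zero] at h2
    change _ ↔ g.toFun i y = 0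
    rw [h2]

/-- Matching complexes over a direct sum extend to every representation which is attracted to
it. -/
theorem HasMatchingComplex.of_extension {R' : FramedRep V' W'} {R'' : FramedRep V'' W''}
    {T' : FramedRep U' W'} {T'' : FramedRep U'' W''} {R : FramedRep V (FSum W' W'')}
    (hR' : R'.IsStable) (hT' : T'.IsStable) (hT'' : T''.IsStable)
    (h : HasMatchingComplex R' R'' (T'.directSum T''))
    (f₀ : FramedHom T' R (fun i => LinearMap.inl ℂ (W' i) (W'' i)))
    (g₀ : FramedHom R T'' (fun i => LinearMap.snd ℂ (W' i) (W'' i)))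
    (hf₀ : ∀ i, Function.Injective (f₀.toFun i))
    (hex : ∀ i, LinearMap.range (f₀.toFun i) = LinearMap.ker (g₀.toFun i)) :
    HasMatchingComplex R' R'' R := by
  obtain ⟨f, g, k, P, Q, θ, hm⟩ := h
  let f₁ : FramedHom R' T' (fun _ => LinearMap.id) :=
    (T'.fstHom T'').comp f _ fun _ _ => rfl
  let g₁ : FramedHom T'' R'' (fun _ => LinearMap.id) :=
    g.comp (T'.inrHom T'') _ fun _ _ => rfl
  have hf₁ : f₁.toHom.Surjective := f₁.surjective hT' fun _ => Function.surjective_id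
  have hg₀ : g₀.toHom.Surjective := g₀.surjective hT'' fun i => LinearMap.snd_surjective
  -- The framing `W'` of `R'` maps to 0 in `T''`, so by stability of `R'` the whole component
  -- vanishes; dually `g` vanishes on `T'`.
  have hfsnd : ∀ i x, (f.toFun i x).2 = 0 := fun i x =>
    hR'.hom_eq ((T'.sndHom T'').toHom.comp f.toHom) (((T'.sndHom T'').toHom.comp f.toHom).smul 0)
      (fun i w => by
        rw [Hom.comp_toFun, Hom.smul_toFun, zero_smul, f.comm_A, (T'.sndHom T'').comm_A]
        exact map_zero _) i x |>.trans (by rw [Hom.smul_toFun, zero_smul])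
  have hginl : ∀ i x, g.toFun i (x, 0) = 0 := fun i x =>
    hT'.hom_eq (g.toHom.comp (T'.inlHom T'').toHom) ((g.toHom.comp (T'.inlHom T'').toHom).smul 0)
      (fun i w => by
        rw [Hom.comp_toFun, Hom.smul_toFun, zero_smul, (T'.inlHom T'').comm_A, g.comm_A]
        exact map_zero _) i x |>.trans (by rw [Hom.smul_toFun, zero_smul])
  have hfeq : ∀ i x, f.toFun i x = (f₁.toFun i x, 0) := fun i x => Prod.ext rfl (hfsnd i x)
  have hgeq : ∀ i (y : U' i × U'' i), g.toFun i y = g₁.toFun i y.2 := fun i y => by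
    have h1 : y = (y.1, 0) + (0, y.2) := by simp
    have h2 := congrArg (g.toFun i) h1
    rw [map_add, hginl, zero_add] at h2
    exact h2
  let f' : FramedHom R' R (fun i => LinearMap.inl ℂ (W' i) (W'' i)) :=
    f₀.comp f₁ _ fun _ _ => rfl
  let g' : FramedHom R R'' (fun i => LinearMap.snd ℂ (W' i) (W'' i)) :=
    g₁.comp g₀ _ fun _ _ => rfl
  have hf' : ∀ i x, f'.toFun i x = f₀.toFun i (f₁.toFun i x) := fun _ _ => rfl
  -- As `R'` surjects onto `T'`, both `f` and `f'` have image `T'` and cokernel `T''`, through which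
  -- the chain is carried.
  refine ⟨f', g', k, hm.transfer f'.toHom.comm R'.idHom.toHom (fun i => Function.bijective_id)
    (fun i x => ?_) (T'.sndHom T'').toHom (fun i => LinearMap.snd_surjective) (fun i y => ?_)
    g₀.toHom hg₀ (fun i y => ?_) fun i x y hxy => ?_⟩
  · change _ ↔ f.toFun i x = 0
    rw [hf', map_eq_zero_iff _ (hf₀ i), hfeq]
    simp
  · change y.2 = 0 ↔ _
    constructor
    · intro hy
      obtain ⟨x, hx⟩ := hf₁ i y.1
      exact ⟨x, by rw [hfeq, hx, ← hy]⟩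
    · rintro ⟨x, rfl⟩
      exact hfsnd i x
  · rw [← LinearMap.mem_ker, ← hex]
    constructor
    · rintro ⟨x, rfl⟩
      obtain ⟨z, rfl⟩ := hf₁ i x
      exact ⟨z, rfl⟩
    · rintro ⟨z, rfl⟩
      exact ⟨_, rfl⟩
  · change _ ↔ g₁.toFun i (g₀.toFun i y) = 0
    rw [hgeq, ← hxy]
    rfl

end MatchingComplexes

/-! ### Diagonal blocks of representations on direct sums -/

section Parts

variable {I : Type*} [Quiver I] {V' V'' W' W'' : I → Type*}
  [∀ i, AddCommGroup (V' i)] [∀ i, Module ℂ (V' i)]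
  [∀ i, AddCommGroup (V'' i)] [∀ i, Module ℂ (V'' i)]
  [∀ i, AddCommGroup (W' i)] [∀ i, Module ℂ (W' i)]
  [∀ i, AddCommGroup (W'' i)] [∀ i, Module ℂ (W'' i)]

/-- The first diagonal block of a representation on a direct sum. -/
def FramedRep.fstPart (P : FramedRep (FSum V' V'') (FSum W' W'')) : FramedRep V' W' where
  toDoubleRep := DoubleRep.ofAct fun i j d =>
    LinearMap.fst ℂ (V' j) (V'' j) ∘ₗ P.act d ∘ₗ LinearMap.inl ℂ (V' i) (V'' i)
  A i := LinearMap.fst ℂ (V' i) (V'' i) ∘ₗ P.A i ∘ₗ LinearMap.inl ℂ (W' i) (W'' i)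
  B i := LinearMap.fst ℂ (W' i) (W'' i) ∘ₗ P.B i ∘ₗ LinearMap.inl ℂ (V' i) (V'' i)

/-- The second diagonal block of a representation on a direct sum. -/
def FramedRep.sndPart (P : FramedRep (FSum V' V'') (FSum W' W'')) : FramedRep V'' W'' where
  toDoubleRep := DoubleRep.ofAct fun i j d =>
    LinearMap.snd ℂ (V' j) (V'' j) ∘ₗ P.act d ∘ₗ LinearMap.inr ℂ (V' i) (V'' i)
  A i := LinearMap.snd ℂ (V' i) (V'' i) ∘ₗ P.A i ∘ₗ LinearMap.inr ℂ (W' i) (W'' i)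
  B i := LinearMap.snd ℂ (W' i) (W'' i) ∘ₗ P.B i ∘ₗ LinearMap.inr ℂ (V' i) (V'' i)

theorem FramedRep.act_fstPart (P : FramedRep (FSum V' V'') (FSum W' W'')) {i j : I}
    (d : DArrow i j) (x : V' i) : P.fstPart.act d x = (P.act d (x, 0)).1 := by
  cases d <;> rfl

theorem FramedRep.act_sndPart (P : FramedRep (FSum V' V'') (FSum W' W'')) {i j : I}
    (d : DArrow i j) (x : V'' i) : P.sndPart.act d x = (P.act d (0, x)).2 := by
  cases d <;> rfl

/-- Commuting with the first projection kills both off-diagonal blocks. -/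
theorem LinearMap.eq_prodMap_of_comm {E E' F F' : Type*} [AddCommGroup E] [Module ℂ E]
    [AddCommGroup E'] [Module ℂ E'] [AddCommGroup F] [Module ℂ F] [AddCommGroup F'] [Module ℂ F']
    (L : E × E' →ₗ[ℂ] F × F') (h : ∀ x, ((L x).1, (0 : F')) = L (x.1, 0)) (x : E × E') :
    ((L (x.1, 0)).1, (L (0, x.2)).2) = L x := by
  have h1 := h x
  have h2 : L x = L (x.1, 0) + L (0, x.2) := by
    rw [← map_add]
    simp
  refine Prod.ext (congrArg Prod.fst h1).symm ?_
  have h3 := congrArg Prod.snd h1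
  rw [h2]
  simp [← h3]

/-- A representation for which the projection onto the first summand is an endomorphism is a
direct sum. -/
theorem FramedRep.directSum_parts (P : FramedRep (FSum V' V'') (FSum W' W''))
    (e : FramedHom P P
      (fun i => LinearMap.inl ℂ (W' i) (W'' i) ∘ₗ LinearMap.fst ℂ (W' i) (W'' i)))
    (he : ∀ i x, e.toFun i x = (x.1, 0)) : P.fstPart.directSum P.sndPart = P := by
  refine FramedRep.ext_act (fun i j d x => ?_) (fun i w => ?_) fun i x => ?_
  · rw [FramedRep.act_directSum, LinearMap.prodMap_apply, act_fstPart, act_sndPart]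
    refine LinearMap.eq_prodMap_of_comm (P.act d) (fun x => ?_) x
    rw [← he, ← he, e.toHom.comm]
  · refine LinearMap.eq_prodMap_of_comm (P.A i) (fun x => ?_) w
    rw [← he, e.comm_A]
    rfl
  · refine LinearMap.eq_prodMap_of_comm (P.B i) (fun x => ?_) x
    rw [← he, e.comm_B]
    rfl

theorem FramedRep.fstPart_directSum (R' : FramedRep V' W') (R'' : FramedRep V'' W'') :
    (R'.directSum R'').fstPart = R' := by
  refine FramedRep.ext_act (fun i j d x => ?_) (fun i w => rfl) fun i x => rfl
  rw [act_fstPart, FramedRep.act_directSum]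
  rfl

theorem FramedRep.sndPart_directSum (R' : FramedRep V' W') (R'' : FramedRep V'' W'') :
    (R'.directSum R'').sndPart = R'' := by
  refine FramedRep.ext_act (fun i j d x => ?_) (fun i w => rfl) fun i x => rfl
  rw [act_sndPart, FramedRep.act_directSum]
  rfl

variable [∀ i, TopologicalSpace (V' i)] [∀ i, TopologicalSpace (V'' i)]
  [∀ i, TopologicalSpace (W' i)] [∀ i, TopologicalSpace (W'' i)]

theorem FramedRep.tendsto_fstPart {ι : Type*} {l : Filter ι}
    {P : ι → FramedRep (FSum V' V'') (FSum W' W'')} {P₀ : FramedRep (FSum V' V'') (FSum W' W'')}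
    (h : Tendsto P l (𝓝 P₀)) : Tendsto (fun n => (P n).fstPart) l (𝓝 P₀.fstPart) := by
  rw [FramedRep.tendsto_iff] at h ⊢
  refine ⟨fun i j d x => ?_, fun i w => (continuous_fst.tendsto _).comp (h.2.1 i (w, 0)),
    fun i x => (continuous_fst.tendsto _).comp (h.2.2 i (x, 0))⟩
  simp only [act_fstPart]
  exact (continuous_fst.tendsto _).comp (h.1 i j d (x, 0))

theorem FramedRep.tendsto_sndPart {ι : Type*} {l : Filter ι}
    {P : ι → FramedRep (FSum V' V'') (FSum W' W'')} {P₀ : FramedRep (FSum V' V'') (FSum W' W'')}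
    (h : Tendsto P l (𝓝 P₀)) : Tendsto (fun n => (P n).sndPart) l (𝓝 P₀.sndPart) := by
  rw [FramedRep.tendsto_iff] at h ⊢
  refine ⟨fun i j d x => ?_, fun i w => (continuous_snd.tendsto _).comp (h.2.1 i (0, w)),
    fun i x => (continuous_snd.tendsto _).comp (h.2.2 i (0, x))⟩
  simp only [act_sndPart]
  exact (continuous_snd.tendsto _).comp (h.1 i j d (0, x))

end Parts

/-! ### Linear maps close to the identity -/

section NearIdentity

variable {ι : Type*} {l : Filter ι} {m : ℕ}

theorem eventually_bijective_of_tendsto_id {L : ι → (Fin m → ℂ) →ₗ[ℂ] (Fin m → ℂ)}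
    (hL : ∀ x, Tendsto (fun n => L n x) l (𝓝 x)) : ∀ᶠ n in l, Function.Bijective (L n) := by
  have h1 := tendsto_toMatrix (L₀ := LinearMap.id) hL
  have h2 := ((continuous_id.matrix_det (A := fun M : Matrix (Fin m) (Fin m) ℂ => M)).tendsto
    _).comp h1
  have h3 : Matrix.det (LinearMap.toMatrix' (LinearMap.id : (Fin m → ℂ) →ₗ[ℂ] (Fin m → ℂ))) ≠ 0 := by
    simp
  filter_upwards [h2.eventually_ne h3] with n hn
  rw [← Module.End.isUnit_iff, LinearMap.isUnit_iff_isUnit_det, ← LinearMap.det_toMatrix']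
  exact isUnit_iff_ne_zero.2 hn

theorem tendsto_symm_of_tendsto_id [l.NeBot] {U : ι → (Fin m → ℂ) ≃ₗ[ℂ] (Fin m → ℂ)}
    (hU : ∀ x, Tendsto (fun n => U n x) l (𝓝 x)) (x : Fin m → ℂ) :
    Tendsto (fun n => (U n).symm x) l (𝓝 x) := by
  have h1 : Tendsto (fun n => LinearMap.toMatrix' (U n).toLinearMap) l (𝓝 1) := by
    have := tendsto_toMatrix (L := fun n => (U n).toLinearMap) (L₀ := LinearMap.id) hU
    rwa [LinearMap.toMatrix'_id] at this
  obtain ⟨L₀, hL₀⟩ := exists_tendsto_of_basis (L := fun n => (U n).symm.toLinearMap)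
    (y := fun j => Pi.single j 1) h1 fun j => by
      have h2 : ∀ n, (LinearMap.toMatrix' (U n).toLinearMap).col j = U n (Pi.single j 1) :=
        fun n => by
          ext r
          exact LinearMap.toMatrix'_apply _ _ _
      simp only [h2, LinearEquiv.coe_coe, LinearEquiv.symm_apply_apply]
      exact tendsto_const_nhds
  have h3 := tendsto_linearMap_apply hL₀ (hU x)
  simp only [LinearEquiv.coe_coe, LinearEquiv.symm_apply_apply] at h3
  have h4 : x = L₀ x := tendsto_nhds_unique tendsto_const_nhds h3
  have h5 := hL₀ x
  rw [← h4] at h5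
  exact h5

end NearIdentity

/-! ### The matching relation is closed -/

section Closedness

variable {I : Type*} [Quiver I] [Fintype I] [∀ i j : I, Fintype (i ⟶ j)]
  {W' W'' : I → Type*}
  [∀ i, AddCommGroup (W' i)] [∀ i, Module ℂ (W' i)]
  [∀ i, AddCommGroup (W'' i)] [∀ i, Module ℂ (W'' i)]
  [∀ i, TopologicalSpace (W' i)] [∀ i, IsTopologicalAddGroup (W' i)]
  [∀ i, ContinuousSMul ℂ (W' i)] [∀ i, T2Space (W' i)]
  [∀ i, TopologicalSpace (W'' i)] [∀ i, IsTopologicalAddGroup (W'' i)]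
  [∀ i, ContinuousSMul ℂ (W'' i)] [∀ i, T2Space (W'' i)]

/-- The projection onto the first summand, moved to `P`. It lies over the projection of the framing
to `W'`, so by rigidity it converges when `P` does. -/
theorem Nak.exists_idempotent {u' u'' v : I → ℕ} (hu : u' + u'' = v) {T' : StableRep u' W'}
    {T'' : StableRep u'' W''} {P : StableRep v (FSum W' W'')}
    (h : Nak.mk P = Nak.sum hu (Nak.mk T') (Nak.mk T'')) :
    ∃ e : FramedHom P.1 P.1
      (fun i => LinearMap.inl ℂ (W' i) (W'' i) ∘ₗ LinearMap.fst ℂ (W' i) (W'' i)),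
      ∀ i x, e.toFun i (e.toFun i x) = e.toFun i x := by
  obtain ⟨ψ, hψ⟩ := (Nak.mk_eq_sum_iff hu).1 h
  refine ⟨ψ.comp ((T'.1.inlHom T''.1).comp ((T'.1.fstHom T''.1).comp (ψ.symm hψ)
    (fun i => LinearMap.fst ℂ (W' i) (W'' i)) fun _ _ => rfl)
    (fun i => LinearMap.inl ℂ (W' i) (W'' i) ∘ₗ LinearMap.fst ℂ (W' i) (W'' i)) fun _ _ => rfl) _
    fun _ _ => rfl, fun i x => ?_⟩
  simp only [FramedHom.comp_toFun, FramedHom.symm_apply]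
  rfl

/-- Fixed points near a direct sum are represented by nearby direct sums. -/
theorem exists_tendsto_sum {v' v'' v : I → ℕ} (hv : v' + v'' = v) {ι : Type*} {l : Filter ι}
    [l.NeBot] {P : ι → StableRep v (FSum W' W'')} {R' : StableRep v' W'} {R'' : StableRep v'' W''}
    (hP : Tendsto (fun n => (P n).1) l (𝓝 (StableRep.sum hv R' R'').1))
    (hfix : ∀ n, ∃ (u' u'' : I → ℕ) (hu : u' + u'' = v) (T' : StableRep u' W')
      (T'' : StableRep u'' W''), Nak.mk (P n) = Nak.sum hu (Nak.mk T') (Nak.mk T'')) :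
    ∃ (S' : ι → StableRep v' W') (S'' : ι → StableRep v'' W''),
      Tendsto (fun n => (S' n).1) l (𝓝 R'.1) ∧ Tendsto (fun n => (S'' n).1) l (𝓝 R''.1) ∧
      ∀ᶠ n in l, Nak.mk (P n) = Nak.sum hv (Nak.mk (S' n)) (Nak.mk (S'' n)) := by
  classical
  have hidem : ∀ n, ∃ e : FramedHom (P n).1 (P n).1
      (fun i => LinearMap.inl ℂ (W' i) (W'' i) ∘ₗ LinearMap.fst ℂ (W' i) (W'' i)),
      ∀ i x, e.toFun i (e.toFun i x) = e.toFun i x := fun n => by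
    obtain ⟨u', u'', hu, T', T'', h⟩ := hfix n
    exact Nak.exists_idempotent hu h
  choose e he using hidem
  obtain ⟨e₀, he₀⟩ := FramedHom.exists_tendsto
    (fun i => (continuous_fst.prodMk continuous_const : Continuous fun w : FSum W' W'' i =>
      (w.1, (0 : W'' i)))) hP hP (StableRep.sum hv R' R'').2.2 e
  let sE : ∀ i, FSum (Cn v') (Cn v'') i ≃ₗ[ℂ] Cn v i := sumEquiv hv
  have hsE : ∀ i (y : FSum (Cn v') (Cn v'') i), e₀.toFun i (sE i y) = sE i (y.1, 0) := by
    intro i y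
    have ht := (R'.1.directSum R''.1).transportHom_bijective (sumEquiv hv)
    have h1 := FramedHom.toFun_eq_of_isStable (StableRep.sum hv R' R'').2.2 e₀
      (((R'.1.directSum R''.1).transportHom (sumEquiv hv)).comp ((R'.1.inlHom R''.1).comp
        ((R'.1.fstHom R''.1).comp (((R'.1.directSum R''.1).transportHom (sumEquiv hv)).symm ht)
          (fun i => LinearMap.fst ℂ (W' i) (W'' i)) fun _ _ => rfl)
        (fun i => LinearMap.inl ℂ (W' i) (W'' i) ∘ₗ LinearMap.fst ℂ (W' i) (W'' i))
        fun _ _ => rfl) _ fun _ _ => rfl) i (sE i y)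
    have h2 := ((R'.1.directSum R''.1).transportHom (sumEquiv hv)).symm_apply ht i y
    rw [FramedRep.transportHom_toFun] at h2
    rw [h1]
    simp only [FramedHom.comp_toFun, FramedRep.transportHom_toFun]
    erw [h2]
    rfl
  have hidem₀ : ∀ i x, e₀.toFun i (e₀.toFun i x) = e₀.toFun i x := by
    intro i x
    obtain ⟨y, rfl⟩ := (sE i).surjective x
    rw [hsE, hsE]
  -- For idempotents `e` and `e₀`, the map `e e₀ + (1 - e)(1 - e₀)` intertwines them. It tends to
  -- the identity as `e` tends to `e₀`, so it is eventually invertible.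
  let u : ι → ∀ i, Cn v i →ₗ[ℂ] Cn v i := fun n i =>
    (e n).toFun i ∘ₗ e₀.toFun i + (LinearMap.id - (e n).toFun i) ∘ₗ (LinearMap.id - e₀.toFun i)
  have hu : ∀ n i x, u n i x = (e n).toFun i (e₀.toFun i x) +
      ((x - e₀.toFun i x) - (e n).toFun i (x - e₀.toFun i x)) := fun _ _ _ => rfl
  have hulim : ∀ i x, Tendsto (fun n => u n i x) l (𝓝 x) := by
    intro i x
    have h1 := (he₀ i (e₀.toFun i x)).add
      ((tendsto_const_nhds (x := x - e₀.toFun i x)).sub (he₀ i (x - e₀.toFun i x)))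
    rw [map_sub, hidem₀, sub_self, sub_zero, add_sub_cancel] at h1
    exact h1
  have hcomm : ∀ n i x, (e n).toFun i (u n i x) = u n i (e₀.toFun i x) := by
    intro n i x
    rw [hu, hu, map_add, map_sub, he, he, hidem₀]
    simp
  have hgood : ∀ᶠ n in l, ∀ i, Function.Bijective (u n i) :=
    eventually_all.2 fun i => eventually_bijective_of_tendsto_id (hulim i)
  let U : ι → ∀ i, Cn v i ≃ₗ[ℂ] Cn v i := fun n i =>
    if h : ∀ i, Function.Bijective (u n i) then LinearEquiv.ofBijective (u n i) (h i)
    else LinearEquiv.refl ℂ _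
  have hUu : ∀ n, (∀ i, Function.Bijective (u n i)) → ∀ i x, U n i x = u n i x := by
    intro n hn i x
    simp only [U, dif_pos hn]
    rfl
  have hUlim : ∀ i x, Tendsto (fun n => U n i x) l (𝓝 x) := fun i x =>
    (hulim i x).congr' (hgood.mono fun n hn => (hUu n hn i x).symm)
  have hUlim' : ∀ i x, Tendsto (fun n => (U n i).symm x) l (𝓝 x) := fun i =>
    tendsto_symm_of_tendsto_id (hUlim i)
  let a : ∀ (_ : ι) (i : I), Cn v i ≃ₗ[ℂ] FSum (Cn v') (Cn v'') i := fun n i =>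
    (U n i).symm.trans (sE i).symm
  let T : ι → FramedRep (FSum (Cn v') (Cn v'')) (FSum W' W'') := fun n => (P n).1.transport (a n)
  have hsEc : ∀ i, Continuous (sE i).symm := fun i =>
    (sE i).symm.toLinearMap.continuous_of_finiteDimensional
  have hT : Tendsto T l (𝓝 (R'.1.directSum R''.1)) := by
    rw [FramedRep.tendsto_iff] at hP ⊢
    refine ⟨fun i j d x => ?_, fun i w => ?_, fun i x => ?_⟩
    · have h1 : ∀ n, (T n).act d x =
          (sE j).symm ((U n j).symm ((P n).1.act d (U n i (sE i x)))) := fun n =>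
        DoubleRep.act_transport _ _ d x
      have h2 : (R'.1.directSum R''.1).act d x =
          (sE j).symm ((StableRep.sum hv R' R'').1.act d (sE i x)) := by
        have := DoubleRep.act_transport (R'.1.directSum R''.1).toDoubleRep sE d (sE i x)
        rw [LinearEquiv.symm_apply_apply] at this
        exact ((sE j).symm_apply_eq.2 this).symm
      simp only [h1, h2]
      exact ((hsEc j).tendsto _).comp (tendsto_linearMap_apply
        (L := fun n => (U n j).symm.toLinearMap) (L₀ := LinearMap.id) (hUlim' j)
        (tendsto_linearMap_apply (hP.1 i j d) (hUlim i _)))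
    · have h2 : (R'.1.directSum R''.1).A i w =
          (sE i).symm ((StableRep.sum hv R' R'').1.A i w) := ((sE i).symm_apply_apply _).symm
      rw [h2]
      exact ((hsEc i).tendsto _).comp (tendsto_linearMap_apply
        (L := fun n => (U n i).symm.toLinearMap) (L₀ := LinearMap.id) (hUlim' i) (hP.2.1 i w))
    · have h2 : (R'.1.directSum R''.1).B i x = (StableRep.sum hv R' R'').1.B i (sE i x) :=
        congrArg ((R'.1.directSum R''.1).B i) ((sE i).symm_apply_apply x).symm
      rw [h2]
      exact tendsto_linearMap_apply (hP.2.2 i) (hUlim i (sE i x))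
  -- After conjugation by `u n` the idempotent endomorphism is the standard projection, so the
  -- representation is block diagonal with blocks of the dimensions of the limit.
  have hsplit : ∀ n, (∀ i, Function.Bijective (u n i)) →
      (T n).fstPart.directSum (T n).sndPart = T n := by
    intro n hn
    have ht := (P n).1.transportHom_bijective (a n)
    refine FramedRep.directSum_parts (T n) (((P n).1.transportHom (a n)).comp ((e n).comp
      (((P n).1.transportHom (a n)).symm ht)
      (fun i => LinearMap.inl ℂ (W' i) (W'' i) ∘ₗ LinearMap.fst ℂ (W' i) (W'' i))
      fun _ _ => rfl) _ fun _ _ => rfl) fun i x => ?_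
    have h2 := ((P n).1.transportHom (a n)).symm_apply ht i ((a n i).symm x)
    rw [FramedRep.transportHom_toFun, LinearEquiv.apply_symm_apply] at h2
    rw [FramedHom.comp_toFun, FramedHom.comp_toFun, h2, FramedRep.transportHom_toFun]
    change (sE i).symm ((U n i).symm ((e n).toFun i (U n i (sE i x)))) = _
    rw [hUu n hn, hcomm, ← hUu n hn, LinearEquiv.symm_apply_apply, hsE,
      LinearEquiv.symm_apply_apply]
  have hex : ∀ n, ∃ (S' : StableRep v' W') (S'' : StableRep v'' W''),
      (∀ i, Function.Bijective (u n i)) → S'.1 = (T n).fstPart ∧ S''.1 = (T n).sndPart := by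
    intro n
    by_cases hn : ∀ i, Function.Bijective (u n i)
    · have hst : ((T n).fstPart.directSum (T n).sndPart).IsStable := by
        rw [hsplit n hn]
        exact (P n).2.2.transport _
      have hm : ∀ i, ((T n).fstPart.directSum (T n).sndPart).moment i = 0 := by
        rw [hsplit n hn]
        exact FramedRep.moment_transport (P n).2.1 _
      have h1 : ((T n).fstPart.fstHom (T n).sndPart).toHom.Surjective :=
        fun i => LinearMap.fst_surjective
      have h2 : ((T n).fstPart.sndHom (T n).sndPart).toHom.Surjective :=
        fun i => LinearMap.snd_surjective
      exact ⟨⟨_, FramedHom.moment_eq_zero_of_surjective _ h1 hm, hst.of_surjective _ h1⟩,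
        ⟨_, FramedHom.moment_eq_zero_of_surjective _ h2 hm, hst.of_surjective _ h2⟩,
        fun _ => ⟨rfl, rfl⟩⟩
    · exact ⟨R', R'', fun h => absurd h hn⟩
  choose S' S'' hS using hex
  refine ⟨S', S'', ?_, ?_, ?_⟩
  · have h1 := FramedRep.tendsto_fstPart hT
    rw [FramedRep.fstPart_directSum] at h1
    exact h1.congr' (hgood.mono fun n hn => (hS n hn).1.symm)
  · have h1 := FramedRep.tendsto_sndPart hT
    rw [FramedRep.sndPart_directSum] at h1
    exact h1.congr' (hgood.mono fun n hn => (hS n hn).2.symm)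
  · filter_upwards [hgood] with n hn
    rw [Nak.mk_eq_sum_iff, (hS n hn).1, (hS n hn).2, hsplit n hn]
    exact ⟨((P n).1.transportHom (a n)).symm ((P n).1.transportHom_bijective (a n)),
      FramedHom.symm_bijective _ _⟩

/-- The pairs of a fixed point `[V' ⊕ V'']` and a point `[V]` for which there are framed morphisms
`V' → V → V''` with matching filtrations. -/
def matchingRelation (W' W'' : I → Type*) [∀ i, AddCommGroup (W' i)] [∀ i, Module ℂ (W' i)]
    [∀ i, AddCommGroup (W'' i)] [∀ i, Module ℂ (W'' i)] (v : I → ℕ) :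
    Set (Nak v (FSum W' W'') × Nak v (FSum W' W'')) :=
  {z | ∃ (v' v'' : I → ℕ) (hv : v' + v'' = v) (R' : StableRep v' W') (R'' : StableRep v'' W'')
    (R : StableRep v (FSum W' W'')), z.1 = Nak.sum hv (Nak.mk R') (Nak.mk R'') ∧ z.2 = Nak.mk R ∧
    HasMatchingComplex R'.1 R''.1 R.1}

/-- Matching complexes are invariant under isomorphism and the summands are unique, so any
representatives may be used. -/
theorem sum_mk_mem_matchingRelation_iff {v' v'' v : I → ℕ} (hv : v' + v'' = v)
    (R' : StableRep v' W') (R'' : StableRep v'' W'') (R : StableRep v (FSum W' W'')) :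
    (Nak.sum hv (Nak.mk R') (Nak.mk R''), Nak.mk R) ∈ matchingRelation W' W'' v ↔
      HasMatchingComplex R'.1 R''.1 R.1 := by
  constructor
  · rintro ⟨u', u'', hu, T', T'', T, h1, h2, hm⟩
    obtain ⟨⟨φ', hφ'⟩, ⟨φ'', hφ''⟩⟩ := (Nak.sum_eq_sum_iff hv hu).1 h1
    obtain ⟨φ, hφ⟩ := Nak.mk_eq_mk_iff.1 h2.symm
    exact hm.congr φ' hφ' φ'' hφ'' φ hφ
  · exact fun hm => ⟨v', v'', hv, R', R'', R, rfl, rfl, hm⟩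

/-- Openness of the quotient map lifts the approximating pairs to converging representatives, the
fixed points being represented by converging summands. The morphisms `f` and `g` then converge by
stability, and the limit of their chains carries a chain. -/
theorem mem_matchingRelation_of_mem_closure {v' v'' v : I → ℕ} (hv : v' + v'' = v)
    {R' : StableRep v' W'} {R'' : StableRep v'' W''} {R : StableRep v (FSum W' W'')}
    (h : (Nak.sum hv (Nak.mk R') (Nak.mk R''), Nak.mk R) ∈ closure (matchingRelation W' W'' v)) :
    HasMatchingComplex R'.1 R''.1 R.1 := by
  let q : StableRep v (FSum W' W'') × StableRep v (FSum W' W'') →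
      Nak v (FSum W' W'') × Nak v (FSum W' W'') := Prod.map Nak.mk Nak.mk
  have hq : IsOpenMap q := Nak.isOpenMap_mk.prodMap Nak.isOpenMap_mk
  have hq' : Continuous q := Nak.continuous_mk.prodMap Nak.continuous_mk
  have h1 : (StableRep.sum hv R' R'', R) ∈ closure (q ⁻¹' matchingRelation W' W'' v) := by
    rw [← hq.preimage_closure_eq_closure_preimage hq']
    exact h
  rw [mem_closure_iff_comap_neBot] at h1
  set l : Filter (q ⁻¹' matchingRelation W' W'' v) :=
    comap Subtype.val (𝓝 (StableRep.sum hv R' R'', R))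
  have hval : Tendsto Subtype.val l (𝓝 (StableRep.sum hv R' R'', R)) := tendsto_comap
  have hP : Tendsto (fun n : q ⁻¹' matchingRelation W' W'' v => n.1.1.1) l
      (𝓝 (StableRep.sum hv R' R'').1) :=
    (continuous_subtype_val.tendsto _).comp ((continuous_fst.tendsto _).comp hval)
  have hR : Tendsto (fun n : q ⁻¹' matchingRelation W' W'' v => n.1.2.1) l (𝓝 R.1) :=
    (continuous_subtype_val.tendsto _).comp ((continuous_snd.tendsto _).comp hval)
  obtain ⟨S', S'', hS', hS'', hS⟩ := exists_tendsto_sum hv hP fun n => by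
    obtain ⟨u', u'', hu, T', T'', T, h2, -⟩ := n.2
    exact ⟨u', u'', hu, T', T'', h2⟩
  have hm : ∀ᶠ n in l, HasMatchingComplex (S' n).1 (S'' n).1 n.1.2.1 := by
    filter_upwards [hS] with n hn
    rw [← sum_mk_mem_matchingRelation_iff hv, ← hn]
    exact n.2
  let N := {n | HasMatchingComplex (S' n).1 (S'' n).1 n.1.2.1}
  have hN : (comap (Subtype.val : N → _) l).NeBot :=
    NeBot.comap_of_range_mem h1 (by rw [Subtype.range_val]; exact hm)
  have hval' : Tendsto (Subtype.val : N → _) (comap Subtype.val l) l := tendsto_comap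
  choose f g k P Q θ hc using fun n : N => n.2
  obtain ⟨f₀, hf₀⟩ := FramedHom.exists_tendsto
    (fun i => (continuous_id.prodMk continuous_const : Continuous fun w : W' i =>
      (w, (0 : W'' i)))) (hS'.comp hval') (hR.comp hval') R'.2.2 f
  obtain ⟨g₀, hg₀⟩ := FramedHom.exists_tendsto (fun i => continuous_snd) (hR.comp hval')
    (hS''.comp hval') R.2.2 g
  obtain ⟨k, P, Q, θ, h2⟩ := exists_matchingChain_of_tendsto hv
    (FramedRep.tendsto_iff.1 (hS'.comp hval')).1 (FramedRep.tendsto_iff.1 (hR.comp hval')).1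
    hf₀ hg₀ f₀.toHom.comm (g₀.surjective R''.2.2 fun i => LinearMap.snd_surjective)
    (Eventually.of_forall fun n => ⟨_, _, _, _, hc n⟩)
  exact ⟨f₀, g₀, k, P, Q, θ, h2⟩

end Closedness

/-! ### Kernels between quotients of one representation -/

section Subquotients

variable {I : Type*} [Quiver I] {V U C : I → Type*}
  [∀ i, AddCommGroup (V i)] [∀ i, Module ℂ (V i)]
  [∀ i, AddCommGroup (U i)] [∀ i, Module ℂ (U i)]
  [∀ i, AddCommGroup (C i)] [∀ i, Module ℂ (C i)]

/-- The kernel of a morphism between quotients of a representation as a subquotient. -/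
theorem isomorphic_ker_of_factor {R : DoubleRep V} {T : DoubleRep U} {S : DoubleRep C}
    {K L : SubRep R} (hKL : K ≤ L) (φ : Hom R T) (hφ : φ.Surjective)
    (hK : ∀ i x, φ.toFun i x = 0 ↔ x ∈ K.carrier i) (π : Hom T S)
    (hL : ∀ i x, π.toFun i (φ.toFun i x) = 0 ↔ x ∈ L.carrier i) :
    (SubRep.factor hKL).ker.toRep.Isomorphic π.ker.toRep := by
  let χ : Hom K.quotient T :=
    Hom.ofAct (fun i => (K.carrier i).liftQ (φ.toFun i) fun x hx => (hK i x).2 hx)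
      fun i j d x => by
        obtain ⟨x, rfl⟩ := (K.carrier i).mkQ_surjective x
        rw [K.act_quotient]
        exact φ.comm d x
  have hχ : ∀ i x, χ.toFun i ((K.carrier i).mkQ x) = φ.toFun i x := fun _ _ => rfl
  have hmem : ∀ i (x : V i), (K.carrier i).mkQ x ∈ (SubRep.factor hKL).ker.carrier i ↔
      x ∈ L.carrier i := fun i x => Submodule.Quotient.mk_eq_zero _
  refine Hom.isomorphic_of_injective (χ.comp (SubRep.factor hKL).ker.incl) (fun i => ?_) π.ker
    fun i => ?_
  · rw [injective_iff_map_eq_zero]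
    rintro ⟨x, hx⟩ h0
    obtain ⟨x, rfl⟩ := (K.carrier i).mkQ_surjective x
    rw [Hom.comp_toFun, SubRep.incl_toFun, hχ, hK] at h0
    exact Subtype.ext ((Submodule.Quotient.mk_eq_zero _).2 h0)
  · ext y
    constructor
    · rintro ⟨⟨x, hx⟩, rfl⟩
      obtain ⟨x, rfl⟩ := (K.carrier i).mkQ_surjective x
      exact (hL i x).2 ((hmem i x).1 hx)
    · intro hy
      obtain ⟨x, rfl⟩ := hφ i y
      exact ⟨⟨(K.carrier i).mkQ x, (hmem i x).2 ((hL i x).1 hy)⟩, rfl⟩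

theorem dim_add_eq_of_isomorphic_ker {t' t'' u' u'' v : I → ℕ} {T' : DoubleRep (Cn t')}
    {T'' : DoubleRep (Cn t'')} {S' : DoubleRep (Cn u')} {S'' : DoubleRep (Cn u'')}
    (hu : u' + u'' = v) (π' : Hom T' S') (π'' : Hom S'' T'') (hπ' : π'.Surjective)
    (hπ'' : π''.Surjective) (h : π'.ker.toRep.Isomorphic π''.ker.toRep) : t' + t'' = v := by
  obtain ⟨φ, hφ⟩ := h
  funext i
  have h0 : Module.finrank ℂ (LinearMap.ker (π'.toFun i)) =
      Module.finrank ℂ (LinearMap.ker (π''.toFun i)) :=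
    (LinearEquiv.ofBijective (φ.toFun i) (hφ i)).finrank_eq
  have h1 := LinearMap.finrank_range_add_finrank_ker (π'.toFun i)
  have h2 := LinearMap.finrank_range_add_finrank_ker (π''.toFun i)
  have h3 := congrFun hu i
  rw [LinearMap.range_eq_top.2 (hπ' i)] at h1
  rw [LinearMap.range_eq_top.2 (hπ'' i)] at h2
  simp at h1 h2
  simp only [Pi.add_apply] at h3 ⊢
  omega

end Subquotients

/-! ### The full attracting set -/

section FullAttractingSet

variable {I : Type*} [Quiver I] [Fintype I] [∀ i j : I, Fintype (i ⟶ j)]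
  {W' W'' : I → Type*}
  [∀ i, AddCommGroup (W' i)] [∀ i, Module ℂ (W' i)]
  [∀ i, AddCommGroup (W'' i)] [∀ i, Module ℂ (W'' i)]

namespace MatchingChain

variable {v' v'' v : I → ℕ} {R' : StableRep v' W'} {R'' : StableRep v'' W''}
  {R : StableRep v (FSum W' W'')}
  {f : FramedHom R'.1 R.1 (fun i => LinearMap.inl ℂ (W' i) (W'' i))}
  {g : FramedHom R.1 R''.1 (fun i => LinearMap.snd ℂ (W' i) (W'' i))}
  {k : ℕ} {P : ℕ → ∀ i, Submodule ℂ (Cn v' i)} {Q : ℕ → ∀ i, Submodule ℂ (Cn v i)}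
  {θ : ℕ → ∀ i, Cn v' i →ₗ[ℂ] Cn v i}

/-- `f` vanishes on `P l`, hence so does `B`, and the quotient of `R'` keeps its framing. -/
theorem exists_source_model
    (h : MatchingChain k R'.1.toDoubleRep R.1.toDoubleRep f.toFun g.toFun P Q θ) {l : ℕ}
    (hl : l ≤ k) :
    ∃ (u : I → ℕ) (S : StableRep u W') (φ : FramedHom R'.1 S.1 (fun _ => LinearMap.id)),
      φ.toHom.Surjective ∧ ∀ i x, φ.toFun i x = 0 ↔ x ∈ P l i := by
  refine exists_quotient_model R'.2.1 R'.2.2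
    (SubRep.ofAct (P l) fun i j d x hx => h.P_act l hl d x hx) (fun _ => LinearMap.id)
    (fun _ => LinearMap.id) (fun i w => ?_) fun i x hx => ?_
  · simp
  · have h1 : f.toFun i x = 0 := by
      have := h.P_le hl le_rfl i hx
      rwa [h.P_last] at this
    have h2 := f.comm_B i x
    rw [h1, map_zero] at h2
    exact (congrArg Prod.fst h2).symm

/-- `Q l` lies between the range of `f`, which absorbs the images of `A'`, and the kernel of `g`, on
which `B''` vanishes. So the quotient of `R` is framed by `W''`. -/
theorem exists_target_model
    (h : MatchingChain k R'.1.toDoubleRep R.1.toDoubleRep f.toFun g.toFun P Q θ) {l : ℕ}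
    (hl : l ≤ k) :
    ∃ (u : I → ℕ) (S : StableRep u W'')
      (φ : FramedHom R.1 S.1 (fun i => LinearMap.snd ℂ (W' i) (W'' i))),
      φ.toHom.Surjective ∧ ∀ i x, φ.toFun i x = 0 ↔ x ∈ Q l i := by
  refine exists_quotient_model R.2.1 R.2.2
    (SubRep.ofAct (Q l) fun i j d x hx => h.Q_act l hl d x hx)
    (fun i => LinearMap.snd ℂ (W' i) (W'' i)) (fun i => LinearMap.inr ℂ (W' i) (W'' i))
    (fun i w => ?_) fun i x hx => ?_
  · have h1 : R.1.A i w - R.1.A i (0, w.2) = f.toFun i (R'.1.A i w.1) := by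
      rw [f.comm_A, ← map_sub]
      congr 1
      ext1 <;> simp
    change R.1.A i w - R.1.A i (0, w.2) ∈ Q l i
    rw [h1]
    refine h.Q_le hl le_rfl i ?_
    rw [h.Q_last]
    exact ⟨_, rfl⟩
  · have h1 : g.toFun i x = 0 := by
      have := h.Q_le l.zero_le hl i hx
      rwa [h.Q_zero] at this
    rw [← g.comm_B, h1, map_zero]

variable
  [∀ i, TopologicalSpace (W' i)] [∀ i, IsTopologicalAddGroup (W' i)]
  [∀ i, ContinuousSMul ℂ (W' i)] [∀ i, T2Space (W' i)]
  [∀ i, TopologicalSpace (W'' i)] [∀ i, IsTopologicalAddGroup (W'' i)]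
  [∀ i, ContinuousSMul ℂ (W'' i)] [∀ i, T2Space (W'' i)]

/-- The fixed points defined by the steps of a matching chain are connected by flow lines. -/
theorem models_mem_fullAttr
    (h : MatchingChain k R'.1.toDoubleRep R.1.toDoubleRep f.toFun g.toFun P Q θ)
    (hv : v' + v'' = v) (l : ℕ) (hl : l ≤ k) {u' u'' : I → ℕ} (hu : u' + u'' = v)
    {S' : StableRep u' W'} {S'' : StableRep u'' W''}
    (φ : FramedHom R'.1 S'.1 (fun _ => LinearMap.id))
    (hφ : ∀ i x, φ.toFun i x = 0 ↔ x ∈ P l i)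
    (ψ : FramedHom R.1 S''.1 (fun i => LinearMap.snd ℂ (W' i) (W'' i)))
    (hψ : ∀ i x, ψ.toFun i x = 0 ↔ x ∈ Q l i) :
    (fixedPair hv (Nak.mk R') (Nak.mk R''), Nak.sum hu (Nak.mk S') (Nak.mk S'')) ∈
      fullAttr (Nak v (FSum W' W'')) := by
  induction l generalizing u' u'' with
  | zero =>
    have hφs := φ.surjective S'.2.2 fun _ => Function.surjective_id
    have hgs := g.surjective R''.2.2 fun i => LinearMap.snd_surjective
    have hψs := ψ.surjective S''.2.2 fun i => LinearMap.snd_surjective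
    obtain ⟨χ, hχ⟩ := g.exists_factor hgs (fun i => LinearMap.snd_surjective) ψ
      (fun _ => LinearMap.id) (fun _ _ => rfl) fun i x hx => by
        rw [hψ, h.Q_zero]
        exact hx
    -- As `P 0 = 0` and `Q 0 = Ker g`, the models at step 0 are `R'` and `R''`.
    have h1 : Nak.sum hu (Nak.mk S') (Nak.mk S'') = Nak.sum hv (Nak.mk R') (Nak.mk R'') := by
      refine (Nak.sum_eq_sum_iff hu hv).2 ⟨⟨φ, fun i => ⟨?_, hφs i⟩⟩, ⟨χ, fun i => ⟨?_, ?_⟩⟩⟩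
      · rw [injective_iff_map_eq_zero]
        intro x hx
        rwa [hφ, h.P_zero] at hx
      · rw [injective_iff_map_eq_zero]
        intro z hz
        obtain ⟨y, rfl⟩ := hgs i z
        rwa [hχ, hψ, h.Q_zero] at hz
      · intro z
        obtain ⟨y, rfl⟩ := hψs i z
        exact ⟨_, hχ i y⟩
    rw [h1]
    exact isFullAttracting_fullAttr.diag_mem (fixedPair hv (Nak.mk R') (Nak.mk R''))
  | succ l ih =>
    obtain ⟨t', T', φ₁, hφ₁s, hφ₁⟩ := h.exists_source_model (Nat.le_of_succ_le hl)
    obtain ⟨t'', T'', ψ₁, hψ₁s, hψ₁⟩ := h.exists_target_model (Nat.le_of_succ_le hl)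
    have hφs := φ.surjective S'.2.2 fun _ => Function.surjective_id
    have hψs := ψ.surjective S''.2.2 fun i => LinearMap.snd_surjective
    obtain ⟨π', hπ'⟩ := φ₁.exists_factor hφ₁s (fun _ => Function.surjective_id) φ
      (fun _ => LinearMap.id) (fun _ _ => rfl) fun i x hx => by
        rw [hφ₁] at hx
        rw [hφ]
        exact h.P_mono l hl i hx
    obtain ⟨π'', hπ''⟩ := ψ.exists_factor hψs (fun i => LinearMap.snd_surjective) ψ₁
      (fun _ => LinearMap.id) (fun _ _ => rfl) fun i x hx => by
        rw [hψ] at hx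
        rw [hψ₁]
        exact h.Q_anti l hl i hx
    let SP : ∀ m ≤ k, SubRep R'.1.toDoubleRep := fun m hm =>
      SubRep.ofAct (P m) fun i j d x hx => h.P_act m hm d x hx
    let SQ : ∀ m ≤ k, SubRep R.1.toDoubleRep := fun m hm =>
      SubRep.ofAct (Q m) fun i j d x hx => h.Q_act m hm d x hx
    have hP : SP l (Nat.le_of_succ_le hl) ≤ SP (l + 1) hl := fun i => h.P_mono l hl i
    have hQ : SQ (l + 1) hl ≤ SQ l (Nat.le_of_succ_le hl) := fun i => h.Q_anti l hl i
    have hiso := isomorphic_of_step hP hQ (θ l) (h.θ_mem l hl) (h.θ_mem_iff l hl)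
      (h.θ_surj l hl) (h.θ_act l hl)
    have h' := isomorphic_ker_of_factor hP φ₁.toHom hφ₁s hφ₁ π'.toHom fun i x => by
      rw [hπ', hφ]
      rfl
    have h'' := isomorphic_ker_of_factor hQ ψ.toHom hψs hψ π''.toHom fun i x => by
      rw [hπ'', hψ₁]
      rfl
    have hker : π'.toHom.ker.toRep.Isomorphic π''.toHom.ker.toRep := (h'.symm.trans hiso).trans h''
    have ht := dim_add_eq_of_isomorphic_ker hu π'.toHom π''.toHom
      (π'.surjective S'.2.2 fun _ => Function.surjective_id)
      (π''.surjective T''.2.2 fun _ => Function.surjective_id) hker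
    -- The amalgam `T` tends to the previous fixed point for `t → 0`, which puts its orbit into the
    -- attracting set, and to the next one for `t → ∞`, which follows by closedness. The kernels may
    -- be zero here.
    obtain ⟨T, f₀, g₀, f₁, g₁, hf₀, hgf₀, hf₁, hgf₁, -, -⟩ := exists_amalgam ht π' π'' hker
    have hT := isFullAttracting_fullAttr.attr_mem _ (fixedPair ht (Nak.mk T') (Nak.mk T'')) _
      (ih (Nat.le_of_succ_le hl) ht φ₁ hφ₁ ψ₁ hψ₁)
      ((limZero_sum_iff ht).2 ⟨f₀, g₀, hf₀, hgf₀⟩)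
    have hlim : LimInfty (Nak.mk T) (Nak.sum hu (Nak.mk S') (Nak.mk S'')) :=
      (limInfty_sum_iff hu).2 ⟨f₁, g₁, hf₁, hgf₁⟩
    exact isFullAttracting_fullAttr.isClosed.mem_of_tendsto
      (tendsto_const_nhds.prodMk_nhds hlim)
      (Eventually.of_forall fun t => isFullAttracting_fullAttr.smul_mem t⁻¹ _ _ hT)

/-- `R` is an extension of `V / Im f` by `Im f`, hence attracted to the fixed point reached at the
last step of the chain. -/
theorem mem_fullAttr
    (h : MatchingChain k R'.1.toDoubleRep R.1.toDoubleRep f.toFun g.toFun P Q θ)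
    (hv : v' + v'' = v) :
    (fixedPair hv (Nak.mk R') (Nak.mk R''), Nak.mk R) ∈ fullAttr (Nak v (FSum W' W'')) := by
  obtain ⟨u', S', φ, hφs, hφ⟩ := h.exists_source_model le_rfl
  obtain ⟨u'', S'', ψ, hψs, hψ⟩ := h.exists_target_model le_rfl
  obtain ⟨χ, hχ⟩ := φ.exists_factor hφs (fun _ => Function.surjective_id) f
    (fun i => LinearMap.inl ℂ (W' i) (W'' i)) (fun _ _ => rfl) fun i x hx => by
      rwa [hφ, h.P_last] at hx
  have hχi : ∀ i, Function.Injective (χ.toFun i) := fun i => by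
    rw [injective_iff_map_eq_zero]
    intro y hy
    obtain ⟨x, rfl⟩ := hφs i y
    rw [hχ] at hy
    rw [hφ, h.P_last]
    exact hy
  have hex : ∀ i, LinearMap.range (χ.toFun i) = LinearMap.ker (ψ.toFun i) := fun i => by
    ext y
    rw [LinearMap.mem_ker, hψ, h.Q_last]
    constructor
    · rintro ⟨z, rfl⟩
      obtain ⟨x, rfl⟩ := hφs i z
      exact ⟨x, (hχ i x).symm⟩
    · rintro ⟨x, rfl⟩
      exact ⟨_, hχ i x⟩
  have hu := dim_add_of_exact hχi hψs hex
  refine isFullAttracting_fullAttr.attr_mem _ (fixedPair hu (Nak.mk S') (Nak.mk S'')) _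
    (h.models_mem_fullAttr hv k le_rfl hu φ hφ ψ hψ) ((limZero_sum_iff hu).2
    ⟨χ, ψ, hχi, fun i x => ?_⟩)
  rw [← LinearMap.mem_ker, ← hex]
  exact ⟨x, rfl⟩

end MatchingChain

variable
  [∀ i, TopologicalSpace (W' i)] [∀ i, IsTopologicalAddGroup (W' i)]
  [∀ i, ContinuousSMul ℂ (W' i)] [∀ i, T2Space (W' i)]
  [∀ i, TopologicalSpace (W'' i)] [∀ i, IsTopologicalAddGroup (W'' i)]
  [∀ i, ContinuousSMul ℂ (W'' i)] [∀ i, T2Space (W'' i)]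

theorem exists_fixedPair_eq {v : I → ℕ} (p : MulAction.fixedPoints ℂˣ (Nak v (FSum W' W''))) :
    ∃ (v' v'' : I → ℕ) (hv : v' + v'' = v) (R' : StableRep v' W') (R'' : StableRep v'' W''),
      p = fixedPair hv (Nak.mk R') (Nak.mk R'') := by
  obtain ⟨⟨⟨⟨v', v''⟩, hv⟩, m', m''⟩, rfl⟩ := (bijective_fixedPair v).2 p
  obtain ⟨R', rfl⟩ := Nak.exists_rep m'
  obtain ⟨R'', rfl⟩ := Nak.exists_rep m''
  exact ⟨v', v'', hv, R', R'', rfl⟩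

/-- Since the full attracting set is the smallest one of its kind, this yields the necessity of
matching filtrations. Closedness is the substantial part; the diagonal uses the chain of length 0.
-/
theorem isFullAttracting_matchingRelation (v : I → ℕ) :
    IsFullAttracting {z : MulAction.fixedPoints ℂˣ (Nak v (FSum W' W'')) × Nak v (FSum W' W'') |
      ((z.1 : Nak v (FSum W' W'')), z.2) ∈ matchingRelation W' W'' v} where
  diag_mem p := by
    obtain ⟨v', v'', hv, R', R'', rfl⟩ := exists_fixedPair_eq p
    refine (sum_mk_mem_matchingRelation_iff hv R' R'' (StableRep.sum hv R' R'')).2 ?_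
    exact (HasMatchingComplex.directSum R'.1 R''.1).congr R'.1.idHom
      (fun i => Function.bijective_id) R''.1.idHom (fun i => Function.bijective_id)
      ((R'.1.directSum R''.1).transportHom (sumEquiv hv))
      ((R'.1.directSum R''.1).transportHom_bijective (sumEquiv hv))
  isClosed := by
    rw [← closure_subset_iff_isClosed]
    rintro ⟨p, x⟩ hz
    have h1 := map_mem_closure (f := fun z : MulAction.fixedPoints ℂˣ (Nak v (FSum W' W'')) ×
      Nak v (FSum W' W'') => ((z.1 : Nak v (FSum W' W'')), z.2)) (by fun_prop) hz
      (t := matchingRelation W' W'' v) (fun z hz => hz)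
    obtain ⟨v', v'', hv, R', R'', rfl⟩ := exists_fixedPair_eq p
    obtain ⟨R, rfl⟩ := Nak.exists_rep x
    exact (sum_mk_mem_matchingRelation_iff hv R' R'' R).2
      (mem_matchingRelation_of_mem_closure hv h1)
  smul_mem t p x h := by
    obtain ⟨v', v'', hv, R', R'', rfl⟩ := exists_fixedPair_eq p
    obtain ⟨R, rfl⟩ := Nak.exists_rep x
    have h1 := (sum_mk_mem_matchingRelation_iff hv R' R'' R).1 h
    exact (sum_mk_mem_matchingRelation_iff hv R' R'' (R.twist t)).2 (h1.reframe t)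
  attr_mem p p' x h hx := by
    obtain ⟨v', v'', hv, R', R'', rfl⟩ := exists_fixedPair_eq p
    obtain ⟨u', u'', hu, T', T'', rfl⟩ := exists_fixedPair_eq p'
    obtain ⟨R, rfl⟩ := Nak.exists_rep x
    have h1 := (sum_mk_mem_matchingRelation_iff hv R' R'' (StableRep.sum hu T' T'')).1 h
    have h2 := h1.congr R'.1.idHom (fun i => Function.bijective_id) R''.1.idHom
      (fun i => Function.bijective_id)
      (((T'.1.directSum T''.1).transportHom (sumEquiv hu)).symm
        ((T'.1.directSum T''.1).transportHom_bijective (sumEquiv hu)))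
      (FramedHom.symm_bijective _ _)
    obtain ⟨f₀, g₀, hf₀, hgf₀⟩ := (limZero_sum_iff hu).1 hx
    exact (sum_mk_mem_matchingRelation_iff hv R' R'' R).2
      (h2.of_extension R'.2.2 T'.2.2 T''.2.2 f₀ g₀ hf₀ (range_eq_ker_of_dim hu hf₀
        (g₀.surjective T''.2.2 fun i => LinearMap.snd_surjective) hgf₀))

theorem mem_fullAttr_iff {v' v'' v : I → ℕ} (hv : v' + v'' = v) (R' : StableRep v' W')
    (R'' : StableRep v'' W'') (R : StableRep v (FSum W' W'')) :
    (fixedPair hv (Nak.mk R') (Nak.mk R''), Nak.mk R) ∈ fullAttr (Nak v (FSum W' W'')) ↔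
      ∃ (f : FramedHom R'.1 R.1 (fun i => LinearMap.inl ℂ (W' i) (W'' i)))
        (g : FramedHom R.1 R''.1 (fun i => LinearMap.snd ℂ (W' i) (W'' i)))
        (h : ∀ i x, g.toFun i (f.toFun i x) = 0), MatchingFiltrations f.toHom g.toHom h := by
  constructor
  · intro h
    have h1 := Set.mem_sInter.1 h _ (isFullAttracting_matchingRelation v)
    obtain ⟨f, g, k, P, Q, θ, hm⟩ := (sum_mk_mem_matchingRelation_iff hv R' R'' R).1 h1
    refine ⟨f, g, fun i x => ?_, hm.matchingFiltrations
      (g.surjective R''.2.2 fun i => LinearMap.snd_surjective)⟩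
    have h2 := hm.Q_le k.zero_le le_rfl i
    rw [hm.Q_last, hm.Q_zero] at h2
    exact h2 ⟨x, rfl⟩
  · rintro ⟨f, g, h, hm⟩
    obtain ⟨k, P, Q, θ, hm⟩ := hm.exists_matchingChain
    exact hm.mem_fullAttr hv

end FullAttractingSet

end QuiverVariety

theorem corollary3p7 {I : Type*} [Quiver I] [Fintype I] [∀ i j : I, Fintype (i ⟶ j)]
    (w' w'' v : I → ℕ) :
    -- pairs `([V'], [V''])` are the same as torus fixed points, via `V' ⊕ V''`
    Function.Bijective
      (fun m : (Σ d : {d : (I → ℕ) × (I → ℕ) // d.1 + d.2 = v},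
          Nak d.1.1 (Cn w') × Nak d.1.2 (Cn w'')) =>
        fixedPair m.1.2 m.2.1 m.2.2) ∧
    -- closed flow lines from `(Ṽ', Ṽ'') = (S', S'')` to `(V', V'') = (R', R'')`
    (∀ (u' u'' v' v'' : I → ℕ) (hu : u' + u'' = v) (hv : v' + v'' = v)
        (S' : StableRep u' (Cn w')) (S'' : StableRep u'' (Cn w''))
        (R' : StableRep v' (Cn w')) (R'' : StableRep v'' (Cn w'')),
      (ClosedFlowLine
          (fixedPair hu (Nak.mk S') (Nak.mk S'') : Nak v (FSum (Cn w') (Cn w'')))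
          (fixedPair hv (Nak.mk R') (Nak.mk R'')) ↔
        ∃ (π' : FramedHom R'.1 S'.1 (fun _ => LinearMap.id))
          (π'' : FramedHom S''.1 R''.1 (fun _ => LinearMap.id)),
          π'.toHom.Surjective ∧ π''.toHom.Surjective ∧
          π'.toHom.ker.toRep.Isomorphic π''.toHom.ker.toRep ∧ π'.toHom.ker ≠ ⊥) ∧
      (ClosedFlowLine
          (fixedPair hu (Nak.mk S') (Nak.mk S'') : Nak v (FSum (Cn w') (Cn w'')))
          (fixedPair hv (Nak.mk R') (Nak.mk R'')) ↔
        ∃ n : I → ℕ, n ≠ 0 ∧ v' = u' + n ∧ u'' = v'' + n ∧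
          ∃ (ν' : NPoint u' v' n (Cn w')) (ν'' : NPoint v'' u'' n (Cn w'')),
            ν'.piMinus = Nak.mk S' ∧ ν'.piPlus = Nak.mk R' ∧
            ν''.piMinus = Nak.mk R'' ∧ ν''.piPlus = Nak.mk S'' ∧ ν'.p = ν''.p)) ∧
    -- the full attracting set
    (∀ (v' v'' : I → ℕ) (hv : v' + v'' = v)
        (R' : StableRep v' (Cn w')) (R'' : StableRep v'' (Cn w''))
        (R : StableRep v (FSum (Cn w') (Cn w''))),
      (fixedPair hv (Nak.mk R') (Nak.mk R''), Nak.mk R) ∈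
          fullAttr (Nak v (FSum (Cn w') (Cn w''))) ↔
        ∃ (f : FramedHom R'.1 R.1 (fun i => LinearMap.inl ℂ (Cn w' i) (Cn w'' i)))
          (g : FramedHom R.1 R''.1 (fun i => LinearMap.snd ℂ (Cn w' i) (Cn w'' i)))
          (h : ∀ i x, g.toFun i (f.toFun i x) = 0),
          MatchingFiltrations f.toHom g.toHom h) := by
  refine ⟨bijective_fixedPair v, fun u' u'' v' v'' hu hv S' S'' R' R'' => ?_,
    fun v' v'' hv R' R'' R => mem_fullAttr_iff hv R' R'' R⟩
  have h := closedFlowLine_iff hu hv S' S'' R' R''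
  exact ⟨h, h.trans (exists_surjections_iff S' S'' R' R'')⟩
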